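/- **Setting.** Let $r>0$, let $C=C([-r,0],\mathbb R^n)$ carry the supremum norm, and for a function $x$ put $x_t(\omega)=x(t+\omega)$, $\omega\in[-r,0]$. Let $L(t):C\to\mathbb R^n$, $t\in\mathbb R$, be continuous linear operators, measurable in $t$, with $\|L(t)\|\le m(t)$ for some $m\in L^1_{loc}(\mathbb R)$. Solutions are absolutely continuous on bounded subintervals of $[s,\infty)$ and satisfy the equation almost everywhere. Let $T(t,s)\phi=x_t$ ($t\ge s$, $\phi\in C$), where $x$ solves $x'(t)=L(t)x_t$, $x_s=\phi$. Let $C_0$ be the space of functions $[-r,0]\to\mathbb R^n$ that are continuous on $[-r,0)$ and have a limit as $\omega\to0^-$, with the supremum norm. Let $T_0(t,s)\phi=x_t$ for $\phi\in C_0$, where $L(t)$ is extended to discontinuous functions by its Riesz representation $L(t)\phi=\int d\eta(t,\omega)\,\phi(\omega)$. (For $s<t<s+r$ the segment $x_t$ may jump at $\omega=s-t$; it is a bounded function, and its size is measured by the supremum norm.) Let $(X_0p)(\omega)=0$ for $\omega\in[-r,0)$ and $(X_0p)(0)=p$. A differentiable growth rate is a differentiable, strictly increasing $\mu:\mathbb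 R\to(0,\infty)$ with $\mu(0)=1$, $\mu(t)\to\infty$ as $t\to\infty$ and $\mu(t)\to0$ as $t\to-\infty$. **(H1)** $\mu$ is a differentiable growth rate and $\mu(s+r)/\mu(s)\le N$ for all $s$, for some $N>1$. There are constants $K\ge1$, $\alpha,\beta>0$, $\theta,\nu\ge0$, $\alpha>\theta$, $\beta>\nu$, and strongly continuous bounded projections $P(s)$, $Q(s)=I-P(s)$ on $C$, $s\in\mathbb R$, with $U(s)=\operatorname{Im}Q(s)$, such that $T(t,s)P(s)=P(t)T(t,s)$ for $t\ge s$; $\overline T(t,s)=T(t,s)|_{U(s)}:U(s)\to U(t)$ is an isomorphism for $t\ge s$, with inverse denoted by $\overline T(s,t)$; and $$\|T(t,s)P(s)\|\le K\Big(\tfrac{\mu(t)}{\mu(s)}\Big)^{-\alpha}\mu(s)^{\operatorname{sgn}(s)\theta}\ (t\ge s),\qquad \|\overline T(t,s)Q(s)\|\le K\Big(\tfrac{\mu(t)}{\mu(s)}\Big)^{\beta}\mu(s)^{\operatorname{sgn}(s)\nu}\ (t\le s).$$ There are $\tilde K\ge1$, $a\ge0$, $\varepsilon>0$ with $\|T_0(t,s)\|\le\tilde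 K(\mu(t)/\mu(s))^{a}\mu(s)^{\operatorname{sgn}(s)\varepsilon}$ for $t\ge s$. Finally $\theta\ge\varepsilon+\nu$, $\alpha>\theta+\varepsilon$, $\beta>\nu+\varepsilon$. Put $Q_0(t)=\overline T(t,t+r)Q(t+r)T_0(t+r,t)X_0$ and $P_0(t)=X_0-Q_0(t)$. **Theorem.** Assume (H1). (A) There is a constant $D\ge K$ such that $$\|T_0(t,s)P_0(s)\|\le D\Big(\tfrac{\mu(t)}{\mu(s)}\Big)^{-\alpha}\mu(s)^{\operatorname{sgn}(s)(\theta+\varepsilon)}\ (t\ge s),\qquad \|\overline T(t,s)Q_0(s)\|\le D\Big(\tfrac{\mu(t)}{\mu(s)}\Big)^{\beta}\mu(s)^{\operatorname{sgn}(s)(\nu+\varepsilon)}\ (t\le s).\tag{1}$$ (B) Let $D\ge K$ be any constant for which (1) holds. Let $g:\mathbb R\times C\to\mathbb R^n$ be of class $C^1$ with $g(t,0)=0$ and $D_2g(t,0)=0$ for all $t$. Let $\delta,\lambda,q>0$, $\gamma>\max\{\theta,\nu\}$ and $\max\{\nu+\varepsilon,|a-\beta|+\varepsilon\}<\xi<\frac{\alpha+\beta}2$.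 Write $\|x\|_\mu=\|x\|\,\mu(t)^{-\operatorname{sgn}(t)(\xi+\varepsilon)}$ at time $t$, and suppose that for all $t\in\mathbb R$ and $\phi,\psi\in C$ $$|g(t,\phi)-g(t,\psi)|\le\delta\min\{1,\|\phi-\psi\|_\mu\}\,\mu'(t)\mu(t)^{-\operatorname{sgn}(t)(\gamma+\varepsilon)-1},$$ $$|D_2g(t,\phi)-D_2g(t,\psi)|\le\lambda\min\{1,\|\phi-\psi\|_\mu\}\,\mu'(t)\mu(t)^{-\operatorname{sgn}(t)(\gamma+\varepsilon)-2\operatorname{sgn}(t)\xi-1},$$ and that $$\delta\le\frac{q\alpha\beta}{D(\alpha+\beta)(1+q)^2},\qquad \lambda\le\frac{q^2(\alpha+\beta-2\xi)\left[(\xi-\varepsilon)^2-(a-\beta)^2\right]}{D\left[D\left((\xi-\varepsilon)^2-(a-\beta)^2\right)+4\xi\tilde K(\alpha+\beta-2\xi)\right](1+q)^3}.$$ Let $R(t,s)\phi=x_t$, where $x$ solves $x'(t)=L(t)x_t+g(t,x_t)$, $x_s=\phi$. Let $\mathcal M$ be the set of bounded continuous $\eta:\{(t,b):t\in\mathbb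 R,\ b\in U(t)\}\to C$. Let $\mathcal B$ be the set of continuous $\eta$ on the same set that are $C^1$ in $b$ and satisfy $\sup_{t,b}\|\eta(t,b)\|_\mu+\sup_{t,b}\|\frac{\partial\eta}{\partial b}(t,b)\|_\mu\le q$. Put $\eta^t=\eta(t,\cdot)$, $h^t=\mathrm{Id}_{U(t)}+\eta^t:U(t)\to C$, and $$F(\eta)(t,b)=\int_{-\infty}^tT_0(t,\tau)P_0(\tau)g\big(\tau,h^\tau(\overline T(\tau,t)b)\big)d\tau-\int_t^{\infty}\overline T(t,\tau)Q_0(\tau)g\big(\tau,h^\tau(T(\tau,t)b)\big)d\tau,$$ the integrals being taken in $\mathbb R^n$ at each $\omega\in[-r,0]$. Then these integrals converge absolutely for every $\eta\in\mathcal B$, and $F$ has a unique fixed point $\eta$ in $\mathcal B$. This $\eta$ belongs to $\mathcal M$, and it is the unique element of $\mathcal M$ such that $$h^t\circ T(t,s)=R(t,s)\circ h^s\quad\text{on }U(s),\qquad\text{for all }t\ge s.$$ Moreover each $h^t$ is a $C^1$ diffeomorphism of $U(t)$ onto its image $h^t(U(t))\subset C$ (it is injective and $C^1$, and near each point of the image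 its inverse is the restriction of a $C^1$ map defined on an open subset of $C$). -/

import Mathlib

namespace DelayConj

open MeasureTheory Set Filter Topology

noncomputable section

/-- The Euclidean space `ℝⁿ`. -/
abbrev E (n : ℕ) : Type := EuclideanSpace ℝ (Fin n)

/-- The delay interval `[-r, 0]`. -/
abbrev I (r : ℝ) : Type := Icc (-r) (0 : ℝ)

/-- The phase space `C = C([-r, 0], ℝⁿ)` with the supremum norm. All instances below are those of
Mathlib's `C(I r, E n)`. -/
def C (r : ℝ) (n : ℕ) : Type := C(I r, E n)

instance (r : ℝ) (n : ℕ) : NormedAddCommGroup (C r n) :=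
  inferInstanceAs (NormedAddCommGroup C(I r, E n))

instance (r : ℝ) (n : ℕ) : NormedSpace ℝ (C r n) :=
  inferInstanceAs (NormedSpace ℝ C(I r, E n))

instance (r : ℝ) (n : ℕ) : CompleteSpace (C r n) :=
  inferInstanceAs (CompleteSpace C(I r, E n))

instance (r : ℝ) (n : ℕ) : FunLike (C r n) (I r) (E n) :=
  inferInstanceAs (FunLike C(I r, E n) (I r) (E n))

instance (r : ℝ) (n : ℕ) : ContinuousMapClass (C r n) (I r) (E n) :=
  inferInstanceAs (ContinuousMapClass C(I r, E n) (I r) (E n))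

/-- The element of `C` given by a continuous function. -/
def C.mk {r : ℝ} {n : ℕ} (ψ : I r → E n) (h : Continuous ψ) : C r n :=
  (⟨ψ, h⟩ : C(I r, E n))

/-- The element of `C` given by a history function, if that function is continuous
(the value `0` is never used otherwise). -/
def toC {r : ℝ} {n : ℕ} (ψ : I r → E n) : C r n := by
  classical
  exact if h : Continuous ψ then C.mk ψ h else 0

theorem toC_apply {r : ℝ} {n : ℕ} {ψ : I r → E n} (h : Continuous ψ) (ω : I r) :
    toC ψ ω = ψ ω := by
  unfold toC
  rw [dif_pos h]
  rfl

/-- The segment `x_t(ω) = x(t + ω)`, `ω ∈ [-r, 0]`. -/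
def seg {n : ℕ} (r : ℝ) (x : ℝ → E n) (t : ℝ) : I r → E n := fun ω => x (t + ω)

/-- Standing assumptions on the family `L(t) : C → ℝⁿ` of continuous linear operators:
it is (strongly Lebesgue) measurable in `t`, and its norm is dominated by some
`m ∈ L¹_loc(ℝ)`. -/
def Admissible {r : ℝ} {n : ℕ} (L : ℝ → C r n →L[ℝ] E n) : Prop :=
  (∀ φ : C r n, AEStronglyMeasurable (fun t => L t φ) volume) ∧
  ∃ m : ℝ → ℝ, LocallyIntegrable m volume ∧ ∀ t, ‖L t‖ ≤ m t

/-! ### Riesz extension to discontinuous histories -/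

/-- Integral of a function against a signed measure. -/
def sintegral {r : ℝ} (ν : SignedMeasure (I r)) (f : I r → ℝ) : ℝ :=
  (∫ ω, f ω ∂ν.toJordanDecomposition.posPart) - ∫ ω, f ω ∂ν.toJordanDecomposition.negPart

/-- The matrix of signed measures `ν` represents `Λ : C → ℝⁿ`, that is,
`Λ φ = ∫ dν(ω) φ(ω)` for all `φ ∈ C`. -/
def Represents {r : ℝ} {n : ℕ} (Λ : C r n →L[ℝ] E n)
    (ν : Fin n → Fin n → SignedMeasure (I r)) : Prop :=
  ∀ (φ : C r n) (i : Fin n), Λ φ i = ∑ j, sintegral (ν i j) (fun ω => φ ω j)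

/-- The matrix of signed measures that represents `Λ` (Riesz). -/
def rieszMeasure {r : ℝ} {n : ℕ} (Λ : C r n →L[ℝ] E n) :
    Fin n → Fin n → SignedMeasure (I r) :=
  Classical.epsilon (Represents Λ)

/-- The extension `ψ ↦ ∫ dν(ω) ψ(ω)` of `Λ` to bounded Borel histories. -/
def extendOp {r : ℝ} {n : ℕ} (Λ : C r n →L[ℝ] E n) (ψ : I r → E n) : E n :=
  WithLp.toLp 2 (fun i => ∑ j, sintegral (rieszMeasure Λ i j) (fun ω => ψ ω j))

/-- The space `C₀`: histories that are continuous on `[-r, 0)` and have a limit as `ω → 0⁻`. -/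
def MemC0 {r : ℝ} {n : ℕ} (ψ : I r → E n) : Prop :=
  ContinuousOn ψ {ω | (ω : ℝ) < 0} ∧
  ∃ l, Tendsto ψ (comap (fun ω : I r => (ω : ℝ)) (𝓝[<] 0)) (𝓝 l)

/-! ### Solutions and solution operators -/

/-- `x` solves `x'(t) = f(t, x_t)`, `t ≥ s`, with `x_s = ψ`: it is absolutely continuous on
bounded subintervals of `[s, ∞)` and satisfies the equation almost everywhere there. Only the
values of `x` on `[s - r, ∞)` matter. -/
def IsSolution {r : ℝ} {n : ℕ} (f : ℝ → (I r → E n) → E n) (s : ℝ) (ψ : I r → E n)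
    (x : ℝ → E n) : Prop :=
  seg r x s = ψ ∧
  (∀ b, s ≤ b → AbsolutelyContinuousOnInterval x s b) ∧
  ∀ᵐ t ∂volume, s < t → HasDerivAt x (f t (seg r x t)) t

/-- The solution of `x'(t) = f(t, x_t)`, `x_s = ψ`. -/
def solution {r : ℝ} {n : ℕ} (f : ℝ → (I r → E n) → E n) (s : ℝ) (ψ : I r → E n) : ℝ → E n :=
  Classical.epsilon (IsSolution f s ψ)

/-- The solution operator `T(t, s) : C → C`, `t ≥ s`, of `x' = L(t) x_t`. -/
def T {r : ℝ} {n : ℕ} (L : ℝ → C r n →L[ℝ] E n) (t s : ℝ) (φ : C r n) : C r n :=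
  toC (seg r (solution (fun u ψ => L u (toC ψ)) s φ) t)

/-- The operator `T₀(t, s)`, `t ≥ s`, on `C₀`: it sends `ψ ∈ C₀` to `x_t`, where `x` is the
solution with `x_s = ψ` of the linear equation extended by the Riesz integral. For
`s < t < s + r` the segment `x_t` may jump at `ω = s - t`, so it is kept as a plain function. -/
def T0 {r : ℝ} {n : ℕ} (L : ℝ → C r n →L[ℝ] E n) (t s : ℝ) (ψ : I r → E n) : I r → E n :=
  seg r (solution (fun u χ => extendOp (L u) χ) s ψ) t

/-- The solution operator `R(t, s) : C → C`, `t ≥ s`, of `x' = L(t) x_t + g(t, x_t)`. -/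
def R {r : ℝ} {n : ℕ} (L : ℝ → C r n →L[ℝ] E n) (g : ℝ → C r n → E n) (t s : ℝ)
    (φ : C r n) : C r n :=
  toC (seg r (solution (fun u ψ => L u (toC ψ) + g u (toC ψ)) s φ) t)

/-! ### Growth rates and dichotomies -/

/-- Differentiable growth rates. -/
structure IsDiffGrowthRate (μ : ℝ → ℝ) : Prop where
  pos : ∀ t, 0 < μ t
  strictMono : StrictMono μ
  map_zero : μ 0 = 1
  tendsto_atTop : Tendsto μ atTop atTop
  tendsto_atBot : Tendsto μ atBot (𝓝 0)
  differentiable : Differentiable ℝ μ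

/-- The weight `μ(t)^{sgn(t) c}`. -/
def wt (μ : ℝ → ℝ) (c t : ℝ) : ℝ := μ t ^ (Real.sign t * c)

/-- The complementary projection `Q(t) = Id - P(t)`. -/
def Q {r : ℝ} {n : ℕ} (P : ℝ → C r n →L[ℝ] C r n) (t : ℝ) : C r n →L[ℝ] C r n :=
  ContinuousLinearMap.id ℝ (C r n) - P t

/-- The unstable subspace `U(t)`, the range of `Q(t)`. -/
def U {r : ℝ} {n : ℕ} (P : ℝ → C r n →L[ℝ] C r n) (t : ℝ) : Submodule ℝ (C r n) :=
  LinearMap.range (Q P t : C r n →ₗ[ℝ] C r n)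

/-- `Q(t)` as a map onto `U(t)`. -/
def toU {r : ℝ} {n : ℕ} (P : ℝ → C r n →L[ℝ] C r n) (t : ℝ) (φ : C r n) : U P t :=
  ⟨Q P t φ, LinearMap.mem_range.2 ⟨φ, rfl⟩⟩

/-- The map `T̄(t, s) : U(s) → U(t)`: the restriction of `T(t, s)` if `s ≤ t`, and the inverse of
`T(s, t) : U(t) → U(s)` if `t < s`. -/
def Tbar {r : ℝ} {n : ℕ} (L : ℝ → C r n →L[ℝ] E n) (P : ℝ → C r n →L[ℝ] C r n) (t s : ℝ)
    (b : U P s) : U P t := by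
  classical
  exact Classical.epsilon (fun c : U P t =>
    if s ≤ t then (c : C r n) = T L t s b else T L s t c = (b : C r n))

/-- The equation `x' = L(t) x_t` has a nonuniform `μ`-dichotomy on `ℝ` with projections `P(s)`. -/
structure HasMuDichotomy {r : ℝ} {n : ℕ} (L : ℝ → C r n →L[ℝ] E n) (μ : ℝ → ℝ)
    (K α β θ ν : ℝ) (P : ℝ → C r n →L[ℝ] C r n) : Prop where
  one_le_K : 1 ≤ K
  alpha_pos : 0 < α
  beta_pos : 0 < β
  theta_nonneg : 0 ≤ θ
  nu_nonneg : 0 ≤ ν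
  theta_lt : θ < α
  nu_lt : ν < β
  proj : ∀ s φ, P s (P s φ) = P s φ
  stronglyContinuous : ∀ φ, Continuous (fun s => P s φ)
  comm : ∀ s t, s ≤ t → ∀ φ, T L t s (P s φ) = P t (T L t s φ)
  iso : ∀ s t, s ≤ t → BijOn (T L t s) (U P s : Set (C r n)) (U P t : Set (C r n))
  stable : ∀ s t, s ≤ t → ∀ φ,
    ‖T L t s (P s φ)‖ ≤ K * (μ t / μ s) ^ (-α) * wt μ θ s * ‖φ‖
  unstable : ∀ s t, t ≤ s → ∀ φ,
    ‖(Tbar L P t s (toU P s φ) : C r n)‖ ≤ K * (μ t / μ s) ^ β * wt μ ν s * ‖φ‖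

/-- Nonuniform `μ`-bounded growth of `T₀(t, s)`, `t ≥ s`, as an operator on `C₀` with the
supremum norm. -/
def HasBoundedGrowth {r : ℝ} {n : ℕ} (L : ℝ → C r n →L[ℝ] E n) (μ : ℝ → ℝ)
    (Kt a ε : ℝ) : Prop :=
  ∀ s t, s ≤ t → ∀ (ψ : I r → E n) (M : ℝ), MemC0 ψ → (∀ ω, ‖ψ ω‖ ≤ M) →
    ∀ ω, ‖T0 L t s ψ ω‖ ≤ Kt * (μ t / μ s) ^ (Real.sign (t - s) * a) * wt μ ε s * M

/-! ### The operators `X₀`, `P₀`, `Q₀` -/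

/-- `X₀ p` is the history that vanishes on `[-r, 0)` and equals `p` at `0`. -/
def X0 {r : ℝ} {n : ℕ} (p : E n) : I r → E n := by
  classical
  exact fun ω => if (ω : ℝ) = 0 then p else 0

/-- `Q₀(t) = T̄(t, t + r) Q(t + r) T₀(t + r, t) X₀`. -/
def Q0 {r : ℝ} {n : ℕ} (L : ℝ → C r n →L[ℝ] E n) (P : ℝ → C r n →L[ℝ] C r n) (t : ℝ)
    (p : E n) : U P t :=
  Tbar L P t (t + r) (toU P (t + r) (toC (T0 L (t + r) t (X0 p))))

/-- `P₀(t) = X₀ - Q₀(t)`. -/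
def P0 {r : ℝ} {n : ℕ} (L : ℝ → C r n →L[ℝ] E n) (P : ℝ → C r n →L[ℝ] C r n) (t : ℝ)
    (p : E n) : I r → E n :=
  fun ω => X0 p ω - (Q0 L P t p : C r n) ω

/-- The bound `‖T₀(t,s) P₀(s)‖ ≤ D (μ(t)/μ(s))^{-α} μ(s)^{sgn(s)(θ+ε)}` for `t ≥ s`. -/
def StableBound {r : ℝ} {n : ℕ} (L : ℝ → C r n →L[ℝ] E n) (P : ℝ → C r n →L[ℝ] C r n)
    (μ : ℝ → ℝ) (α θ ε D : ℝ) : Prop :=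
  ∀ s t, s ≤ t → ∀ (p : E n) (ω : I r),
    ‖T0 L t s (P0 L P s p) ω‖ ≤ D * (μ t / μ s) ^ (-α) * wt μ (θ + ε) s * ‖p‖

/-- The bound `‖T̄(t,s) Q₀(s)‖ ≤ D (μ(t)/μ(s))^β μ(s)^{sgn(s)(ν+ε)}` for `t ≤ s`. -/
def UnstableBound {r : ℝ} {n : ℕ} (L : ℝ → C r n →L[ℝ] E n) (P : ℝ → C r n →L[ℝ] C r n)
    (μ : ℝ → ℝ) (β ν ε D : ℝ) : Prop :=
  ∀ s t, t ≤ s → ∀ p : E n,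
    ‖(Tbar L P t s (Q0 L P s p) : C r n)‖ ≤ D * (μ t / μ s) ^ β * wt μ (ν + ε) s * ‖p‖

/-! ### The perturbation -/

/-- The norm `‖x‖_μ = ‖x‖ μ(t)^{-sgn(t)(ξ+ε)}` at time `t`. -/
def normMu {V : Type*} [NormedAddCommGroup V] (μ : ℝ → ℝ) (ξ ε t : ℝ) (x : V) : ℝ :=
  ‖x‖ * μ t ^ (-Real.sign t * (ξ + ε))

/-- Weighted Lipschitz bound on `g`. -/
def GBound {r : ℝ} {n : ℕ} (μ : ℝ → ℝ) (ξ ε γ δ : ℝ) (g : ℝ → C r n → E n) : Prop :=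
  ∀ t φ ψ, ‖g t φ - g t ψ‖ ≤
    δ * min 1 (normMu μ ξ ε t (φ - ψ)) * deriv μ t * μ t ^ (-Real.sign t * (γ + ε) - 1)

/-- Weighted Lipschitz bound on `D₂g`. -/
def DGBound {r : ℝ} {n : ℕ} (μ : ℝ → ℝ) (ξ ε γ lam : ℝ) (g : ℝ → C r n → E n) : Prop :=
  ∀ t φ ψ, ‖fderiv ℝ (g t) φ - fderiv ℝ (g t) ψ‖ ≤
    lam * min 1 (normMu μ ξ ε t (φ - ψ)) * deriv μ t *
      μ t ^ (-Real.sign t * (γ + ε) - 2 * Real.sign t * ξ - 1)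

/-! ### Function spaces and the operator `F` -/

/-- Functions `η(t, b) ∈ C`, defined for `t ∈ ℝ` and `b ∈ U(t)`. -/
abbrev Fam {r : ℝ} {n : ℕ} (P : ℝ → C r n →L[ℝ] C r n) : Type := (t : ℝ) → U P t → C r n

/-- Continuity of `η` on `{(t, b) : t ∈ ℝ, b ∈ U(t)} ⊆ ℝ × C`. -/
def JointContinuous {r : ℝ} {n : ℕ} {P : ℝ → C r n →L[ℝ] C r n} (η : Fam P) : Prop :=
  Continuous (fun p : {p : ℝ × C r n // p.2 ∈ U P p.1} => η p.1.1 ⟨p.1.2, p.2⟩)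

/-- The space `𝓜` of bounded continuous `η`. -/
def MemM {r : ℝ} {n : ℕ} {P : ℝ → C r n →L[ℝ] C r n} (η : Fam P) : Prop :=
  JointContinuous η ∧ ∃ M : ℝ, ∀ t b, ‖η t b‖ ≤ M

/-- `‖η‖_{1,μ}`: the sum of the suprema of `‖η(t,b)‖_μ` and of `‖∂η/∂b(t,b)‖_μ`. -/
def norm1 {r : ℝ} {n : ℕ} {P : ℝ → C r n →L[ℝ] C r n} (μ : ℝ → ℝ) (ξ ε : ℝ)
    (η : Fam P) : ENNReal :=
  (⨆ (t : ℝ) (b : U P t), ENNReal.ofReal (normMu μ ξ ε t (η t b))) +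
  ⨆ (t : ℝ) (b : U P t), ENNReal.ofReal (normMu μ ξ ε t (fderiv ℝ (η t) b))

/-- The closed ball `𝓑` of radius `q` in the space `𝓜¹` of functions `η` that are continuous,
`C¹` in `b`, and have finite norm `‖η‖_{1,μ}`. -/
def MemBall {r : ℝ} {n : ℕ} {P : ℝ → C r n →L[ℝ] C r n} (μ : ℝ → ℝ) (ξ ε q : ℝ)
    (η : Fam P) : Prop :=
  JointContinuous η ∧ (∀ t, ContDiff ℝ 1 (η t)) ∧ norm1 μ ξ ε η ≤ ENNReal.ofReal q

/-- The map `h^t = Id + η^t : U(t) → C`. -/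
def hmap {r : ℝ} {n : ℕ} {P : ℝ → C r n →L[ℝ] C r n} (η : Fam P) (t : ℝ) (b : U P t) : C r n :=
  (b : C r n) + η t b

/-- `T₀(t,τ) P₀(τ) g(τ, T̄(τ,t)b + η(τ, T̄(τ,t)b))`, evaluated at `ω`. -/
def stableIntegrand {r : ℝ} {n : ℕ} (L : ℝ → C r n →L[ℝ] E n) (P : ℝ → C r n →L[ℝ] C r n)
    (g : ℝ → C r n → E n) (η : Fam P) (t : ℝ) (b : U P t) (ω : I r) (τ : ℝ) : E n :=
  T0 L t τ (P0 L P τ (g τ (hmap η τ (Tbar L P τ t b)))) ω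

/-- `T̄(t,τ) Q₀(τ) g(τ, T(τ,t)b + η(τ, T(τ,t)b))`, evaluated at `ω`. -/
def unstableIntegrand {r : ℝ} {n : ℕ} (L : ℝ → C r n →L[ℝ] E n) (P : ℝ → C r n →L[ℝ] C r n)
    (g : ℝ → C r n → E n) (η : Fam P) (t : ℝ) (b : U P t) (ω : I r) (τ : ℝ) : E n :=
  (Tbar L P t τ (Q0 L P τ (g τ (hmap η τ (Tbar L P τ t b)))) : C r n) ω

/-- The operator `F`. As always in the variation of constants formula for delay equations, the
integrals are taken in `ℝⁿ` for each `ω ∈ [-r, 0]`. -/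
def F {r : ℝ} {n : ℕ} (L : ℝ → C r n →L[ℝ] E n) (P : ℝ → C r n →L[ℝ] C r n)
    (g : ℝ → C r n → E n) (η : Fam P) (t : ℝ) (b : U P t) (ω : I r) : E n :=
  (∫ τ in Iic t, stableIntegrand L P g η t b ω τ) - ∫ τ in Ioi t, unstableIntegrand L P g η t b ω τ

/-- Both integrals in `F(η)` converge absolutely. -/
def FConverges {r : ℝ} {n : ℕ} (L : ℝ → C r n →L[ℝ] E n) (P : ℝ → C r n →L[ℝ] C r n)
    (g : ℝ → C r n → E n) (η : Fam P) : Prop :=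
  ∀ (t : ℝ) (b : U P t) (ω : I r),
    IntegrableOn (stableIntegrand L P g η t b ω) (Iic t) volume ∧
    IntegrableOn (unstableIntegrand L P g η t b ω) (Ioi t) volume

/-- `F(η) = η`. -/
def IsFixedPoint {r : ℝ} {n : ℕ} (L : ℝ → C r n →L[ℝ] E n) (P : ℝ → C r n →L[ℝ] C r n)
    (g : ℝ → C r n → E n) (η : Fam P) : Prop :=
  ∀ (t : ℝ) (b : U P t) (ω : I r), F L P g η t b ω = η t b ω

/-- `h^t ∘ T(t, s) = R(t, s) ∘ h^s` on `U(s)` for all `t ≥ s`. -/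
def Conjugates {r : ℝ} {n : ℕ} (L : ℝ → C r n →L[ℝ] E n) (P : ℝ → C r n →L[ℝ] C r n)
    (g : ℝ → C r n → E n) (η : Fam P) : Prop :=
  ∀ s t, s ≤ t → ∀ b : U P s, hmap η t (Tbar L P t s b) = R L g t s (hmap η s b)

/-- `h : V → W` is a `C¹` diffeomorphism of `V` onto its image `h(V) ⊆ W`: it is injective and
`C¹`, and its inverse `h(V) → V` is `C¹`, i.e. near each point of `h(V)` it is the restriction of
a `C¹` map defined on an open subset of `W`. -/
def IsC1DiffeoOntoImage {V W : Type*} [NormedAddCommGroup V] [NormedSpace ℝ V]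
    [NormedAddCommGroup W] [NormedSpace ℝ W] (h : V → W) : Prop :=
  Function.Injective h ∧ ContDiff ℝ 1 h ∧
  ∀ b : V, ∃ (O : Set W) (k : W → V), IsOpen O ∧ h b ∈ O ∧ ContDiffOn ℝ 1 k O ∧
    ∀ b' : V, h b' ∈ O → k (h b') = b'

end

end DelayConj

/-!
All rates are read through `ℓ = log μ` (`ell`): ratios `(μ(t)/μ(s))^p` become `e^{p(ℓ(t) - ℓ(s))}`,
the factors `μ(t)^{sgn(t) c}` become `e^{c|ℓ(t)|}`, and `μ'(t)/μ(t) = ℓ'(t)` is the density for which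
the substitution `u = ℓ(τ)` turns every kernel integral below into an elementary one
(`integrable_expKer`).

**The operators `T₀ X₀`.** By the Riesz theorem each `L(t)` extends to discontinuous functions, and
the extension is continuous along bounded pointwise limits (`extendOp_tendsto`). Hence `T₀(t, τ) X₀ p`
consists of segments of the fundamental solution `fund`, which is the pointwise limit of solutions
with continuous initial histories `bump` (`T0_add_X0`, `tendsto_lsol_bump`). This limit also carries
measurability, and it gives the variation of constants formula (`linSol_voc`).

**The bounds for `T₀ P₀` and `T̄ Q₀`.** After one delay the segment of the fundamental solution lies
in `C`, where the dichotomy applies; what happens during that delay costs at most a factor that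
depends on `sup μ(s + r)/μ(s)` (`exists_bounds`).

**Fixed points are conjugacies.** Let `f` be a forcing term that is integrable against the kernel
dominating `T₀ P₀` and `T̄ Q₀`. The Green operator
`f ↦ ∫_{-∞}^t T₀(t,τ) P₀(τ) f(τ) dτ - ∫_t^∞ T̄(t,τ) Q₀(τ) f(τ) dτ` produces a solution of
`x' = L(t) x_t + f(t)` on `ℝ` (`Ctx.linSol_greenSol`). The dichotomy with `θ < α` and `ν < β` leaves no
nonzero bounded solution of the homogeneous equation on `ℝ` (`Ctx.eq_zero_of_bounded`), so this
solution is the only one that stays at bounded distance from a given homogeneous one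
(`Ctx.eq_greenC_of_bounded`). Now `F(η)(t, b)` is the Green operator applied to
`τ ↦ g(τ, h^τ(T̄(τ,t) b))` (`Pert.F_eq`). A continuous fixed point therefore turns orbits in `U` into
orbits of the perturbed equation (`Pert.orbit_of_fixedPoint`). Conversely, along an orbit of a bounded
conjugacy, `η` is a bounded solution of the forced linear equation, hence equals the Green operator of
its forcing term, and the conjugacy is a fixed point (`Pert.fixedPoint_of_conjugates`).

**Existence and uniqueness.** The kernel integrals give `A = Dδ(1/α + 1/β)` as a bound of `F(η)` and
as a Lipschitz constant of `F` for the supremum norm; with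
`B = Dλ(K/(α+β) + K̃/(ξ-ε+β-a))`, the weighted norm of `∂F(η)/∂b` is at most `(1+q)B`. The
hypotheses on `δ` and `λ` say that `A(1+q)² ≤ q` and `B(1+q)³ ≤ q²`. So `F` maps the ball `𝓑` into
itself and contracts `‖η‖_μ + ‖∂η/∂b‖_μ` with factor `q/(1+q)` (`Pert.contraction`), and its Picard
iterates converge to a `C¹` fixed point (`Pert.exists_fixedPoint`). Since `A < 1`, the fixed point is
unique even among merely continuous `η` (`Pert.fixedPoint_unique`), which yields uniqueness in `𝓑` and,
by the correspondence above, uniqueness of the conjugacy in `𝓜`.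

**Diffeomorphisms.** The unit ball of `U(t)` is the image of a bounded set under the compact operator
`T(t, t - r)`, so `U(t)` is finite-dimensional (`finiteDimensional_U`). If `h^t b = h^t b'`, then the
conjugacy bounds `T(τ,t)(b - b')` for `τ ≥ t`, which forces `b = b'` (`Pert.hmap_injective`). If
`Dh^t(b) x = 0`, then `Dh^τ(T(τ,t) b) T(τ,t) x = 0` for all `τ ≥ t`, because `R(τ,t)` is Lipschitz; the
linearized forcing term then vanishes after time `t`, so `T(τ,t) x` is bounded and `x = 0`
(`Pert.fderiv_hmap_injective`). An injective immersion of a finite-dimensional space at bounded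
distance from the inclusion is a diffeomorphism onto its image, by the inverse function theorem
(`isC1DiffeoOntoImage_of_immersion`).
-/

namespace DelayConj

open MeasureTheory Set Filter Topology
open scoped NNReal CompactlySupported

/-! ### Signed Riesz representation and the extension of functionals -/

section Riesz

set_option linter.unusedSectionVars false

variable {X : Type*} [TopologicalSpace X] [CompactSpace X]

/-- A nonnegative continuous function seen as a real one. -/
def realOf (f : C(X, ℝ≥0)) : C(X, ℝ) := ⟨fun x => f x, by fun_prop⟩

/-- The values `Λ g` for `0 ≤ g ≤ f`. -/
def minorantValues (Λ : C(X, ℝ) →L[ℝ] ℝ) (f : C(X, ℝ)) : Set ℝ :=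
  {x | ∃ g : C(X, ℝ), 0 ≤ g ∧ g ≤ f ∧ x = Λ g}

/-- The positive part `Λ⁺ f = sup {Λ g : 0 ≤ g ≤ f}` of a bounded functional, for `f ≥ 0`. -/
noncomputable def posVar (Λ : C(X, ℝ) →L[ℝ] ℝ) (f : C(X, ℝ)) : ℝ := sSup (minorantValues Λ f)

variable (Λ : C(X, ℝ) →L[ℝ] ℝ)

theorem bddAbove_minorantValues (f : C(X, ℝ)) : BddAbove (minorantValues Λ f) := by
  refine ⟨‖Λ‖ * ‖f‖, ?_⟩
  rintro _ ⟨g, hg0, hgf, rfl⟩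
  refine (le_abs_self _).trans ((Λ.le_opNorm g).trans ?_)
  gcongr
  refine (ContinuousMap.norm_le _ (norm_nonneg _)).2 fun x => ?_
  have h1 : 0 ≤ g x := hg0 x
  have h2 : g x ≤ f x := hgf x
  have h3 := f.norm_coe_le_norm x
  rw [Real.norm_eq_abs] at *
  rw [abs_of_nonneg h1]
  exact h2.trans ((le_abs_self _).trans h3)

theorem le_posVar {f g : C(X, ℝ)} (h0 : 0 ≤ g) (hf : g ≤ f) : Λ g ≤ posVar Λ f :=
  le_csSup (bddAbove_minorantValues Λ f) ⟨g, h0, hf, rfl⟩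

theorem posVar_le {f : C(X, ℝ)} (hf : 0 ≤ f) {c : ℝ}
    (h : ∀ g : C(X, ℝ), 0 ≤ g → g ≤ f → Λ g ≤ c) : posVar Λ f ≤ c := by
  refine csSup_le ⟨_, 0, le_rfl, hf, rfl⟩ ?_
  rintro _ ⟨g, h0, h1, rfl⟩
  exact h g h0 h1

theorem posVar_nonneg {f : C(X, ℝ)} (hf : 0 ≤ f) : 0 ≤ posVar Λ f := by
  simpa using le_posVar Λ le_rfl hf

theorem posVar_add {f₁ f₂ : C(X, ℝ)} (h₁ : 0 ≤ f₁) (h₂ : 0 ≤ f₂) :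
    posVar Λ (f₁ + f₂) = posVar Λ f₁ + posVar Λ f₂ := by
  apply le_antisymm
  · refine posVar_le Λ (add_nonneg h₁ h₂) fun g h0 hg => ?_
    -- Riesz decomposition: `g = g ⊓ f₁ + (g - g ⊓ f₁)`
    have e : Λ g = Λ (g ⊓ f₁) + Λ (g - g ⊓ f₁) := by rw [← map_add]; congr 1; abel
    rw [e]
    refine add_le_add (le_posVar Λ (le_inf h0 h₁) inf_le_right) (le_posVar Λ ?_ ?_)
    · exact sub_nonneg.2 inf_le_left
    · intro x
      have : g x ≤ f₁ x + f₂ x := hg x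
      have h2 : 0 ≤ f₂ x := h₂ x
      change g x - g x ⊓ f₁ x ≤ f₂ x
      rcases le_total (g x) (f₁ x) with h | h
      · rw [inf_eq_left.2 h]; linarith
      · rw [inf_eq_right.2 h]; linarith
  · rw [← le_sub_iff_add_le]
    refine posVar_le Λ h₁ fun g h0 hg => ?_
    rw [le_sub_comm]
    refine posVar_le Λ h₂ fun g' h0' hg' => ?_
    rw [le_sub_iff_add_le, ← map_add]
    exact le_posVar Λ (add_nonneg h0' h0) (by rw [add_comm]; exact add_le_add hg hg')

theorem mul_posVar_le {f : C(X, ℝ)} (hf : 0 ≤ f) {c : ℝ} (hc : 0 < c) :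
    c * posVar Λ f ≤ posVar Λ (c • f) := by
  rw [← le_div_iff₀' hc]
  refine posVar_le Λ hf fun g h0 hg => ?_
  rw [le_div_iff₀' hc, ← smul_eq_mul, ← map_smul]
  exact le_posVar Λ (smul_nonneg hc.le h0) (smul_le_smul_of_nonneg_left hg hc.le)

theorem posVar_smul {f : C(X, ℝ)} (hf : 0 ≤ f) {c : ℝ} (hc : 0 < c) :
    posVar Λ (c • f) = c * posVar Λ f := by
  refine le_antisymm ?_ (mul_posVar_le Λ hf hc)
  have h := mul_posVar_le Λ (smul_nonneg hc.le hf) (inv_pos.2 hc)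
  rw [smul_smul, inv_mul_cancel₀ hc.ne', one_smul] at h
  rwa [inv_mul_le_iff₀ hc] at h

/-- An additive, positively homogeneous, nonnegative function on the positive cone of `C(X)` is
integration against a finite measure. -/
theorem exists_measure_of_cone [T2Space X] [MeasurableSpace X] [BorelSpace X]
    (p : C(X, ℝ) → ℝ) (h0 : ∀ f, 0 ≤ f → 0 ≤ p f)
    (hadd : ∀ f g, 0 ≤ f → 0 ≤ g → p (f + g) = p f + p g)
    (hsmul : ∀ (c : ℝ) f, 0 < c → 0 ≤ f → p (c • f) = c * p f) :
    ∃ m : Measure X, IsFiniteMeasure m ∧ ∀ f : C(X, ℝ), 0 ≤ f → ∫ x, f x ∂m = p f := by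
  have hp0 : p 0 = 0 := by
    have := hadd 0 0 le_rfl le_rfl
    rw [add_zero] at this
    linarith
  have hr : ∀ f : C_c(X, ℝ≥0), 0 ≤ realOf f.toContinuousMap := fun f x => (f x).2
  let Φ : C_c(X, ℝ≥0) →ₗ[ℝ≥0] ℝ≥0 :=
    { toFun := fun f => ⟨p (realOf f.toContinuousMap), h0 _ (hr f)⟩
      map_add' := by
        intro f g
        apply NNReal.eq
        exact hadd _ _ (hr f) (hr g)
      map_smul' := by
        intro c f
        apply NNReal.eq
        rcases eq_or_ne c 0 with rfl | hc
        · change p (realOf ((0 : ℝ≥0) • f).toContinuousMap) = ((0 : ℝ≥0) : ℝ) * _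
          rw [NNReal.coe_zero, zero_mul, ← hp0]
          congr 1
          ext x
          simp [realOf]
        · exact hsmul c _ (by positivity) (hr f) }
  refine ⟨NNRealRMK.rieszMeasure Φ, ⟨isCompact_univ.measure_lt_top⟩, fun f hf => ?_⟩
  have := NNRealRMK.integral_rieszMeasure Φ
    (CompactlySupportedContinuousMap.continuousMapEquiv ⟨fun x => Real.toNNReal (f x), by fun_prop⟩)
  have e : ∀ x, ((Real.toNNReal (f x) : ℝ≥0) : ℝ) = f x := fun x => Real.coe_toNNReal _ (hf x)
  have e2 : (Φ (CompactlySupportedContinuousMap.continuousMapEquiv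
      ⟨fun x => Real.toNNReal (f x), by fun_prop⟩) : ℝ) = p f := by
    change p _ = p f
    congr 1
    ext x
    exact e x
  rw [← e2, ← this]
  exact integral_congr_ae (Eventually.of_forall fun x => (e x).symm)

/-- Every bounded functional on `C(X)` is a difference of two finite measures. -/
theorem exists_measures [T2Space X] [MeasurableSpace X] [BorelSpace X] :
    ∃ m₁ m₂ : Measure X, IsFiniteMeasure m₁ ∧ IsFiniteMeasure m₂ ∧
      ∀ f : C(X, ℝ), Λ f = ∫ x, f x ∂m₁ - ∫ x, f x ∂m₂ := by
  obtain ⟨m₁, hm₁, h₁⟩ := exists_measure_of_cone (posVar Λ) (fun f => posVar_nonneg Λ)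
    (fun f g => posVar_add Λ) (fun c f hc hf => posVar_smul Λ hf hc)
  obtain ⟨m₂, hm₂, h₂⟩ := exists_measure_of_cone (fun f => posVar Λ f - Λ f)
    (fun f hf => sub_nonneg.2 (le_posVar Λ hf le_rfl))
    (fun f g hf hg => by simp only [posVar_add Λ hf hg, map_add]; ring)
    (fun c f hc hf => by simp only [posVar_smul Λ hf hc, map_smul, smul_eq_mul]; ring)
  refine ⟨m₁, m₂, hm₁, hm₂, fun f => ?_⟩
  have hi : ∀ (m : Measure X) [IsFiniteMeasure m] (g : C(X, ℝ)), Integrable (fun x => g x) m :=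
    fun m _ g => g.continuous.integrable_of_hasCompactSupport (HasCompactSupport.of_compactSpace _)
  have hpos : 0 ≤ f ⊔ 0 := le_sup_right
  have hneg : 0 ≤ (f ⊔ 0) - f := sub_nonneg.2 le_sup_left
  have e : f = (f ⊔ 0) - ((f ⊔ 0) - f) := by abel
  have key : ∀ (m : Measure X) [IsFiniteMeasure m], ∫ x, f x ∂m =
      ∫ x, (f ⊔ 0) x ∂m - ∫ x, ((f ⊔ 0) - f) x ∂m := by
    intro m _
    rw [← integral_sub (hi m _) (hi m _)]
    congr 1
    ext x
    simp
  rw [key m₁, key m₂, h₁ _ hpos, h₁ _ hneg, h₂ _ hpos, h₂ _ hneg]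
  conv_lhs => rw [e, map_sub]
  ring

end Riesz

section Extension

variable {r : ℝ} {n : ℕ}

/-- The `j`-th unit vector of `ℝⁿ`. -/
noncomputable def unitVec {n : ℕ} (j : Fin n) : E n := EuclideanSpace.basisFun (Fin n) ℝ j

theorem unitVec_apply (j k : Fin n) : unitVec j k = if k = j then 1 else 0 := by
  simp [unitVec, PiLp.single_apply]

theorem sum_smul_unitVec (p : E n) : ∑ j, p j • unitVec j = p := by
  ext k
  simp [unitVec_apply]

theorem norm_unitVec (j : Fin n) : ‖(unitVec j : E n)‖ = 1 := by simp [unitVec]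

theorem sintegral_sub_toSignedMeasure (m₁ m₂ : Measure (I r)) [IsFiniteMeasure m₁]
    [IsFiniteMeasure m₂] {f : I r → ℝ} (hf : Continuous f) :
    sintegral (m₁.toSignedMeasure - m₂.toSignedMeasure) f = ∫ ω, f ω ∂m₁ - ∫ ω, f ω ∂m₂ := by
  set s := m₁.toSignedMeasure - m₂.toSignedMeasure with hs
  have hi : ∀ (m : Measure (I r)) [IsFiniteMeasure m], Integrable f m :=
    fun m _ => hf.integrable_of_hasCompactSupport (HasCompactSupport.of_compactSpace _)
  have h := SignedMeasure.toSignedMeasure_toJordanDecomposition s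
  rw [JordanDecomposition.toSignedMeasure] at h
  have h2 : (s.toJordanDecomposition.posPart + m₂).toSignedMeasure =
      (m₁ + s.toJordanDecomposition.negPart).toSignedMeasure := by
    rw [Measure.toSignedMeasure_add, Measure.toSignedMeasure_add]
    rw [sub_eq_iff_eq_add] at h
    rw [h, hs]
    abel
  rw [Measure.toSignedMeasure_eq_toSignedMeasure_iff] at h2
  have h3 : ∫ ω, f ω ∂(s.toJordanDecomposition.posPart + m₂) =
      ∫ ω, f ω ∂(m₁ + s.toJordanDecomposition.negPart) := by rw [h2]
  rw [integral_add_measure (hi _) (hi _), integral_add_measure (hi _) (hi _)] at h3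
  unfold sintegral
  linarith

/-- Riesz representation of a bounded operator `C → ℝⁿ` by a matrix of signed measures: each scalar
component is a difference of two positive functionals. -/
theorem exists_represents (Λ : C r n →L[ℝ] E n) : ∃ ν, Represents Λ ν := by
  have key : ∀ i j : Fin n, ∃ ν : SignedMeasure (I r), ∀ f : C(I r, ℝ),
      Λ (C.mk (fun ω => f ω • unitVec j)
        (f.continuous.smul continuous_const)) i
        = sintegral ν (fun ω => f ω) := by
    intro i j
    let ιl : C(I r, ℝ) →ₗ[ℝ] C r n :=
      { toFun := fun f => C.mk (fun ω => f ω • unitVec j)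
          (f.continuous.smul continuous_const)
        map_add' := fun f g => by
          apply DFunLike.ext; intro ω
          exact add_smul _ _ _
        map_smul' := fun c f => by
          apply DFunLike.ext; intro ω
          exact mul_smul _ _ _ }
    let ι : C(I r, ℝ) →L[ℝ] C r n := ιl.mkContinuous 1 (by
      intro f
      rw [one_mul]
      refine (ContinuousMap.norm_le (α := I r) (E := E n) _ (norm_nonneg _)).2 fun ω => ?_
      change ‖(f ω • unitVec j : E n)‖ ≤ _
      rw [norm_smul, norm_unitVec, mul_one]
      exact f.norm_coe_le_norm ω)
    obtain ⟨m₁, m₂, h₁, h₂, h⟩ := exists_measures (((EuclideanSpace.proj i : E n →L[ℝ] ℝ) ∘L Λ) ∘L ι)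
    refine ⟨m₁.toSignedMeasure - m₂.toSignedMeasure, fun f => ?_⟩
    rw [sintegral_sub_toSignedMeasure _ _ f.continuous, ← h f]
    rfl
  choose ν hν using key
  refine ⟨ν, fun φ i => ?_⟩
  have hc : ∀ j, Continuous (fun ω => φ ω j) := fun j =>
    (EuclideanSpace.proj j : E n →L[ℝ] ℝ).continuous.comp (map_continuous φ)
  -- `φ` is the sum of its coordinate functions, to which the entries of the matrix apply
  have e : φ = ∑ j, C.mk (fun ω => φ ω j • unitVec j)
      ((hc j).smul continuous_const) := by
    apply DFunLike.ext; intro ω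
    have : ∀ s : Finset (Fin n), (∑ j ∈ s, C.mk (fun ω => φ ω j • unitVec j)
      ((hc j).smul continuous_const) : C r n) ω = ∑ j ∈ s, φ ω j • unitVec j := by
      intro s
      induction s using Finset.cons_induction with
      | empty => rfl
      | cons a s ha ih =>
        rw [Finset.sum_cons, Finset.sum_cons, ← ih]
        rfl
    rw [this, sum_smul_unitVec]
  have h1 : ∀ j, Λ (C.mk (fun ω => φ ω j • unitVec j)
      ((hc j).smul continuous_const)) i = sintegral (ν i j) (fun ω => φ ω j) :=
    fun j => hν i j ⟨fun ω => φ ω j, hc j⟩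
  conv_lhs => rw [e, map_sum]
  rw [WithLp.ofLp_sum, Finset.sum_apply]
  exact Finset.sum_congr rfl fun j _ => h1 j

theorem norm_apply_le (φ : C r n) (ω : I r) : ‖φ ω‖ ≤ ‖φ‖ :=
  ContinuousMap.norm_coe_le_norm (α := I r) (E := E n) φ ω

theorem C_norm_le {φ : C r n} {M : ℝ} (hM : 0 ≤ M) (h : ∀ ω, ‖φ ω‖ ≤ M) : ‖φ‖ ≤ M :=
  (ContinuousMap.norm_le (α := I r) (E := E n) _ hM).2 h

/-- The Riesz extension is continuous along bounded pointwise limits of continuous histories. All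
other properties of `extendOp` follow from this one. -/
theorem extendOp_tendsto (Λ : C r n →L[ℝ] E n) {φ : ℕ → C r n} {ψ : I r → E n} {M : ℝ}
    (hM : ∀ k, ‖φ k‖ ≤ M) (hφ : ∀ ω, Tendsto (fun k => φ k ω) atTop (𝓝 (ψ ω))) :
    Tendsto (fun k => Λ (φ k)) atTop (𝓝 (extendOp Λ ψ)) := by
  have hrep : Represents Λ (rieszMeasure Λ) := Classical.epsilon_spec (exists_represents Λ)
  have hc : ∀ k j, Continuous (fun ω => φ k ω j) := fun k j =>
    (EuclideanSpace.proj j : E n →L[ℝ] ℝ).continuous.comp (map_continuous (φ k))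
  have hb : ∀ k j ω, ‖φ k ω j‖ ≤ M := fun k j ω =>
    (PiLp.norm_apply_le (φ k ω) j).trans ((norm_apply_le _ _).trans (hM k))
  have hl : ∀ j ω, Tendsto (fun k => φ k ω j) atTop (𝓝 (ψ ω j)) := fun j ω =>
    ((EuclideanSpace.proj j : E n →L[ℝ] ℝ).continuous.tendsto _).comp (hφ ω)
  have hint : ∀ (m : Measure (I r)) [IsFiniteMeasure m] (j : Fin n),
      Tendsto (fun k => ∫ ω, φ k ω j ∂m) atTop (𝓝 (∫ ω, ψ ω j ∂m)) := fun m _ j =>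
    tendsto_integral_of_dominated_convergence (fun _ => M)
      (fun k => (hc k j).aestronglyMeasurable) (integrable_const _)
      (fun k => Eventually.of_forall (hb k j)) (Eventually.of_forall (hl j))
  have : Tendsto (fun k => (WithLp.toLp 2 (fun i => ∑ j, sintegral (rieszMeasure Λ i j)
      (fun ω => φ k ω j)) : E n)) atTop (𝓝 (extendOp Λ ψ)) := by
    refine ((PiLp.continuous_toLp 2 _).tendsto _).comp (tendsto_pi_nhds.2 fun i => ?_)
    exact tendsto_finsetSum _ fun j _ => (hint _ j).sub (hint _ j)
  refine this.congr fun k => ?_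
  ext i
  exact (hrep (φ k) i).symm

theorem extendOp_coe (Λ : C r n →L[ℝ] E n) (φ : C r n) : extendOp Λ (fun ω => φ ω) = Λ φ :=
  tendsto_nhds_unique (extendOp_tendsto Λ (φ := fun _ => φ) (M := ‖φ‖) (fun _ => le_rfl)
    fun _ => tendsto_const_nhds) tendsto_const_nhds

/-- A history that is the pointwise limit of a bounded sequence of continuous histories. -/
def BddLimit (M : ℝ) (ψ : I r → E n) : Prop :=
  ∃ φ : ℕ → C r n, (∀ k, ‖φ k‖ ≤ M) ∧ ∀ ω, Tendsto (fun k => φ k ω) atTop (𝓝 (ψ ω))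

theorem bddLimit_coe (φ : C r n) : BddLimit ‖φ‖ (fun ω => φ ω) :=
  ⟨fun _ => φ, fun _ => le_rfl, fun _ => tendsto_const_nhds⟩

theorem BddLimit.norm_extendOp_le {M : ℝ} {ψ : I r → E n} (h : BddLimit M ψ)
    (Λ : C r n →L[ℝ] E n) : ‖extendOp Λ ψ‖ ≤ ‖Λ‖ * M := by
  obtain ⟨φ, hM, hφ⟩ := h
  refine le_of_tendsto (extendOp_tendsto Λ hM hφ).norm (Eventually.of_forall fun k => ?_)
  exact (Λ.le_opNorm _).trans (by gcongr; exact hM k)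

theorem BddLimit.add {M M' : ℝ} {ψ ψ' : I r → E n} (h : BddLimit M ψ) (h' : BddLimit M' ψ') :
    BddLimit (M + M') (fun ω => ψ ω + ψ' ω) := by
  obtain ⟨φ, hM, hφ⟩ := h
  obtain ⟨φ', hM', hφ'⟩ := h'
  exact ⟨fun k => φ k + φ' k, fun k => (norm_add_le _ _).trans (add_le_add (hM k) (hM' k)),
    fun ω => (hφ ω).add (hφ' ω)⟩

theorem BddLimit.extendOp_add {M M' : ℝ} {ψ ψ' : I r → E n} (h : BddLimit M ψ)
    (h' : BddLimit M' ψ') (Λ : C r n →L[ℝ] E n) :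
    extendOp Λ (fun ω => ψ ω + ψ' ω) = extendOp Λ ψ + extendOp Λ ψ' := by
  obtain ⟨φ, hM, hφ⟩ := h
  obtain ⟨φ', hM', hφ'⟩ := h'
  have h1 := extendOp_tendsto Λ (φ := fun k => φ k + φ' k)
    (fun k => (norm_add_le _ _).trans (add_le_add (hM k) (hM' k))) fun ω => (hφ ω).add (hφ' ω)
  refine tendsto_nhds_unique h1 ?_
  simp only [map_add]
  exact (extendOp_tendsto Λ hM hφ).add (extendOp_tendsto Λ hM' hφ')

end Extension

/-! ### Carathéodory delay equations -/

section Weight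

/-- The primitive `Λ(t) = ∫ₛ^{max(s,t)} k`. The weight `e^{2Λ}` turns integral inequalities with
kernel `k` into contractions with factor `1/2`. -/
noncomputable def Lam (k : ℝ → ℝ) (s t : ℝ) : ℝ := ∫ u in s..max s t, k u

variable {k : ℝ → ℝ}

theorem locInt_interval {F : Type*} [NormedAddCommGroup F] {k : ℝ → F}
    (hk : LocallyIntegrable k volume) (a b : ℝ) : IntervalIntegrable k volume a b :=
  intervalIntegrable_iff.mpr ((hk.integrableOn_isCompact isCompact_uIcc).mono_set uIoc_subset_uIcc)

theorem continuous_Lam (hk : LocallyIntegrable k volume) (s : ℝ) : Continuous (Lam k s) :=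
  (intervalIntegral.continuous_primitive (fun a b => locInt_interval hk a b) s).comp
    (continuous_const.max continuous_id)

theorem Lam_mono (hk : LocallyIntegrable k volume) (h0 : ∀ u, 0 ≤ k u) (s : ℝ) :
    Monotone (Lam k s) := by
  intro t t' h
  have h1 := intervalIntegral.integral_add_adjacent_intervals
    (locInt_interval hk s (max s t)) (locInt_interval hk (max s t) (max s t'))
  have h2 : 0 ≤ ∫ u in max s t..max s t', k u :=
    intervalIntegral.integral_nonneg (max_le_max le_rfl h) fun u _ => h0 u
  unfold Lam
  linarith

theorem Lam_of_le (s : ℝ) {t : ℝ} (h : t ≤ s) : Lam k s t = 0 := by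
  simp [Lam, max_eq_left h]

theorem Lam_nonneg (h0 : ∀ u, 0 ≤ k u) (s t : ℝ) : 0 ≤ Lam k s t :=
  intervalIntegral.integral_nonneg (le_max_left _ _) fun u _ => h0 u

theorem intervalIntegrable_mul_weight (hk : LocallyIntegrable k volume) (s a b : ℝ) :
    IntervalIntegrable (fun u => k u * Real.exp (2 * Lam k s u)) volume a b :=
  (locInt_interval hk a b).mul_continuousOn
    (by have := continuous_Lam hk s; fun_prop)

theorem integral_mul_weight_le (hk : LocallyIntegrable k volume) (h0 : ∀ u, 0 ≤ k u) {s t : ℝ}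
    (hst : s ≤ t) :
    ∫ u in s..t, k u * Real.exp (2 * Lam k s u) ≤ Real.exp (2 * Lam k s t) / 2 := by
  have hmono : Monotone (fun t => Real.exp (2 * Lam k s t)) := fun a b h =>
    Real.exp_le_exp.2 (by have := Lam_mono hk h0 s h; linarith)
  have h1 := (hmono.monotoneOn (uIcc s t)).intervalIntegral_deriv_mem_uIcc
  have hsub : 0 ≤ Real.exp (2 * Lam k s t) - Real.exp (2 * Lam k s s) := sub_nonneg.2 (hmono hst)
  rw [uIcc_of_le hsub] at h1
  have h2 : ∫ u in s..t, deriv (fun t => Real.exp (2 * Lam k s t)) u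
      = ∫ u in s..t, 2 * (k u * Real.exp (2 * Lam k s u)) := by
    refine intervalIntegral.integral_congr_ae ?_
    filter_upwards [LocallyIntegrable.ae_hasDerivAt_integral hk] with u hu hus
    rw [uIoc_of_le hst] at hus
    have h3 : HasDerivAt (Lam k s) (k u) u := by
      refine (hu s).congr_of_eventuallyEq ?_
      filter_upwards [lt_mem_nhds hus.1] with v hv
      rw [Lam, max_eq_right hv.le]
    have h4 := (h3.const_mul 2).exp
    rw [h4.deriv]
    ring
  rw [h2, intervalIntegral.integral_const_mul] at h1
  have := Real.exp_pos (2 * Lam k s s)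
  linarith [h1.2]

/-- Grönwall's inequality with an `L¹` kernel, in the weighted form: a bound of `d` by the weight
`M e^{2Λ}` that reproduces itself with factor `1/2` yields `‖d‖ ≤ 2 c e^{2Λ}`. -/
theorem weighted_gronwall {F : Type*} [NormedAddCommGroup F] (hk : LocallyIntegrable k volume)
    (h0 : ∀ u, 0 ≤ k u) {d : ℝ → F} {s b c : ℝ} (hc : 0 ≤ c) (hd : ContinuousOn d (Icc s b))
    (H : ∀ t ∈ Icc s b, ∀ M, c ≤ M → (∀ v ∈ Icc s t, ‖d v‖ ≤ M * Real.exp (2 * Lam k s v)) →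
      ‖d t‖ ≤ c + M * Real.exp (2 * Lam k s t) / 2) :
    ∀ t ∈ Icc s b, ‖d t‖ ≤ 2 * c * Real.exp (2 * Lam k s t) := by
  intro t ht
  have hcont : ContinuousOn (fun v => ‖d v‖ * Real.exp (-(2 * Lam k s v))) (Icc s b) :=
    hd.norm.mul (by have := continuous_Lam hk s; fun_prop)
  obtain ⟨t', ht', hmax⟩ := isCompact_Icc.exists_isMaxOn ⟨t, ht⟩ hcont
  set M := ‖d t'‖ * Real.exp (-(2 * Lam k s t')) with hM
  have key : ∀ v ∈ Icc s b, ‖d v‖ ≤ M * Real.exp (2 * Lam k s v) := by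
    intro v hv
    have := hmax hv
    simp only [mem_ofPred_eq] at this
    calc ‖d v‖ = ‖d v‖ * Real.exp (-(2 * Lam k s v)) * Real.exp (2 * Lam k s v) := by
          rw [mul_assoc, ← Real.exp_add]; simp
      _ ≤ _ := by gcongr
  have hle : M ≤ 2 * c := by
    rcases le_total c M with h | h
    · have h1 := H t' ht' M h fun v hv => key v ⟨hv.1, hv.2.trans ht'.2⟩
      have h2 : ‖d t'‖ = M * Real.exp (2 * Lam k s t') := by
        rw [hM, mul_assoc, ← Real.exp_add]; simp
      have h3 : 1 ≤ Real.exp (2 * Lam k s t') :=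
        Real.one_le_exp (by have := Lam_nonneg h0 s t'; linarith)
      have h4 : 0 ≤ M := by positivity
      nlinarith
    · linarith
  exact (key t ht).trans (by gcongr)

end Weight

section Segments

variable {r : ℝ} {n : ℕ}

/-- The segment `x_t` as an element of `C`. -/
noncomputable def sg (r : ℝ) {n : ℕ} (x : ℝ → E n) (t : ℝ) : C r n := toC (seg r x t)

theorem continuous_seg {x : ℝ → E n} (hx : Continuous x) (t : ℝ) : Continuous (seg r x t) := by
  unfold seg; fun_prop

theorem sg_apply {x : ℝ → E n} (hx : Continuous x) (t : ℝ) (ω : I r) : sg r x t ω = x (t + ω) :=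
  toC_apply (continuous_seg hx t) ω

theorem continuous_sg {x : ℝ → E n} (hx : Continuous x) : Continuous (sg r x) := by
  have : sg r x = fun t => (ContinuousMap.curry
      ⟨fun p : ℝ × I r => x (p.1 + p.2), by fun_prop⟩ t : C(I r, E n)) := by
    funext t
    exact DFunLike.ext _ _ fun ω => sg_apply hx t ω
  rw [this]
  exact (ContinuousMap.curry (⟨fun p : ℝ × I r => x (p.1 + p.2), by fun_prop⟩ :
    C(ℝ × I r, E n))).continuous

theorem norm_sg_le {x : ℝ → E n} (hx : Continuous x) {t M : ℝ} (hM : 0 ≤ M)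
    (h : ∀ v ∈ Icc (t - r) t, ‖x v‖ ≤ M) : ‖sg r x t‖ ≤ M := by
  refine C_norm_le hM fun ω => ?_
  rw [sg_apply hx]
  exact h _ ⟨by linarith [ω.2.1], by linarith [ω.2.2]⟩

theorem sg_congr {x y : ℝ → E n} {t : ℝ} (h : ∀ v ∈ Icc (t - r) t, x v = y v) :
    sg r x t = sg r y t := by
  unfold sg
  congr 1
  funext ω
  exact h _ ⟨by linarith [ω.2.1], by linarith [ω.2.2]⟩

theorem sg_sub {x y : ℝ → E n} (hx : Continuous x) (hy : Continuous y) (t : ℝ) :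
    sg r (fun v => x v - y v) t = sg r x t - sg r y t := by
  refine DFunLike.ext _ _ fun ω => ?_
  rw [sg_apply (x := fun v => x v - y v) (hx.sub hy)]
  change _ = sg r x t ω - sg r y t ω
  rw [sg_apply hx, sg_apply hy]

theorem sg_add {x y : ℝ → E n} (hx : Continuous x) (hy : Continuous y) (t : ℝ) :
    sg r (fun v => x v + y v) t = sg r x t + sg r y t := by
  refine DFunLike.ext _ _ fun ω => ?_
  rw [sg_apply (x := fun v => x v + y v) (hx.add hy)]
  change _ = sg r x t ω + sg r y t ω
  rw [sg_apply hx, sg_apply hy]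

theorem sg_smul {x : ℝ → E n} (hx : Continuous x) (c : ℝ) (t : ℝ) :
    sg r (fun v => c • x v) t = c • sg r x t := by
  refine DFunLike.ext _ _ fun ω => ?_
  rw [sg_apply (x := fun v => c • x v) (hx.const_smul c)]
  change _ = c • sg r x t ω
  rw [sg_apply hx]

/-- The endpoint `ω = 0`. -/
def zeroI (hr : 0 ≤ r) : I r := ⟨0, by simp [hr], le_rfl⟩

/-- The history `φ` continued by constants on both sides. -/
noncomputable def hist (hr : 0 ≤ r) (φ : C r n) (v : ℝ) : E n := φ (projIcc (-r) 0 (by linarith) v)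

theorem continuous_hist (hr : 0 ≤ r) (φ : C r n) : Continuous (hist hr φ) :=
  (map_continuous φ).comp continuous_projIcc

theorem hist_coe (hr : 0 ≤ r) (φ : C r n) (ω : I r) : hist hr φ ω = φ ω := by
  unfold hist; rw [projIcc_val]

theorem hist_of_nonneg (hr : 0 ≤ r) (φ : C r n) {v : ℝ} (hv : 0 ≤ v) :
    hist hr φ v = φ (zeroI hr) := by
  unfold hist; rw [projIcc_of_right_le _ hv]; rfl

theorem norm_hist_le (hr : 0 ≤ r) (φ : C r n) (v : ℝ) : ‖hist hr φ v‖ ≤ ‖φ‖ := norm_apply_le _ _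

end Segments

section Caratheodory

variable {r : ℝ} {n : ℕ}

/-- Carathéodory conditions for a right-hand side `f : ℝ × C → ℝⁿ`, Lipschitz in the history with a
locally integrable constant `k`. -/
structure Cara (f : ℝ → C r n → E n) (k : ℝ → ℝ) : Prop where
  meas : ∀ Y : ℝ → C r n, Continuous Y → AEStronglyMeasurable (fun u => f u (Y u)) volume
  int : LocallyIntegrable k volume
  nonneg : ∀ u, 0 ≤ k u
  lip : ∀ u φ ψ, ‖f u φ - f u ψ‖ ≤ k u * ‖φ - ψ‖
  zero : ∀ u, ‖f u 0‖ ≤ k u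

variable {f : ℝ → C r n → E n} {k : ℝ → ℝ}

theorem Cara.norm_le (hf : Cara f k) (u : ℝ) (φ : C r n) : ‖f u φ‖ ≤ k u * (‖φ‖ + 1) := by
  have h1 := hf.lip u φ 0
  have h2 := hf.zero u
  rw [sub_zero] at h1
  calc ‖f u φ‖ = ‖(f u φ - f u 0) + f u 0‖ := by rw [sub_add_cancel]
    _ ≤ _ := (norm_add_le _ _).trans (by linarith)

theorem Cara.locallyIntegrable (hf : Cara f k) {Y : ℝ → C r n} (hY : Continuous Y) :
    LocallyIntegrable (fun u => f u (Y u)) volume := by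
  have h1 : LocallyIntegrable (fun u => k u * (‖Y u‖ + 1)) volume := by
    simp_rw [mul_comm (k _)]
    exact hf.int.continuous_smul (f := k) (g := fun u => ‖Y u‖ + 1) (by fun_prop)
  exact h1.mono (hf.meas Y hY) (Eventually.of_forall fun u =>
    (hf.norm_le u _).trans (le_abs_self _))

/-- A continuous function on `ℝ` that solves the integral equation of `x' = f(t, x_t)`, `x_s = φ`,
and is continued to the left of `s - r` by a constant. -/
structure NiceSol (hr : 0 ≤ r) (f : ℝ → C r n → E n) (s : ℝ) (φ : C r n) (x : ℝ → E n) : Prop where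
  cont : Continuous x
  past : ∀ u ≤ s, x u = hist hr φ (u - s)
  eqn : ∀ t, s ≤ t → x t = φ (zeroI hr) + ∫ u in s..t, f u (sg r x u)

/-- Existence of solutions on the whole half-line at once: in the norm weighted by `e^{2Λ}`, where
`Λ(t) = ∫_s^t k`, the integral operator contracts with factor `1/2`. -/
theorem exists_niceSol (hr : 0 ≤ r) (hf : Cara f k) (s : ℝ) (φ : C r n) :
    ∃ x, NiceSol hr f s φ x := by
  set w : ℝ → ℝ := fun t => Real.exp (2 * Lam k s t) with hw
  have hwc : Continuous w := by have := continuous_Lam hf.int s; fun_prop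
  set x₀ : ℝ → E n := fun u => hist hr φ (u - s) with hx₀
  have hx₀c : Continuous x₀ := (continuous_hist hr φ).comp (by fun_prop)
  -- the unknown is `v` with `x = x₀ + e^{2Λ} v`
  let X : BoundedContinuousFunction ℝ (E n) → ℝ → E n := fun v u => x₀ u + w u • v u
  have hXc : ∀ v, Continuous (X v) := fun v => by
    have := v.continuous; fun_prop
  have hint : ∀ v, LocallyIntegrable (fun u => f u (sg r (X v) u)) volume := fun v =>
    hf.locallyIntegrable (continuous_sg (hXc v))
  let Φ : BoundedContinuousFunction ℝ (E n) → ℝ → E n := fun v t =>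
    (w t)⁻¹ • ∫ u in s..max s t, f u (sg r (X v) u)
  have hΦc : ∀ v, Continuous (Φ v) := fun v =>
    (hwc.inv₀ fun t => (Real.exp_pos _).ne').smul
      ((intervalIntegral.continuous_primitive (fun a b => locInt_interval (hint v) a b) s).comp
        (continuous_const.max continuous_id))
  have hwmono : Monotone w := fun a b h =>
    Real.exp_le_exp.2 (by have := Lam_mono hf.int hf.nonneg s h; linarith)
  have hwint : ∀ t, ∫ u in s..max s t, k u * w u ≤ w t / 2 := by
    intro t
    refine (integral_mul_weight_le hf.int hf.nonneg (le_max_left _ _)).trans ?_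
    have : Lam k s (max s t) = Lam k s t := by simp [Lam]
    rw [this]
  have hΦlip : ∀ v v' t, ‖Φ v t - Φ v' t‖ ≤ 1 / 2 * ‖v - v'‖ := by
    intro v v' t
    change ‖(w t)⁻¹ • _ - (w t)⁻¹ • _‖ ≤ _
    rw [← smul_sub, norm_smul, ← intervalIntegral.integral_sub (locInt_interval (hint v) _ _)
      (locInt_interval (hint v') _ _), norm_inv, Real.norm_of_nonneg (Real.exp_pos _).le,
      inv_mul_le_iff₀ (Real.exp_pos _)]
    calc ‖∫ u in s..max s t, (f u (sg r (X v) u) - f u (sg r (X v') u))‖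
        ≤ ∫ u in s..max s t, k u * w u * ‖v - v'‖ := by
          refine intervalIntegral.norm_integral_le_of_norm_le (le_max_left _ _)
            (Eventually.of_forall fun u _ => ?_)
            ((intervalIntegrable_mul_weight hf.int s _ _).mul_const _)
          refine (hf.lip u _ _).trans ?_
          rw [mul_assoc]
          refine mul_le_mul_of_nonneg_left ?_ (hf.nonneg u)
          rw [← sg_sub (hXc v) (hXc v')]
          refine norm_sg_le ((hXc v).sub (hXc v')) (by positivity) fun a ha => ?_
          have : X v a - X v' a = w a • (v - v') a := by
            simp only [X, BoundedContinuousFunction.coe_sub, Pi.sub_apply, smul_sub]; abel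
          change ‖X v a - X v' a‖ ≤ _
          rw [this, norm_smul, Real.norm_of_nonneg (Real.exp_pos _).le]
          exact mul_le_mul (hwmono ha.2) ((v - v').norm_coe_le_norm a) (norm_nonneg _)
            (Real.exp_pos _).le
      _ = (∫ u in s..max s t, k u * w u) * ‖v - v'‖ := by
          rw [intervalIntegral.integral_mul_const]
      _ ≤ w t / 2 * ‖v - v'‖ := by gcongr; exact hwint t
      _ = _ := by ring
  have hΦ0 : ∀ t, ‖Φ 0 t‖ ≤ ‖φ‖ + 1 := by
    intro t
    change ‖(w t)⁻¹ • _‖ ≤ _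
    rw [norm_smul, norm_inv, Real.norm_of_nonneg (Real.exp_pos _).le,
      inv_mul_le_iff₀ (Real.exp_pos _)]
    calc ‖∫ u in s..max s t, f u (sg r (X 0) u)‖
        ≤ ∫ u in s..max s t, k u * w u * (‖φ‖ + 1) := by
          refine intervalIntegral.norm_integral_le_of_norm_le (le_max_left _ _)
            (Eventually.of_forall fun u _ => ?_)
            ((intervalIntegrable_mul_weight hf.int s _ _).mul_const _)
          refine (hf.norm_le u _).trans ?_
          have h1 : ‖sg r (X 0) u‖ ≤ ‖φ‖ := by
            refine norm_sg_le (hXc 0) (norm_nonneg _) fun a _ => ?_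
            simp only [X, BoundedContinuousFunction.coe_zero, Pi.zero_apply, smul_zero, add_zero]
            exact norm_hist_le hr φ _
          have h2 : 1 ≤ w u :=
            Real.one_le_exp (by have := Lam_nonneg hf.nonneg s u; linarith)
          have h3 := hf.nonneg u
          calc k u * (‖sg r (X 0) u‖ + 1) ≤ k u * (‖φ‖ + 1) := by gcongr
            _ ≤ k u * w u * (‖φ‖ + 1) := by
              gcongr
              nlinarith
      _ = (∫ u in s..max s t, k u * w u) * (‖φ‖ + 1) := by
          rw [intervalIntegral.integral_mul_const]
      _ ≤ w t / 2 * (‖φ‖ + 1) := by gcongr; exact hwint t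
      _ ≤ _ := by
          have := Real.exp_pos (2 * Lam k s t)
          gcongr
          simp only [hw]; linarith
  have hΦb : ∀ v t, ‖Φ v t‖ ≤ 1 / 2 * ‖v‖ + (‖φ‖ + 1) := by
    intro v t
    have h1 := hΦlip v 0 t
    rw [sub_zero] at h1
    calc ‖Φ v t‖ = ‖(Φ v t - Φ 0 t) + Φ 0 t‖ := by rw [sub_add_cancel]
      _ ≤ _ := (norm_add_le _ _).trans (add_le_add h1 (hΦ0 t))
  let G : BoundedContinuousFunction ℝ (E n) → BoundedContinuousFunction ℝ (E n) := fun v =>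
    BoundedContinuousFunction.ofNormedAddCommGroup (Φ v) (hΦc v) _ (hΦb v)
  have hG : ContractingWith (1 / 2) G := by
    refine ⟨by norm_num, LipschitzWith.of_dist_le_mul fun v v' => ?_⟩
    rw [BoundedContinuousFunction.dist_le (by positivity)]
    intro t
    rw [dist_eq_norm, dist_eq_norm]
    have := hΦlip v v' t
    simp only [NNReal.coe_div, NNReal.coe_one, NNReal.coe_ofNat]
    exact this
  set v := hG.fixedPoint with hv
  have hfix : ∀ t, v t = Φ v t := fun t => by
    have : G v = v := hG.fixedPoint_isFixedPt
    conv_lhs => rw [← this]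
    rfl
  have hwv : ∀ t, w t • v t = ∫ u in s..max s t, f u (sg r (X v) u) := by
    intro t
    rw [hfix t]
    change w t • (w t)⁻¹ • _ = _
    rw [smul_smul, mul_inv_cancel₀ (Real.exp_pos _).ne', one_smul]
  refine ⟨X v, hXc v, fun u hu => ?_, fun t ht => ?_⟩
  · change x₀ u + w u • v u = _
    rw [hwv, max_eq_left hu, intervalIntegral.integral_same, add_zero]
  · change x₀ t + w t • v t = _
    rw [hwv, max_eq_right ht, hx₀]
    simp only
    rw [hist_of_nonneg hr φ (by linarith)]

end Caratheodory

section AbsCont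

set_option linter.unusedSectionVars false

/-- Domination of increments by those of an absolutely continuous real function. -/
theorem absolutelyContinuousOnInterval_of_dist_le {F : Type*} [PseudoMetricSpace F] {x : ℝ → F}
    {G : ℝ → ℝ} {a b : ℝ} (hG : AbsolutelyContinuousOnInterval G a b)
    (h : ∀ u ∈ uIcc a b, ∀ v ∈ uIcc a b, dist (x u) (x v) ≤ dist (G u) (G v)) :
    AbsolutelyContinuousOnInterval x a b := by
  rw [absolutelyContinuousOnInterval_iff] at hG ⊢
  intro ε hε
  obtain ⟨δ, hδ, H⟩ := hG ε hε
  refine ⟨δ, hδ, fun J hJ hlen => lt_of_le_of_lt (Finset.sum_le_sum fun i hi => ?_) (H J hJ hlen)⟩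
  exact h _ (hJ.1 i hi).1 _ (hJ.1 i hi).2

variable {F : Type*} [NormedAddCommGroup F] [NormedSpace ℝ F] [CompleteSpace F]

theorem absolutelyContinuousOnInterval_of_eq_integral {x g : ℝ → F} {a b : ℝ} {p : F} (hab : a ≤ b)
    (hg : LocallyIntegrable g volume) (hx : ∀ t ∈ Icc a b, x t = p + ∫ u in a..t, g u) :
    AbsolutelyContinuousOnInterval x a b := by
  refine absolutelyContinuousOnInterval_of_dist_le
    ((locInt_interval hg a b).norm.absolutelyContinuousOnInterval_intervalIntegral
      (c := a) left_mem_uIcc) fun u hu v hv => ?_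
  rw [uIcc_of_le hab] at hu hv
  rw [hx u hu, hx v hv, dist_add_left, dist_eq_norm, dist_eq_norm,
    intervalIntegral.integral_interval_sub_left (locInt_interval hg _ _) (locInt_interval hg _ _),
    intervalIntegral.integral_interval_sub_left (locInt_interval hg _ _).norm
      (locInt_interval hg _ _).norm]
  exact intervalIntegral.norm_integral_le_abs_integral_norm

/-- The fundamental theorem of calculus for absolutely continuous vector-valued functions whose
derivative has an integrable bound. -/
theorem ac_sub_eq_integral [SecondCountableTopology F] {x x' : ℝ → F} {κ : ℝ → ℝ} {a b : ℝ}
    (hab : a ≤ b) (hac : AbsolutelyContinuousOnInterval x a b)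
    (hx : ∀ᵐ t ∂volume, t ∈ Ioo a b → HasDerivAt x (x' t) t)
    (hκ : IntervalIntegrable κ volume a b) (hb : ∀ t ∈ Ioo a b, ‖x' t‖ ≤ κ t) :
    IntervalIntegrable x' volume a b ∧ ∀ t ∈ Icc a b, x t - x a = ∫ u in a..t, x' u := by
  borelize F
  have hne : ∀ᵐ t ∂(volume : Measure ℝ), t ≠ b := by simp [ae_iff, measure_singleton]
  have hne' : ∀ᵐ t ∂(volume : Measure ℝ), t ≠ a := by simp [ae_iff, measure_singleton]
  have hint : IntervalIntegrable x' volume a b := by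
    refine hκ.mono_fun ?_ ?_
    · refine (measurable_deriv x).aestronglyMeasurable.congr ?_
      rw [EventuallyEq, ae_restrict_iff' measurableSet_uIoc, uIoc_of_le hab]
      filter_upwards [hx, hne] with t h1 h2 h3
      exact (h1 ⟨h3.1, lt_of_le_of_ne h3.2 h2⟩).deriv
    · rw [EventuallyLE, ae_restrict_iff' measurableSet_uIoc, uIoc_of_le hab]
      filter_upwards [hne] with t h2 h3
      exact (hb t ⟨h3.1, lt_of_le_of_ne h3.2 h2⟩).trans (le_abs_self _)
  refine ⟨hint, ?_⟩
  have hacI : AbsolutelyContinuousOnInterval (fun t => ∫ u in a..t, x' u) a b := by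
    refine absolutelyContinuousOnInterval_of_dist_le
      (hint.norm.absolutelyContinuousOnInterval_intervalIntegral
        (c := a) left_mem_uIcc) fun u hu v hv => ?_
    have hi : ∀ w ∈ uIcc a b, IntervalIntegrable x' volume a w := fun w hw =>
      hint.mono_set (uIcc_subset_uIcc_left hw)
    rw [dist_eq_norm, dist_eq_norm,
      intervalIntegral.integral_interval_sub_left (hi u hu) (hi v hv),
      intervalIntegral.integral_interval_sub_left (hi u hu).norm (hi v hv).norm]
    exact intervalIntegral.norm_integral_le_abs_integral_norm
  have h0 : ∀ᵐ t ∂volume, t ∈ uIcc a b →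
      HasDerivAt (fun t => x t - ∫ u in a..t, x' u) 0 t := by
    filter_upwards [hx, hint.ae_hasDerivAt_integral, hne, hne'] with t h1 h2 h3 h4 ht
    have ht' := ht
    rw [uIcc_of_le hab] at ht'
    have h5 := (h1 ⟨lt_of_le_of_ne ht'.1 h4.symm, lt_of_le_of_ne ht'.2 h3⟩).sub
      (h2 ht a left_mem_uIcc)
    rwa [sub_self] at h5
  obtain ⟨c, hc⟩ := AbsolutelyContinuousOnInterval.const_of_ae_hasDerivAt_zero
    (f := fun t => x t - ∫ u in a..t, x' u) (hac.sub hacI) h0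
  intro t ht
  have h1 := hc t (by rwa [uIcc_of_le hab])
  have h2 := hc a left_mem_uIcc
  simp only [intervalIntegral.integral_same, sub_zero] at h1 h2
  rw [h2, ← h1]
  abel

end AbsCont

section Uniqueness

variable {r : ℝ} {n : ℕ}

theorem NiceSol.isSolution {f : ℝ → C r n → E n} {k : ℝ → ℝ} (hr : 0 ≤ r) (hf : Cara f k) {s : ℝ}
    {φ : C r n} {x : ℝ → E n} (hx : NiceSol hr f s φ x) :
    IsSolution (fun u ψ => f u (toC ψ)) s (fun ω => φ ω) x := by
  have hg : LocallyIntegrable (fun u => f u (sg r x u)) volume :=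
    hf.locallyIntegrable (continuous_sg hx.cont)
  refine ⟨?_, fun b hb => ?_, ?_⟩
  · funext ω
    unfold seg
    rw [hx.past _ (by linarith [ω.2.2]), add_sub_cancel_left, hist_coe]
  · exact absolutelyContinuousOnInterval_of_eq_integral hb hg fun t ht => hx.eqn t ht.1
  · filter_upwards [LocallyIntegrable.ae_hasDerivAt_integral hg] with t ht hst
    refine ((ht s).const_add (φ (zeroI hr))).congr_of_eventuallyEq ?_
    filter_upwards [lt_mem_nhds hst] with v hv
    exact hx.eqn v hv.le

/-- Two solutions with the same history agree as soon as the difference of the right-hand sides is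
controlled by the difference of the solutions. -/
theorem isSolution_unique (hr : 0 ≤ r) {F : ℝ → (I r → E n) → E n} {k : ℝ → ℝ}
    (hk : LocallyIntegrable k volume) (h0 : ∀ u, 0 ≤ k u) {s : ℝ} {ψ : I r → E n}
    {x y : ℝ → E n} (hx : IsSolution F s ψ x) (hy : IsSolution F s ψ y)
    (hF : ∀ t, s < t → ∀ M, 0 ≤ M → (∀ v ∈ Icc (s - r) t, ‖x v - y v‖ ≤ M) →
      ‖F t (seg r x t) - F t (seg r y t)‖ ≤ k t * M) :
    ∀ t, s - r ≤ t → x t = y t := by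
  have hpast : ∀ v ∈ Icc (s - r) s, x v - y v = 0 := by
    intro v hv
    have h1 := congrFun hx.1 ⟨v - s, by linarith [hv.1], by linarith [hv.2]⟩
    have h2 := congrFun hy.1 ⟨v - s, by linarith [hv.1], by linarith [hv.2]⟩
    simp only [seg, add_sub_cancel] at h1 h2
    rw [h1, h2, sub_self]
  intro t ht
  rcases le_total t s with h | hst
  · exact sub_eq_zero.1 (hpast t ⟨ht, h⟩)
  have hac : AbsolutelyContinuousOnInterval (fun v => x v - y v) s t := (hx.2.1 t hst).sub (hy.2.1 t hst)
  have hcont : ContinuousOn (fun v => x v - y v) (Icc s t) := by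
    have := hac.continuousOn
    rwa [uIcc_of_le hst] at this
  obtain ⟨B, hB⟩ := isCompact_Icc.exists_bound_of_continuousOn hcont
  have hB0 : 0 ≤ B := (norm_nonneg _).trans (hB s ⟨le_rfl, hst⟩)
  have hder : ∀ᵐ v ∂volume, v ∈ Ioo s t → HasDerivAt (fun v => x v - y v)
      (F v (seg r x v) - F v (seg r y v)) v := by
    filter_upwards [hx.2.2, hy.2.2] with v h1 h2 hv
    exact (h1 hv.1).sub (h2 hv.1)
  obtain ⟨hint, hftc⟩ := ac_sub_eq_integral hst hac hder ((locInt_interval hk s t).mul_const B)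
    fun v hv => hF v hv.1 B hB0 fun w hw => by
      rcases le_total w s with h | h
      · rw [hpast w ⟨hw.1, h⟩, norm_zero]; exact hB0
      · exact hB w ⟨h, hw.2.trans hv.2.le⟩
  have hs : x s - y s = 0 := hpast s ⟨by linarith, le_rfl⟩
  have := weighted_gronwall hk h0 (c := 0) le_rfl hcont (fun v hv M hM hvM => by
    have h1 := hftc v hv
    rw [hs, sub_zero] at h1
    rw [h1, zero_add]
    calc ‖∫ u in s..v, (F u (seg r x u) - F u (seg r y u))‖
        ≤ ∫ u in s..v, k u * Real.exp (2 * Lam k s u) * M := by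
          refine intervalIntegral.norm_integral_le_of_norm_le hv.1
            (Eventually.of_forall fun u hu => ?_)
            ((intervalIntegrable_mul_weight hk s _ _).mul_const _)
          rw [mul_assoc]
          refine hF u hu.1 _ (by positivity) fun w hw => ?_
          rcases le_total w s with h | h
          · rw [hpast w ⟨hw.1, h⟩, norm_zero]; positivity
          · refine (hvM w ⟨h, hw.2.trans hu.2⟩).trans ?_
            rw [mul_comm]
            gcongr
            exact Lam_mono hk h0 s hw.2
      _ = (∫ u in s..v, k u * Real.exp (2 * Lam k s u)) * M := by
          rw [intervalIntegral.integral_mul_const]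
      _ ≤ Real.exp (2 * Lam k s v) / 2 * M := by
          gcongr; exact integral_mul_weight_le hk h0 hv.1
      _ = _ := by ring) t ⟨hst, le_rfl⟩
  rw [mul_zero, zero_mul] at this
  exact sub_eq_zero.1 (norm_le_zero_iff.1 this)

theorem continuousOn_of_history (hr : 0 ≤ r) {s : ℝ} {φ : C r n} {x : ℝ → E n}
    (h1 : seg r x s = fun ω => φ ω) (h2 : ∀ b, s ≤ b → AbsolutelyContinuousOnInterval x s b) :
    ContinuousOn x (Ici (s - r)) := by
  have hl : ContinuousOn x (Icc (s - r) s) := by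
    refine ContinuousOn.congr (f := fun v => hist hr φ (v - s))
      ((continuous_hist hr φ).comp (by fun_prop)).continuousOn fun v hv => ?_
    have h3 := congrFun h1 ⟨v - s, by linarith [hv.1], by linarith [hv.2]⟩
    simp only [seg, add_sub_cancel] at h3
    rw [h3, ← hist_coe hr φ ⟨v - s, by linarith [hv.1], by linarith [hv.2]⟩]
  have hrr : ContinuousOn x (Ici s) := by
    intro v hv
    have h3 : ContinuousOn x (Icc s (v + 1)) := by
      have := (h2 (v + 1) (by linarith [mem_Ici.1 hv])).continuousOn
      rwa [uIcc_of_le (by linarith [mem_Ici.1 hv])] at this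
    exact (h3 v ⟨hv, by linarith⟩).mono_of_mem_nhdsWithin
      (mem_nhdsWithin.2 ⟨Iio (v + 1), isOpen_Iio, by simp,
        fun w hw => ⟨hw.2, le_of_lt hw.1⟩⟩)
  have := hl.union_of_isClosed hrr isClosed_Icc isClosed_Ici
  rwa [Icc_union_Ici_eq_Ici (by linarith)] at this

theorem continuous_seg_of_continuousOn {s : ℝ} {x : ℝ → E n} (hx : ContinuousOn x (Ici (s - r)))
    {t : ℝ} (ht : s ≤ t) : Continuous (seg r x t) :=
  hx.comp_continuous (by fun_prop) fun ω => by
    have := ω.2.1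
    exact mem_Ici.2 (by linarith)

theorem NiceSol.eq_of_isSolution {f : ℝ → C r n → E n} {k : ℝ → ℝ} (hr : 0 ≤ r) (hf : Cara f k)
    {s : ℝ} {φ : C r n} {x y : ℝ → E n} (hx : NiceSol hr f s φ x)
    (hy : IsSolution (fun u ψ => f u (toC ψ)) s (fun ω => φ ω) y) :
    ∀ t, s - r ≤ t → y t = x t := by
  have hyc := continuousOn_of_history hr hy.1 hy.2.1
  refine isSolution_unique hr hf.int hf.nonneg hy (hx.isSolution hr hf) fun t ht M hM hv => ?_
  refine (hf.lip t _ _).trans (mul_le_mul_of_nonneg_left ?_ (hf.nonneg t))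
  refine C_norm_le hM fun ω => ?_
  change ‖toC (seg r y t) ω - toC (seg r x t) ω‖ ≤ M
  rw [toC_apply (continuous_seg_of_continuousOn hyc ht.le), toC_apply (continuous_seg hx.cont t)]
  exact hv _ ⟨by linarith [ω.2.1], by linarith [ω.2.2]⟩

end Uniqueness

section Flow

variable {r : ℝ} {n : ℕ}

/-- The solution operator of `x' = f(t, x_t)`; both `T` and `R` are instances. -/
noncomputable def flow (f : ℝ → C r n → E n) (t s : ℝ) (φ : C r n) : C r n :=
  toC (seg r (solution (fun u ψ => f u (toC ψ)) s φ) t)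

/-- The continuous representative of the solution, see `NiceSol`. -/
noncomputable def sol (hr : 0 ≤ r) (f : ℝ → C r n → E n) (s : ℝ) (φ : C r n) : ℝ → E n :=
  Classical.epsilon (NiceSol hr f s φ)

variable {f : ℝ → C r n → E n} {k : ℝ → ℝ} (hr : 0 ≤ r) (hf : Cara f k)
include hr hf

theorem niceSol_sol (s : ℝ) (φ : C r n) : NiceSol hr f s φ (sol hr f s φ) :=
  Classical.epsilon_spec (exists_niceSol hr hf s φ)

theorem NiceSol.solution_eq {s : ℝ} {φ : C r n} {x : ℝ → E n} (hx : NiceSol hr f s φ x) {t : ℝ}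
    (ht : s - r ≤ t) : solution (fun u ψ => f u (toC ψ)) s φ t = x t :=
  hx.eq_of_isSolution hr hf (Classical.epsilon_spec ⟨x, hx.isSolution hr hf⟩) t ht

theorem NiceSol.flow_eq {s : ℝ} {φ : C r n} {x : ℝ → E n} (hx : NiceSol hr f s φ x) {t : ℝ}
    (ht : s ≤ t) : flow f t s φ = sg r x t :=
  sg_congr fun _ hv => hx.solution_eq hr hf (by linarith [hv.1])

theorem flow_eq_sg {s t : ℝ} (ht : s ≤ t) (φ : C r n) : flow f t s φ = sg r (sol hr f s φ) t :=
  (niceSol_sol hr hf s φ).flow_eq hr hf ht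

omit hf in
theorem NiceSol.sg_self {s : ℝ} {φ : C r n} {x : ℝ → E n} (hx : NiceSol hr f s φ x) :
    sg r x s = φ := by
  refine DFunLike.ext _ _ fun ω => ?_
  rw [sg_apply hx.cont, hx.past _ (by linarith [ω.2.2]), add_sub_cancel_left, hist_coe]

theorem flow_self (s : ℝ) (φ : C r n) : flow f s s φ = φ := by
  rw [flow_eq_sg hr hf le_rfl, (niceSol_sol hr hf s φ).sg_self]

/-- A continuous function that satisfies the integral equation on `[s, ∞)` is transported by the
solution operator. -/
theorem flow_eq_of_eqn {s : ℝ} {x : ℝ → E n} (hx : Continuous x)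
    (h : ∀ t, s ≤ t → x t = x s + ∫ u in s..t, f u (sg r x u)) {t : ℝ} (ht : s ≤ t) :
    flow f t s (sg r x s) = sg r x t := by
  have hsg : ∀ u, s ≤ u → sg r (fun v => x (max v (s - r))) u = sg r x u := fun u hu =>
    sg_congr fun v hv => by rw [max_eq_left (by linarith [hv.1])]
  have : NiceSol hr f s (sg r x s) (fun v => x (max v (s - r))) := by
    refine ⟨by fun_prop, fun u hu => ?_, fun t ht => ?_⟩
    · unfold hist
      rw [sg_apply hx, projIcc]
      congr 1
      change _ = s + max (-r) (min 0 (u - s))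
      rw [min_eq_right (by linarith), ← max_add_add_left,
        add_sub_cancel, max_comm, sub_eq_add_neg]
    · rw [sg_apply hx, max_eq_left (by linarith), h t ht]
      congr 1
      · simp [zeroI]
      · refine intervalIntegral.integral_congr fun u hu => ?_
        rw [uIcc_of_le ht] at hu
        rw [hsg u hu.1]
  rw [this.flow_eq hr hf ht, hsg t ht]

theorem NiceSol.eqn' {s : ℝ} {φ : C r n} {x : ℝ → E n} (hx : NiceSol hr f s φ x) {u t : ℝ}
    (hu : s ≤ u) (ht : u ≤ t) : x t = x u + ∫ v in u..t, f v (sg r x v) := by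
  have hg : LocallyIntegrable (fun u => f u (sg r x u)) volume :=
    hf.locallyIntegrable (continuous_sg hx.cont)
  rw [hx.eqn t (hu.trans ht), hx.eqn u hu, add_assoc,
    intervalIntegral.integral_add_adjacent_intervals (locInt_interval hg _ _)
      (locInt_interval hg _ _)]

theorem flow_flow {s u t : ℝ} (hu : s ≤ u) (ht : u ≤ t) (φ : C r n) :
    flow f t u (flow f u s φ) = flow f t s φ := by
  have hx := niceSol_sol hr hf s φ
  rw [flow_eq_sg hr hf hu, flow_eq_sg hr hf (hu.trans ht)]
  exact flow_eq_of_eqn hr hf hx.cont (fun v hv => hx.eqn' hr hf hu hv) ht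

end Flow

/-! ### Linear delay equations -/

section Measurability

variable {r : ℝ} {n : ℕ}

instance (r : ℝ) (n : ℕ) : SecondCountableTopology (C r n) :=
  inferInstanceAs (SecondCountableTopology C(I r, E n))

/-- A strongly measurable family of operators coincides almost everywhere with one that is
measurable everywhere. -/
theorem exists_measurable_version {L : ℝ → C r n →L[ℝ] E n}
    (hL : ∀ φ : C r n, AEStronglyMeasurable (fun t => L t φ) volume) :
    ∃ L' : ℝ → C r n →L[ℝ] E n, (∀ φ, StronglyMeasurable (fun t => L' t φ)) ∧
      ∀ᵐ t ∂volume, L t = L' t := by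
  let D := TopologicalSpace.denseSeq (C r n)
  have hD : DenseRange D := TopologicalSpace.denseRange_denseSeq _
  have hae : ∀ᵐ t ∂volume, ∀ i, L t (D i) = (hL (D i)).mk _ t :=
    ae_all_iff.2 fun i => (hL (D i)).ae_eq_mk
  obtain ⟨N, hNsub, hNm, hN0⟩ := exists_measurable_superset_of_null (mem_ae_iff.1 hae)
  refine ⟨fun t => by classical exact if t ∈ N then 0 else L t, ?_, ?_⟩
  · have h1 : ∀ i, StronglyMeasurable
        (fun t => (by classical exact if t ∈ N then 0 else L t : C r n →L[ℝ] E n) (D i)) := by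
      intro i
      have : (fun t => (by classical exact if t ∈ N then 0 else L t : C r n →L[ℝ] E n) (D i)) =
          Nᶜ.indicator ((hL (D i)).mk _) := by
        funext t
        by_cases ht : t ∈ N
        · simp [ht]
        · have h2 : t ∈ {t | ∀ i, L t (D i) = (hL (D i)).mk _ t} := by
            by_contra hcon
            exact ht (hNsub hcon)
          simp only [ht, if_false, mem_compl_iff, not_false_eq_true, indicator_of_mem]
          exact h2 i
      rw [this]
      exact (hL (D i)).stronglyMeasurable_mk.indicator hNm.compl
    intro φ
    have hcl : φ ∈ closure (range D) := hD.closure_eq ▸ mem_univ φ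
    obtain ⟨x, hx, hlim⟩ := mem_closure_iff_seq_limit.1 hcl
    choose j hj using hx
    refine stronglyMeasurable_of_tendsto atTop (fun i => h1 (j i)) (tendsto_pi_nhds.2 fun t => ?_)
    simp_rw [hj]
    exact (ContinuousLinearMap.continuous _).tendsto _ |>.comp hlim
  · have : ∀ᵐ t ∂(volume : Measure ℝ), t ∉ N := measure_eq_zero_iff_ae_notMem.1 hN0
    filter_upwards [this] with t ht
    simp [ht]

theorem stronglyMeasurable_clm_apply {L' : ℝ → C r n →L[ℝ] E n}
    (hL' : ∀ φ, StronglyMeasurable (fun t => L' t φ)) {α : Type*} [MeasurableSpace α]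
    {a : α → ℝ} (ha : Measurable a) {Φ : α → C r n} (hΦ : StronglyMeasurable Φ) :
    StronglyMeasurable (fun p => L' (a p) (Φ p)) := by
  borelize (C r n)
  have h := stronglyMeasurable_uncurry_of_continuous_of_stronglyMeasurable
    (u := fun (φ : C r n) t => L' t φ) (fun t => (L' t).continuous) hL'
  exact h.comp_measurable (hΦ.measurable.prodMk ha)

theorem aestronglyMeasurable_clm_apply {L : ℝ → C r n →L[ℝ] E n}
    (hL : ∀ φ : C r n, AEStronglyMeasurable (fun t => L t φ) volume) {Y : ℝ → C r n}
    (hY : AEStronglyMeasurable Y volume) : AEStronglyMeasurable (fun u => L u (Y u)) volume := by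
  obtain ⟨L', hL', hae⟩ := exists_measurable_version hL
  refine (stronglyMeasurable_clm_apply hL' measurable_id
    hY.stronglyMeasurable_mk).aestronglyMeasurable.congr ?_
  filter_upwards [hae, hY.ae_eq_mk] with u h1 h2
  rw [h1, h2]
  rfl

theorem Cara.add {f f' : ℝ → C r n → E n} {k k' : ℝ → ℝ} (h : Cara f k) (h' : Cara f' k') :
    Cara (fun u φ => f u φ + f' u φ) (fun u => k u + k' u) where
  meas Y hY := (h.meas Y hY).add (h'.meas Y hY)
  int := h.int.add h'.int
  nonneg u := add_nonneg (h.nonneg u) (h'.nonneg u)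
  lip u φ ψ := by
    rw [add_sub_add_comm, add_mul]
    exact (norm_add_le _ _).trans (add_le_add (h.lip u φ ψ) (h'.lip u φ ψ))
  zero u := (norm_add_le _ _).trans (add_le_add (h.zero u) (h'.zero u))

theorem cara_forcing {f : ℝ → E n} (hf : LocallyIntegrable f volume) :
    Cara (r := r) (fun u _ => f u) (fun u => ‖f u‖) where
  meas _ _ := hf.aestronglyMeasurable
  int := hf.mono hf.aestronglyMeasurable.norm (Eventually.of_forall fun u => by simp)
  nonneg u := norm_nonneg _
  lip u φ ψ := by rw [sub_self, norm_zero]; positivity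
  zero u := le_rfl

theorem cara_linear {L : ℝ → C r n →L[ℝ] E n} {m : ℝ → ℝ}
    (hL : ∀ φ : C r n, AEStronglyMeasurable (fun t => L t φ) volume)
    (hm : LocallyIntegrable m volume) (hLm : ∀ t, ‖L t‖ ≤ m t) :
    Cara (fun u φ => L u φ) m where
  meas _ hY := aestronglyMeasurable_clm_apply hL hY.aestronglyMeasurable
  int := hm
  nonneg u := (norm_nonneg _).trans (hLm u)
  lip u φ ψ := by
    rw [← map_sub]
    exact (L u).le_of_opNorm_le (hLm u) _
  zero u := by rw [map_zero, norm_zero]; exact (norm_nonneg _).trans (hLm u)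

end Measurability

section Gronwall

variable {r : ℝ} {n : ℕ}

/-- Gronwall's inequality for a delay. The weight `e^{2Λ}` satisfies `∫ m e^{2Λ} ≤ e^{2Λ}/2`, so half
of the right-hand side is absorbed on the left; this is the origin of the two factors `2`. -/
theorem gronwall_sg {m : ℝ → ℝ} (hm : LocallyIntegrable m volume) (h0 : ∀ u, 0 ≤ m u)
    {x : ℝ → E n} (hx : Continuous x) {s b c : ℝ} (hc : 0 ≤ c)
    (hpast : ∀ v ∈ Icc (s - r) s, ‖x v‖ ≤ c)
    (h : ∀ t ∈ Icc s b, ‖x t‖ ≤ c + ∫ u in s..t, m u * ‖sg r x u‖) :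
    ∀ t ∈ Icc (s - r) b, ‖x t‖ ≤ 2 * c * Real.exp (2 * Lam m s t) := by
  have key := weighted_gronwall hm h0 (d := x) (s := s) (b := b) hc hx.continuousOn (by
    intro t ht M hM hv
    refine (h t ht).trans ?_
    gcongr
    calc ∫ u in s..t, m u * ‖sg r x u‖ ≤ ∫ u in s..t, M * (m u * Real.exp (2 * Lam m s u)) := by
          refine intervalIntegral.integral_mono_on ht.1
            ((locInt_interval hm _ _).mul_continuousOn (continuous_sg hx).norm.continuousOn)
            ((intervalIntegrable_mul_weight hm s _ _).const_mul _) fun u hu => ?_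
          rw [mul_left_comm]
          refine mul_le_mul_of_nonneg_left ?_ (h0 u)
          have hM0 : 0 ≤ M := hc.trans hM
          refine norm_sg_le hx (by positivity) fun v hv' => ?_
          rcases le_total v s with h1 | h1
          · refine (hpast v ⟨by linarith [hv'.1, hu.1], h1⟩).trans (hM.trans ?_)
            refine le_mul_of_one_le_right hM0 (Real.one_le_exp ?_)
            have := Lam_nonneg h0 s u
            linarith
          · refine (hv v ⟨h1, hv'.2.trans hu.2⟩).trans ?_
            gcongr
            exact Lam_mono hm h0 s hv'.2
      _ = M * ∫ u in s..t, m u * Real.exp (2 * Lam m s u) := by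
          rw [intervalIntegral.integral_const_mul]
      _ ≤ M * (Real.exp (2 * Lam m s t) / 2) := by
          have hM0 : 0 ≤ M := hc.trans hM
          gcongr
          exact integral_mul_weight_le hm h0 ht.1
      _ = _ := by ring)
  intro t ht
  rcases le_total t s with h1 | h1
  · refine (hpast t ⟨ht.1, h1⟩).trans ?_
    rw [Lam_of_le s h1, mul_zero, Real.exp_zero]
    linarith
  · exact key t ⟨h1, ht.2⟩

end Gronwall

section Linear

variable {r : ℝ} {n : ℕ}

/-- `x` is continuous and solves `x' = L(t) x_t + f(t)` on `[s, ∞)`, in integrated form. -/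
def LinSol (L : ℝ → C r n →L[ℝ] E n) (f : ℝ → E n) (s : ℝ) (x : ℝ → E n) : Prop :=
  Continuous x ∧ ∀ t, s ≤ t → x t = x s + ∫ u in s..t, (L u (sg r x u) + f u)

/-- The data `Admissible` with a fixed dominating function, together with `0 < r`. -/
structure Adm (L : ℝ → C r n →L[ℝ] E n) (m : ℝ → ℝ) : Prop where
  pos : 0 < r
  meas : ∀ φ : C r n, AEStronglyMeasurable (fun t => L t φ) volume
  int : LocallyIntegrable m volume
  le : ∀ t, ‖L t‖ ≤ m t

variable {L : ℝ → C r n →L[ℝ] E n} {m : ℝ → ℝ}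

theorem Adm.nn (h : Adm L m) : 0 ≤ r := h.pos.le

theorem Adm.nonneg (h : Adm L m) (u : ℝ) : 0 ≤ m u := (norm_nonneg _).trans (h.le u)

theorem Adm.cara (h : Adm L m) : Cara (fun u φ => L u φ) m := cara_linear h.meas h.int h.le

theorem Adm.cara_forced (h : Adm L m) {f : ℝ → E n} (hf : LocallyIntegrable f volume) :
    Cara (fun u φ => L u φ + f u) (fun u => m u + ‖f u‖) := h.cara.add (cara_forcing hf)

theorem Adm.locallyIntegrable (h : Adm L m) {x : ℝ → E n} (hx : Continuous x) :
    LocallyIntegrable (fun u => L u (sg r x u)) volume :=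
  h.cara.locallyIntegrable (continuous_sg hx)

theorem Adm.locallyIntegrable_forced (h : Adm L m) {f : ℝ → E n}
    (hf : LocallyIntegrable f volume) {x : ℝ → E n} (hx : Continuous x) :
    LocallyIntegrable (fun u => L u (sg r x u) + f u) volume :=
  (h.locallyIntegrable hx).add hf

theorem LinSol.add (h : Adm L m) {f g : ℝ → E n} (hf : LocallyIntegrable f volume)
    (hg : LocallyIntegrable g volume) {s : ℝ} {x y : ℝ → E n} (hx : LinSol L f s x)
    (hy : LinSol L g s y) : LinSol L (fun u => f u + g u) s (fun v => x v + y v) := by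
  refine ⟨hx.1.add hy.1, fun t ht => ?_⟩
  have h1 : ∀ u, L u (sg r (fun v => x v + y v) u) + (f u + g u) =
      (L u (sg r x u) + f u) + (L u (sg r y u) + g u) := fun u => by
    rw [sg_add hx.1 hy.1, map_add]; abel
  simp_rw [h1]
  rw [intervalIntegral.integral_add
    (locInt_interval (h.locallyIntegrable_forced hf hx.1) _ _)
    (locInt_interval (h.locallyIntegrable_forced hg hy.1) _ _), hx.2 t ht, hy.2 t ht]
  abel

theorem LinSol.smul {f : ℝ → E n} {s : ℝ} {x : ℝ → E n} (hx : LinSol L f s x) (c : ℝ) :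
    LinSol L (fun u => c • f u) s (fun v => c • x v) := by
  refine ⟨hx.1.const_smul c, fun t ht => ?_⟩
  have h1 : ∀ u, L u (sg r (fun v => c • x v) u) + c • f u = c • (L u (sg r x u) + f u) :=
    fun u => by rw [sg_smul hx.1, map_smul, smul_add]
  simp_rw [h1]
  rw [intervalIntegral.integral_smul, hx.2 t ht, smul_add]

theorem LinSol.mono (h : Adm L m) {f : ℝ → E n} (hf : LocallyIntegrable f volume) {s s' : ℝ}
    (hs : s ≤ s') {x : ℝ → E n} (hx : LinSol L f s x) : LinSol L f s' x := by
  refine ⟨hx.1, fun t ht => ?_⟩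
  have hi := h.locallyIntegrable_forced hf hx.1
  rw [hx.2 t (hs.trans ht), hx.2 s' hs, add_assoc,
    intervalIntegral.integral_add_adjacent_intervals (locInt_interval hi _ _)
      (locInt_interval hi _ _)]

/-- The continuous solution of the homogeneous linear equation. -/
noncomputable def lsol (h : Adm L m) (s : ℝ) (φ : C r n) : ℝ → E n :=
  sol h.nn (fun u ψ => L u ψ) s φ

theorem niceSol_lsol (h : Adm L m) (s : ℝ) (φ : C r n) :
    NiceSol h.nn (fun u ψ => L u ψ) s φ (lsol h s φ) := niceSol_sol h.nn h.cara s φ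

theorem continuous_lsol (h : Adm L m) (s : ℝ) (φ : C r n) : Continuous (lsol h s φ) :=
  (niceSol_lsol h s φ).cont

theorem lsol_past (h : Adm L m) {s u : ℝ} (hu : u ≤ s) (φ : C r n) :
    lsol h s φ u = hist h.nn φ (u - s) := (niceSol_lsol h s φ).past u hu

theorem lsol_eqn (h : Adm L m) {s t : ℝ} (ht : s ≤ t) (φ : C r n) :
    lsol h s φ t = φ (zeroI h.nn) + ∫ u in s..t, L u (sg r (lsol h s φ) u) :=
  (niceSol_lsol h s φ).eqn t ht

theorem T_eq_sg (h : Adm L m) {s t : ℝ} (ht : s ≤ t) (φ : C r n) :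
    T L t s φ = sg r (lsol h s φ) t := flow_eq_sg h.nn h.cara ht φ

theorem sg_lsol_self (h : Adm L m) (s : ℝ) (φ : C r n) : sg r (lsol h s φ) s = φ :=
  (niceSol_lsol h s φ).sg_self

theorem T_self (h : Adm L m) (s : ℝ) (φ : C r n) : T L s s φ = φ := flow_self h.nn h.cara s φ

theorem T_T (h : Adm L m) {s u t : ℝ} (hu : s ≤ u) (ht : u ≤ t) (φ : C r n) :
    T L t u (T L u s φ) = T L t s φ := flow_flow h.nn h.cara hu ht φ

theorem linSol_lsol (h : Adm L m) (s : ℝ) (φ : C r n) : LinSol L (fun _ => 0) s (lsol h s φ) := by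
  refine ⟨continuous_lsol h s φ, fun t ht => ?_⟩
  simp only [add_zero]
  exact (niceSol_lsol h s φ).eqn' h.nn h.cara le_rfl ht

theorem locallyIntegrable_zero' {F : Type*} [NormedAddCommGroup F] :
    LocallyIntegrable (fun _ : ℝ => (0 : F)) volume := locallyIntegrable_zero

theorem LinSol.T_eq (h : Adm L m) {s : ℝ} {x : ℝ → E n} (hx : LinSol L (fun _ => 0) s x) {t : ℝ}
    (ht : s ≤ t) : T L t s (sg r x s) = sg r x t :=
  flow_eq_of_eqn h.nn h.cara hx.1 (fun t ht => by simpa using hx.2 t ht) ht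

theorem T_add (h : Adm L m) {s t : ℝ} (ht : s ≤ t) (φ ψ : C r n) :
    T L t s (φ + ψ) = T L t s φ + T L t s ψ := by
  have h1 := (linSol_lsol h s φ).add h locallyIntegrable_zero' locallyIntegrable_zero'
    (linSol_lsol h s ψ)
  simp only [add_zero] at h1
  have h2 := h1.T_eq h ht
  rw [sg_add (continuous_lsol h s φ) (continuous_lsol h s ψ),
    sg_add (continuous_lsol h s φ) (continuous_lsol h s ψ), sg_lsol_self, sg_lsol_self] at h2
  rw [h2, T_eq_sg h ht, T_eq_sg h ht]

theorem T_smul (h : Adm L m) {s t : ℝ} (ht : s ≤ t) (c : ℝ) (φ : C r n) :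
    T L t s (c • φ) = c • T L t s φ := by
  have h1 := (linSol_lsol h s φ).smul c
  simp only [smul_zero] at h1
  have h2 := h1.T_eq h ht
  rw [sg_smul (continuous_lsol h s φ), sg_smul (continuous_lsol h s φ), sg_lsol_self] at h2
  rw [h2, T_eq_sg h ht]

theorem T_sub (h : Adm L m) {s t : ℝ} (ht : s ≤ t) (φ ψ : C r n) :
    T L t s (φ - ψ) = T L t s φ - T L t s ψ := by
  have h1 := T_add h ht φ ((-1 : ℝ) • ψ)
  rw [T_smul h ht, neg_one_smul, neg_one_smul] at h1
  rw [sub_eq_add_neg, h1, sub_eq_add_neg]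

/-- The difference of two solutions of the same forced equation is transported by `T`. -/
theorem LinSol.T_sub_eq (h : Adm L m) {f : ℝ → E n} (hf : LocallyIntegrable f volume) {s : ℝ}
    {x y : ℝ → E n} (hx : LinSol L f s x) (hy : LinSol L f s y) {t : ℝ} (ht : s ≤ t) :
    T L t s (sg r x s - sg r y s) = sg r x t - sg r y t := by
  have h1 := hx.add h hf (hf.smul (-1 : ℝ)) (hy.smul (-1))
  have h2 : LinSol L (fun _ => 0) s (fun v => x v + (-1 : ℝ) • y v) := by
    convert h1 using 2 with u
    simp
  have h3 := h2.T_eq h ht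
  have h4 : Continuous (fun v => (-1 : ℝ) • y v) := by have := hy.1; fun_prop
  rw [sg_add hx.1 h4, sg_add hx.1 h4, sg_smul hy.1,
    sg_smul hy.1, neg_one_smul, neg_one_smul, ← sub_eq_add_neg, ← sub_eq_add_neg] at h3
  exact h3

theorem norm_lsol_le (h : Adm L m) (s : ℝ) (φ : C r n) (t : ℝ) :
    ‖lsol h s φ t‖ ≤ 2 * ‖φ‖ * Real.exp (2 * Lam m s t) := by
  rcases le_total t s with h1 | h1
  · rw [lsol_past h h1, Lam_of_le s h1]
    have := norm_hist_le h.nn φ (t - s)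
    have h2 := norm_nonneg φ
    simp only [mul_zero, Real.exp_zero]
    linarith
  · refine gronwall_sg (r := r) h.int h.nonneg (continuous_lsol h s φ) (b := t) (norm_nonneg φ)
      (fun v hv => by rw [lsol_past h hv.2]; exact norm_hist_le h.nn φ _) (fun v hv => ?_) t
      ⟨by linarith [h.pos], le_rfl⟩
    rw [lsol_eqn h hv.1]
    refine (norm_add_le _ _).trans (add_le_add (norm_apply_le _ _) ?_)
    refine intervalIntegral.norm_integral_le_of_norm_le hv.1
      (Eventually.of_forall fun u _ => (L u).le_of_opNorm_le (h.le u) _)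
      ((locInt_interval h.int _ _).mul_continuousOn
        (continuous_sg (continuous_lsol h s φ)).norm.continuousOn)

theorem norm_sg_lsol_le (h : Adm L m) (s : ℝ) (φ : C r n) (t : ℝ) :
    ‖sg r (lsol h s φ) t‖ ≤ 2 * ‖φ‖ * Real.exp (2 * Lam m s t) :=
  norm_sg_le (continuous_lsol h s φ) (by positivity) fun v hv =>
    (norm_lsol_le h s φ v).trans (by gcongr; exact Lam_mono h.int h.nonneg s hv.2)

theorem norm_T_le (h : Adm L m) {s t : ℝ} (ht : s ≤ t) (φ : C r n) :
    ‖T L t s φ‖ ≤ 2 * Real.exp (2 * Lam m s t) * ‖φ‖ := by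
  rw [T_eq_sg h ht]
  exact (norm_sg_lsol_le h s φ t).trans (le_of_eq (by ring))

theorem Lam_anti (h : Adm L m) {s s' : ℝ} (hs : s ≤ s') (t : ℝ) : Lam m s' t ≤ Lam m s t := by
  rcases le_total t s' with h1 | h1
  · rw [Lam_of_le s' h1]; exact Lam_nonneg h.nonneg s t
  · rw [Lam, Lam, max_eq_right h1, max_eq_right (hs.trans h1),
      ← intervalIntegral.integral_add_adjacent_intervals (locInt_interval h.int s s')
        (locInt_interval h.int s' t)]
    have : 0 ≤ ∫ u in s..s', m u := intervalIntegral.integral_nonneg hs fun u _ => h.nonneg u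
    linarith

/-- `T(t, s)`, `s ≤ t`, as a bounded operator. -/
noncomputable def TL (h : Adm L m) {s t : ℝ} (ht : s ≤ t) : C r n →L[ℝ] C r n :=
  LinearMap.mkContinuous
    { toFun := T L t s
      map_add' := T_add h ht
      map_smul' := T_smul h ht } _ (norm_T_le h ht)

theorem TL_apply (h : Adm L m) {s t : ℝ} (ht : s ≤ t) (φ : C r n) : TL h ht φ = T L t s φ := rfl

/-- Dependence of solutions on the initial time, which is moved from `s` to `s' ≥ s`: `Δ` bounds the change of the history, and the integral of `m` the
evolution between the two initial times. -/
theorem norm_lsol_sub_le (h : Adm L m) (φ : C r n) {s s' b Δ : ℝ} (hs : s ≤ s')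
    (hΔ : ∀ v, ‖hist h.nn φ (v - s') - hist h.nn φ (v - s)‖ ≤ Δ) {t : ℝ} (ht : t ≤ b) :
    ‖lsol h s' φ t - lsol h s φ t‖ ≤ 2 * (Δ + (∫ u in s..s', m u) *
      (2 * ‖φ‖ * Real.exp (2 * Lam m s s'))) * Real.exp (2 * Lam m s b) := by
  set c := Δ + (∫ u in s..s', m u) * (2 * ‖φ‖ * Real.exp (2 * Lam m s s')) with hc
  have hΔ0 : 0 ≤ Δ := (norm_nonneg _).trans (hΔ 0)
  have hI0 : 0 ≤ ∫ u in s..s', m u := intervalIntegral.integral_nonneg hs fun u _ => h.nonneg u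
  have hc0 : 0 ≤ c := by positivity
  have hxi := h.locallyIntegrable (continuous_lsol h s φ)
  have hyi := h.locallyIntegrable (continuous_lsol h s' φ)
  -- the contribution of the interval between the two initial times
  have hJ : ∀ t ∈ Icc s s', ‖∫ u in s..t, L u (sg r (lsol h s φ) u)‖ ≤
      (∫ u in s..s', m u) * (2 * ‖φ‖ * Real.exp (2 * Lam m s s')) := by
    intro t ht
    calc ‖∫ u in s..t, L u (sg r (lsol h s φ) u)‖
        ≤ ∫ u in s..t, m u * (2 * ‖φ‖ * Real.exp (2 * Lam m s s')) := by
          refine intervalIntegral.norm_integral_le_of_norm_le ht.1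
            (Eventually.of_forall fun u hu => ?_) ((locInt_interval h.int _ _).mul_const _)
          refine (L u).le_of_opNorm_le_of_le (h.le u) ((norm_sg_lsol_le h s φ u).trans ?_)
          gcongr
          exact Lam_mono h.int h.nonneg s (hu.2.trans ht.2)
      _ = (∫ u in s..t, m u) * (2 * ‖φ‖ * Real.exp (2 * Lam m s s')) := by
          rw [intervalIntegral.integral_mul_const]
      _ ≤ _ := by
          gcongr
          rw [← intervalIntegral.integral_add_adjacent_intervals (locInt_interval h.int s t)
            (locInt_interval h.int t s')]
          have : 0 ≤ ∫ u in t..s', m u :=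
            intervalIntegral.integral_nonneg ht.2 fun u _ => h.nonneg u
          linarith
  have hx : ∀ t, s ≤ t → lsol h s φ t = hist h.nn φ (t - s) +
      ∫ u in s..t, L u (sg r (lsol h s φ) u) := fun t ht => by
    rw [lsol_eqn h ht, hist_of_nonneg h.nn φ (by linarith)]
  have hy : ∀ t, s' ≤ t → lsol h s' φ t = hist h.nn φ (t - s') +
      ∫ u in s'..t, L u (sg r (lsol h s' φ) u) := fun t ht => by
    rw [lsol_eqn h ht, hist_of_nonneg h.nn φ (by linarith)]
  have hcont : Continuous (fun v => lsol h s' φ v - lsol h s φ v) :=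
    (continuous_lsol h s' φ).sub (continuous_lsol h s φ)
  have hpast : ∀ v, v ≤ s' → ‖lsol h s' φ v - lsol h s φ v‖ ≤ c := fun v hv => by
    rw [lsol_past h hv]
    rcases le_total v s with h1 | h1
    · rw [lsol_past h h1]
      exact (hΔ v).trans (by rw [hc]; linarith [show 0 ≤ (∫ u in s..s', m u) *
        (2 * ‖φ‖ * Real.exp (2 * Lam m s s')) by positivity])
    · rw [hx v h1, ← sub_sub]
      exact (norm_sub_le _ _).trans (add_le_add (hΔ v) (hJ v ⟨h1, hv⟩))
  rcases le_total t s' with hts | hts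
  · refine (hpast t hts).trans ?_
    have : 1 ≤ Real.exp (2 * Lam m s b) :=
      Real.one_le_exp (by have := Lam_nonneg h.nonneg s b; linarith)
    nlinarith
  have key := gronwall_sg (r := r) h.int h.nonneg hcont (s := s') (b := b) hc0
    (fun v hv => hpast v hv.2)
    (fun v hv => by
      rw [hy v hv.1, hx v (hs.trans hv.1),
        ← intervalIntegral.integral_add_adjacent_intervals (locInt_interval hxi s s')
          (locInt_interval hxi s' v)]
      have e : ∀ a b c d e : E n, a + b - (c + (d + e)) = (a - c) - d + (b - e) := by
        intros; abel
      rw [e, ← intervalIntegral.integral_sub (locInt_interval hyi _ _) (locInt_interval hxi _ _)]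
      refine (norm_add_le _ _).trans (add_le_add ?_ ?_)
      · exact (norm_sub_le _ _).trans (add_le_add (hΔ v) (hJ s' ⟨hs, le_rfl⟩))
      · refine intervalIntegral.norm_integral_le_of_norm_le hv.1
          (Eventually.of_forall fun u _ => ?_)
          ((locInt_interval h.int _ _).mul_continuousOn (continuous_sg hcont).norm.continuousOn)
        rw [← map_sub, ← sg_sub (continuous_lsol h s' φ) (continuous_lsol h s φ)]
        exact (L u).le_of_opNorm_le (h.le u) _) t ⟨by linarith [h.pos], ht⟩
  refine key.trans ?_
  gcongr
  exact (Lam_mono h.int h.nonneg s' ht).trans (Lam_anti h hs b)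

/-- Solutions depend continuously on the initial time, uniformly on half-lines `(-∞, b]`. -/
theorem eventually_norm_lsol_sub_le (h : Adm L m) (φ : C r n) (s₀ b : ℝ) {ε : ℝ} (hε : 0 < ε) :
    ∀ᶠ s in 𝓝 s₀, ∀ t, t ≤ b → ‖lsol h s φ t - lsol h s₀ φ t‖ ≤ ε := by
  set B := 2 * ‖φ‖ * Real.exp (2 * Lam m (s₀ - 1) (s₀ + 1)) with hB
  set W := Real.exp (2 * Lam m (s₀ - 1) b) with hW
  have hW1 : 1 ≤ W := Real.one_le_exp (by have := Lam_nonneg h.nonneg (s₀ - 1) b; linarith)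
  have hB0 : 0 ≤ B := by positivity
  -- uniform continuity of the extended history
  have huc : UniformContinuous (hist h.nn φ) :=
    (CompactSpace.uniformContinuous_of_continuous (map_continuous φ)).comp
      (LipschitzWith.projIcc _).uniformContinuous
  obtain ⟨η, hη, hηφ⟩ := Metric.uniformContinuous_iff.1 huc (ε / (8 * W)) (by positivity)
  have hI : Tendsto (fun s => ∫ u in s₀..s, m u) (𝓝 s₀) (𝓝 0) := by
    have := (intervalIntegral.continuous_primitive (fun a b => locInt_interval h.int a b)
      s₀).tendsto s₀
    rwa [intervalIntegral.integral_same] at this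
  have hIε : ∀ᶠ s in 𝓝 s₀, |∫ u in s₀..s, m u| ≤ ε / (8 * W * (B + 1)) := by
    have := Metric.tendsto_nhds.1 hI (ε / (8 * W * (B + 1))) (by positivity)
    filter_upwards [this] with s hs
    rw [Real.dist_eq, sub_zero] at hs
    exact hs.le
  filter_upwards [hIε, Metric.ball_mem_nhds s₀ hη, Metric.ball_mem_nhds s₀ one_pos] with s h1 h2 h3
  rw [Metric.mem_ball, Real.dist_eq] at h2 h3
  have h3' := abs_lt.1 h3
  have hΔ : ∀ v, ‖hist h.nn φ (v - s) - hist h.nn φ (v - s₀)‖ ≤ ε / (8 * W) := fun v => by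
    have := hηφ (a := v - s) (b := v - s₀) (by
      rw [Real.dist_eq, show v - s - (v - s₀) = -(s - s₀) by ring, abs_neg]; exact h2)
    rw [dist_eq_norm] at this
    exact this.le
  have hfin : ∀ a c : ℝ, 0 ≤ a → a ≤ ε / (8 * W * (B + 1)) → 0 ≤ c → c ≤ B →
      2 * (ε / (8 * W) + a * c) * W ≤ ε := by
    intro a c ha0 ha hc0 hc
    have e1 : a * c ≤ ε / (8 * W * (B + 1)) * (B + 1) := by gcongr; linarith
    have e2 : ε / (8 * W * (B + 1)) * (B + 1) = ε / (8 * W) := by field_simp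
    have e3 : ε / (8 * W) * W = ε / 8 := by field_simp
    rw [e2] at e1
    nlinarith
  intro t ht
  have hsmall : ∀ s s', s₀ - 1 ≤ s → s' ≤ s₀ + 1 →
      2 * ‖φ‖ * Real.exp (2 * Lam m s s') ≤ B := by
    intro s s' ha hb
    rw [hB]
    gcongr
    exact (Lam_anti h ha _).trans (Lam_mono h.int h.nonneg _ hb)
  have hbig : ∀ s, s₀ - 1 ≤ s → Real.exp (2 * Lam m s b) ≤ W := by
    intro s ha
    rw [hW]
    gcongr
    exact Lam_anti h ha _
  rcases le_total s₀ s with hs | hs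
  · have hI0 : 0 ≤ ∫ u in s₀..s, m u := intervalIntegral.integral_nonneg hs fun u _ => h.nonneg u
    refine (norm_lsol_sub_le h φ hs hΔ ht).trans ?_
    refine le_trans ?_ (hfin _ _ hI0 ((le_abs_self _).trans h1) (by positivity)
      (hsmall s₀ s (by linarith) (by linarith)))
    gcongr
    exact hbig s₀ (by linarith)
  · have hI0 : 0 ≤ ∫ u in s..s₀, m u := intervalIntegral.integral_nonneg hs fun u _ => h.nonneg u
    rw [intervalIntegral.integral_symm, abs_neg] at h1
    rw [norm_sub_rev]
    refine (norm_lsol_sub_le h φ hs (fun v => by rw [norm_sub_rev]; exact hΔ v) ht).trans ?_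
    refine le_trans ?_ (hfin _ _ hI0 ((le_abs_self _).trans h1) (by positivity)
      (hsmall s s₀ (by linarith) (by linarith)))
    gcongr
    exact hbig s (by linarith)

/-- Joint continuity in the final and in the initial time. -/
theorem continuous_sg_lsol (h : Adm L m) (φ : C r n) :
    Continuous (fun p : ℝ × ℝ => sg r (lsol h p.2 φ) p.1) := by
  rw [continuous_iff_continuousAt]
  rintro ⟨t₀, s₀⟩
  rw [ContinuousAt, Metric.tendsto_nhds]
  intro ε hε
  have h1 := eventually_norm_lsol_sub_le h φ s₀ (t₀ + 1) (ε := ε / 3) (by positivity)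
  have h2 : ∀ᶠ t in 𝓝 t₀, t < t₀ + 1 := gt_mem_nhds (by simp)
  have h3 : ∀ᶠ t in 𝓝 t₀, dist (sg r (lsol h s₀ φ) t) (sg r (lsol h s₀ φ) t₀) < ε / 3 :=
    Metric.tendsto_nhds.1 ((continuous_sg (continuous_lsol h s₀ φ)).tendsto t₀) _ (by positivity)
  filter_upwards [(h2.and h3).prod_nhds h1] with p hp
  obtain ⟨⟨h2, h3⟩, h1⟩ := hp
  have h4 : dist (sg r (lsol h p.2 φ) p.1) (sg r (lsol h s₀ φ) p.1) ≤ ε / 3 := by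
    rw [dist_eq_norm, ← sg_sub (continuous_lsol h _ φ) (continuous_lsol h _ φ)]
    exact norm_sg_le ((continuous_lsol h _ φ).sub (continuous_lsol h _ φ)) (by positivity)
      fun v hv => h1 v (hv.2.trans h2.le)
  calc _ ≤ _ := dist_triangle _ (sg r (lsol h s₀ φ) p.1) _
    _ < ε := by linarith

end Linear

/-! ### The fundamental solution and the operators `T₀` -/

section Fundamental

variable {r : ℝ} {n : ℕ}

theorem sg_apply' {x : ℝ → E n} {t : ℝ} (hx : Continuous (seg r x t)) (ω : I r) :
    sg r x t ω = x (t + ω) := toC_apply hx ω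

/-- Continuous approximations `ω ↦ max(0, 1 + kω) p` of the history `X₀ p`. -/
noncomputable def bump (r : ℝ) {n : ℕ} (k : ℕ) (p : E n) : C r n :=
  C.mk (fun ω => (max 0 (1 + k * (ω : ℝ))) • p) (by fun_prop)

theorem bump_apply (k : ℕ) (p : E n) (ω : I r) :
    bump r k p ω = (max 0 (1 + k * (ω : ℝ))) • p := rfl

theorem norm_bump_le (k : ℕ) (p : E n) : ‖bump r k p‖ ≤ ‖p‖ := by
  refine C_norm_le (norm_nonneg _) fun ω => ?_
  rw [bump_apply, norm_smul, Real.norm_of_nonneg (le_max_left _ _)]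
  refine mul_le_of_le_one_left (norm_nonneg _) (max_le zero_le_one ?_)
  have := mul_nonneg (Nat.cast_nonneg (α := ℝ) k) (neg_nonneg.2 ω.2.2)
  linarith

theorem bump_add (k : ℕ) (p p' : E n) : bump r k (p + p') = bump r k p + bump r k p' :=
  DFunLike.ext _ _ fun _ => smul_add _ _ _

theorem bump_smul (k : ℕ) (c : ℝ) (p : E n) : bump r k (c • p) = c • bump r k p :=
  DFunLike.ext _ _ fun _ => smul_comm _ _ _

/-- The function that jumps from `0` to `p` at time `τ`. -/
noncomputable def step {n : ℕ} (τ : ℝ) (p : E n) (v : ℝ) : E n := if τ ≤ v then p else 0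

theorem tendsto_bump (hr : 0 < r) (τ : ℝ) (p : E n) (v : ℝ) :
    Tendsto (fun k => hist hr.le (bump r k p) (v - τ)) atTop (𝓝 (step τ p v)) := by
  unfold step
  split_ifs with h
  · refine tendsto_const_nhds.congr fun k => ?_
    rw [hist_of_nonneg _ _ (by linarith), bump_apply]
    simp [zeroI]
  · push Not at h
    set ω := projIcc (-r) 0 (by linarith) (v - τ) with hω
    have hneg : (ω : ℝ) < 0 := by
      rw [hω, coe_projIcc]
      exact max_lt (by linarith) (by rw [min_eq_right (by linarith)]; linarith)
    refine tendsto_const_nhds.congr' ?_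
    obtain ⟨K, hK⟩ := exists_nat_gt (-1 / (ω : ℝ))
    filter_upwards [eventually_ge_atTop K] with k hk
    change (0 : E n) = (max 0 (1 + k * (ω : ℝ))) • p
    have h1 : (-1 / (ω : ℝ)) < k := hK.trans_le (by exact_mod_cast hk)
    rw [div_lt_iff_of_neg hneg] at h1
    rw [max_eq_left (by linarith), zero_smul]

variable {L : ℝ → C r n →L[ℝ] E n} {m : ℝ → ℝ}

theorem bddLimit_step (h : Adm L m) (τ : ℝ) (p : E n) (u : ℝ) :
    BddLimit (r := r) ‖p‖ (seg r (step τ p) u) := by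
  have hc : ∀ k, Continuous (fun v => hist h.nn (bump r k p) (v - τ)) := fun k =>
    (continuous_hist h.nn _).comp (by fun_prop)
  refine ⟨fun k => sg r (fun v => hist h.nn (bump r k p) (v - τ)) u, fun k => ?_, fun ω => ?_⟩
  · exact norm_sg_le (hc k) (norm_nonneg _) fun v _ => (norm_hist_le _ _ _).trans (norm_bump_le _ _)
  · simp_rw [sg_apply (hc _)]
    exact tendsto_bump h.pos τ p (u + ω)

/-- The forcing produced by the jump of the fundamental solution. -/
noncomputable def stepForce (L : ℝ → C r n →L[ℝ] E n) (τ : ℝ) (p : E n) (u : ℝ) : E n :=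
  extendOp (L u) (seg r (step τ p) u)

theorem tendsto_stepForce (h : Adm L m) (τ : ℝ) (p : E n) (u : ℝ) :
    Tendsto (fun k => L u (sg r (fun v => hist h.nn (bump r k p) (v - τ)) u)) atTop
      (𝓝 (stepForce L τ p u)) := by
  have hc : ∀ k, Continuous (fun v => hist h.nn (bump r k p) (v - τ)) := fun k =>
    (continuous_hist h.nn _).comp (by fun_prop)
  refine extendOp_tendsto (M := ‖p‖) (L u) (fun k => ?_) fun ω => ?_
  · exact norm_sg_le (hc k) (norm_nonneg _) fun v _ => (norm_hist_le _ _ _).trans (norm_bump_le _ _)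
  · simp_rw [sg_apply (hc _)]
    exact tendsto_bump h.pos τ p (u + ω)

theorem norm_stepForce_le (h : Adm L m) (τ : ℝ) (p : E n) (u : ℝ) :
    ‖stepForce L τ p u‖ ≤ m u * ‖p‖ :=
  ((bddLimit_step h τ p u).norm_extendOp_le _).trans (by gcongr; exact h.le u)

theorem locallyIntegrable_stepForce (h : Adm L m) (τ : ℝ) (p : E n) :
    LocallyIntegrable (stepForce L τ p) volume := by
  have hmeas : AEStronglyMeasurable (stepForce L τ p) volume :=
    aestronglyMeasurable_of_tendsto_ae (u := atTop)
      (f := fun k u => L u (sg r (fun v => hist h.nn (bump r k p) (v - τ)) u))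
      (fun k => (h.locallyIntegrable ((continuous_hist h.nn _).comp
        (by fun_prop))).aestronglyMeasurable)
      (Eventually.of_forall fun u => tendsto_stepForce h τ p u)
  have h1 : LocallyIntegrable (fun u => m u * ‖p‖) volume := by
    simp_rw [mul_comm (m _)]
    exact h.int.smul ‖p‖
  exact h1.mono hmeas (Eventually.of_forall fun u =>
    (norm_stepForce_le h τ p u).trans (le_abs_self _))

/-- The continuous part of the fundamental solution. -/
noncomputable def fundCont (h : Adm L m) (τ : ℝ) (p : E n) : ℝ → E n :=
  sol h.nn (fun u φ => L u φ + stepForce L τ p u) τ 0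

/-- The fundamental solution `X(·, τ) p`: it vanishes before `τ`, jumps to `p` at `τ` and solves the
linear equation afterwards. -/
noncomputable def fund (h : Adm L m) (τ : ℝ) (p : E n) (v : ℝ) : E n :=
  step τ p v + fundCont h τ p v

theorem niceSol_fundCont (h : Adm L m) (τ : ℝ) (p : E n) :
    NiceSol h.nn (fun u φ => L u φ + stepForce L τ p u) τ 0 (fundCont h τ p) :=
  niceSol_sol h.nn (h.cara_forced (locallyIntegrable_stepForce h τ p)) τ 0

theorem continuous_fundCont (h : Adm L m) (τ : ℝ) (p : E n) : Continuous (fundCont h τ p) :=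
  (niceSol_fundCont h τ p).cont

theorem fundCont_past (h : Adm L m) {τ v : ℝ} (hv : v ≤ τ) (p : E n) : fundCont h τ p v = 0 :=
  (niceSol_fundCont h τ p).past v hv

theorem fundCont_eqn (h : Adm L m) {τ t : ℝ} (ht : τ ≤ t) (p : E n) :
    fundCont h τ p t = ∫ u in τ..t, (L u (sg r (fundCont h τ p) u) + stepForce L τ p u) := by
  rw [(niceSol_fundCont h τ p).eqn t ht]
  exact zero_add _

theorem fund_of_lt (h : Adm L m) {τ v : ℝ} (hv : v < τ) (p : E n) : fund h τ p v = 0 := by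
  rw [fund, fundCont_past h hv.le, step, if_neg (not_le.2 hv), add_zero]

theorem fund_self (h : Adm L m) (τ : ℝ) (p : E n) : fund h τ p τ = p := by
  rw [fund, fundCont_past h le_rfl, step, if_pos le_rfl, add_zero]

theorem fund_of_le (h : Adm L m) {τ v : ℝ} (hv : τ ≤ v) (p : E n) :
    fund h τ p v = p + fundCont h τ p v := by
  rw [fund, step, if_pos hv]

theorem continuous_seg_fund (h : Adm L m) {τ t : ℝ} (ht : τ + r ≤ t) (p : E n) :
    Continuous (seg r (fund h τ p) t) := by
  have : seg r (fund h τ p) t = fun ω : I r => p + fundCont h τ p (t + ω) := by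
    funext ω
    exact fund_of_le h (by linarith [ω.2.1]) p
  rw [this]
  have := continuous_fundCont h τ p
  fun_prop

theorem lsol_bump_past (h : Adm L m) {τ t : ℝ} (ht : t < τ) (p : E n) :
    Tendsto (fun k => lsol h τ (bump r k p) t) atTop (𝓝 (fund h τ p t)) := by
  simp_rw [lsol_past h ht.le]
  have := tendsto_bump h.pos τ p t
  rwa [fund, fundCont_past h ht.le, add_zero]

/-- The solutions with histories `bump k p` converge to the fundamental solution, uniformly on
compact subintervals of `[τ, ∞)`. -/
theorem eventually_norm_lsol_bump_sub_le (h : Adm L m) (τ b : ℝ) (p : E n) {ε : ℝ} (hε : 0 < ε) :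
    ∀ᶠ k in atTop, ∀ t ∈ Icc τ b, ‖lsol h τ (bump r k p) t - fund h τ p t‖ ≤ ε := by
  rcases lt_or_ge b τ with hb | hb
  · exact Eventually.of_forall fun k t ht => by linarith [ht.1, ht.2]
  set H : ℕ → ℝ → E n := fun k v => hist h.nn (bump r k p) (v - τ) with hH
  have hHc : ∀ k, Continuous (H k) := fun k => (continuous_hist h.nn _).comp (by fun_prop)
  have hHb : ∀ k v, ‖H k v‖ ≤ ‖p‖ := fun k v => (norm_hist_le _ _ _).trans (norm_bump_le _ _)
  have hfi := locallyIntegrable_stepForce h τ p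
  have hgi : ∀ k, LocallyIntegrable (fun u => L u (sg r (H k) u) - stepForce L τ p u) volume :=
    fun k => (h.locallyIntegrable (hHc k)).sub hfi
  have hgb : ∀ k u, ‖L u (sg r (H k) u) - stepForce L τ p u‖ ≤ 2 * (m u * ‖p‖) := fun k u => by
    refine (norm_sub_le _ _).trans ?_
    have h1 := (L u).le_of_opNorm_le_of_le (h.le u)
      (norm_sg_le (t := u) (hHc k) (norm_nonneg p) fun v _ => hHb k v)
    have h2 := norm_stepForce_le h τ p u
    linarith
  have hlim : Tendsto (fun k => ∫ u in τ..b, ‖L u (sg r (H k) u) - stepForce L τ p u‖) atTop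
      (𝓝 0) := by
    have h0 : (0 : ℝ) = ∫ u in τ..b, (0 : ℝ) := by simp
    rw [h0]
    refine intervalIntegral.tendsto_integral_filter_of_dominated_convergence
      (fun u => 2 * (m u * ‖p‖)) (Eventually.of_forall fun k => ?_)
      (Eventually.of_forall fun k => Eventually.of_forall fun u _ => ?_)
      (((locInt_interval h.int _ _).mul_const _).const_mul _)
      (Eventually.of_forall fun u _ => ?_)
    · exact (hgi k).aestronglyMeasurable.norm.restrict
    · rw [norm_norm]; exact hgb k u
    · have := (tendsto_stepForce h τ p u).sub_const (stepForce L τ p u)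
      rw [sub_self] at this
      simpa using this.norm
  set W := Real.exp (2 * Lam m τ b) with hW
  have hev := Metric.tendsto_nhds.1 hlim (ε / (2 * W)) (by positivity)
  filter_upwards [hev] with k hk t ht
  set c := ∫ u in τ..b, ‖L u (sg r (H k) u) - stepForce L τ p u‖ with hc
  have hc0 : 0 ≤ c := intervalIntegral.integral_nonneg hb fun u _ => norm_nonneg _
  rw [Real.dist_eq, sub_zero, abs_of_nonneg hc0] at hk
  -- `D` is the difference of the continuous parts
  set D : ℝ → E n := fun v => (lsol h τ (bump r k p) v - H k v) - fundCont h τ p v with hD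
  have hl := continuous_lsol h τ (bump r k p)
  have hy := continuous_fundCont h τ p
  have hlH : Continuous (fun v => lsol h τ (bump r k p) v - H k v) := hl.sub (hHc k)
  have hDc : Continuous D := hlH.sub hy
  have hDpast : ∀ v, v ≤ τ → D v = 0 := fun v hv => by
    rw [hD]
    simp only
    rw [lsol_past h hv, fundCont_past h hv, hH]
    simp
  have hHτ : ∀ v, τ ≤ v → H k v = p := fun v hv => by
    rw [hH]
    simp only
    rw [hist_of_nonneg _ _ (by linarith), bump_apply]
    simp [zeroI]
  have hDeq : D t = lsol h τ (bump r k p) t - fund h τ p t := by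
    change lsol h τ (bump r k p) t - H k t - fundCont h τ p t = _
    rw [fund_of_le h ht.1, hHτ t ht.1, sub_sub]
  have hφ0 : bump r k p (zeroI h.nn) = p := by rw [bump_apply]; simp [zeroI]
  have key := gronwall_sg (r := r) h.int h.nonneg hDc (s := τ) (b := b) hc0
    (fun v hv => by rw [hDpast v hv.2, norm_zero]; exact hc0)
    (fun v hv => by
      have hli := h.locallyIntegrable hl
      have e1 : D v = ∫ u in τ..v, (L u (sg r D u) +
          (L u (sg r (H k) u) - stepForce L τ p u)) := by
        change lsol h τ (bump r k p) v - H k v - fundCont h τ p v = _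
        rw [lsol_eqn h hv.1, hHτ v hv.1, hφ0, fundCont_eqn h hv.1, add_sub_cancel_left,
          ← intervalIntegral.integral_sub (locInt_interval hli _ _)
            (locInt_interval (h.locallyIntegrable_forced hfi hy) _ _)]
        refine intervalIntegral.integral_congr fun u _ => ?_
        change _ = L u (sg r (fun v => lsol h τ (bump r k p) v - H k v - fundCont h τ p v) u) + _
        rw [sg_sub hlH hy, sg_sub hl (hHc k), map_sub, map_sub]
        abel
      have hDi := h.locallyIntegrable hDc
      rw [e1, intervalIntegral.integral_add (locInt_interval hDi _ _)
        (locInt_interval (hgi k) _ _), add_comm c]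
      refine (norm_add_le _ _).trans (add_le_add ?_ ?_)
      · exact intervalIntegral.norm_integral_le_of_norm_le hv.1
          (Eventually.of_forall fun u _ => (L u).le_of_opNorm_le (h.le u) _)
          ((locInt_interval h.int _ _).mul_continuousOn (continuous_sg hDc).norm.continuousOn)
      · refine (intervalIntegral.norm_integral_le_integral_norm hv.1).trans ?_
        rw [hc, ← intervalIntegral.integral_add_adjacent_intervals
          (locInt_interval (hgi k) τ v).norm (locInt_interval (hgi k) v b).norm]
        have : 0 ≤ ∫ u in v..b, ‖L u (sg r (H k) u) - stepForce L τ p u‖ :=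
          intervalIntegral.integral_nonneg hv.2 fun u _ => norm_nonneg _
        linarith) t ⟨by linarith [ht.1, h.pos], ht.2⟩
  rw [← hDeq]
  refine key.trans ?_
  have h1 : Real.exp (2 * Lam m τ t) ≤ W := by
    rw [hW]; gcongr; exact Lam_mono h.int h.nonneg τ ht.2
  calc 2 * c * Real.exp (2 * Lam m τ t) ≤ 2 * (ε / (2 * W)) * W := by gcongr
    _ = ε := by
        have : W ≠ 0 := (Real.exp_pos _).ne'
        field_simp

theorem tendsto_lsol_bump (h : Adm L m) (τ : ℝ) (p : E n) (t : ℝ) :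
    Tendsto (fun k => lsol h τ (bump r k p) t) atTop (𝓝 (fund h τ p t)) := by
  rcases lt_or_ge t τ with ht | ht
  · exact lsol_bump_past h ht p
  · rw [Metric.tendsto_nhds]
    intro ε hε
    filter_upwards [eventually_norm_lsol_bump_sub_le h τ t p (half_pos hε)] with k hk
    rw [dist_eq_norm]
    exact (hk t ⟨ht, le_rfl⟩).trans_lt (half_lt_self hε)

theorem norm_fund_le (h : Adm L m) (τ : ℝ) (p : E n) (t : ℝ) :
    ‖fund h τ p t‖ ≤ 2 * ‖p‖ * Real.exp (2 * Lam m τ t) := by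
  refine le_of_tendsto (tendsto_lsol_bump h τ p t).norm (Eventually.of_forall fun k => ?_)
  refine (norm_lsol_le h τ _ t).trans ?_
  gcongr
  exact norm_bump_le k p

theorem lsol_eq_T (h : Adm L m) {s t : ℝ} (ht : s ≤ t) (φ : C r n) :
    lsol h s φ t = T L t s φ (zeroI h.nn) := by
  rw [T_eq_sg h ht, sg_apply (continuous_lsol h s φ)]
  simp [zeroI]

theorem lsol_add (h : Adm L m) (s : ℝ) (φ ψ : C r n) (t : ℝ) :
    lsol h s (φ + ψ) t = lsol h s φ t + lsol h s ψ t := by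
  rcases le_total s t with ht | ht
  · rw [lsol_eq_T h ht, lsol_eq_T h ht, lsol_eq_T h ht, T_add h ht]; rfl
  · rw [lsol_past h ht, lsol_past h ht, lsol_past h ht]; rfl

theorem lsol_smul (h : Adm L m) (s : ℝ) (c : ℝ) (φ : C r n) (t : ℝ) :
    lsol h s (c • φ) t = c • lsol h s φ t := by
  rcases le_total s t with ht | ht
  · rw [lsol_eq_T h ht, lsol_eq_T h ht, T_smul h ht]; rfl
  · rw [lsol_past h ht, lsol_past h ht]; rfl

theorem fund_add (h : Adm L m) (τ : ℝ) (p p' : E n) (t : ℝ) :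
    fund h τ (p + p') t = fund h τ p t + fund h τ p' t := by
  refine tendsto_nhds_unique (tendsto_lsol_bump h τ (p + p') t) ?_
  simp_rw [bump_add, lsol_add]
  exact (tendsto_lsol_bump h τ p t).add (tendsto_lsol_bump h τ p' t)

theorem fund_smul (h : Adm L m) (τ : ℝ) (c : ℝ) (p : E n) (t : ℝ) :
    fund h τ (c • p) t = c • fund h τ p t := by
  refine tendsto_nhds_unique (tendsto_lsol_bump h τ (c • p) t) ?_
  simp_rw [bump_smul, lsol_smul]
  exact (tendsto_lsol_bump h τ p t).const_smul c

theorem fund_sum (h : Adm L m) (τ : ℝ) (p : E n) (t : ℝ) :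
    fund h τ p t = ∑ j, p j • fund h τ (unitVec j) t := by
  let Φ : E n →ₗ[ℝ] E n :=
    { toFun := fun p => fund h τ p t
      map_add' := fun p p' => fund_add h τ p p' t
      map_smul' := fun c p => fund_smul h τ c p t }
  change Φ p = ∑ j, p j • Φ (unitVec j)
  conv_lhs => rw [← sum_smul_unitVec p, map_sum]
  simp_rw [map_smul]

theorem continuous_lsol_two (h : Adm L m) (φ : C r n) :
    Continuous (fun q : ℝ × ℝ => lsol h q.2 φ q.1) := by
  have h1 : ∀ q : ℝ × ℝ, lsol h q.2 φ q.1 = sg r (lsol h q.2 φ) q.1 (zeroI h.nn) := fun q => by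
    rw [sg_apply (continuous_lsol h _ φ)]; simp [zeroI]
  simp_rw [h1]
  exact (continuous_eval_const (F := C(I r, E n)) (zeroI h.nn)).comp
    (continuous_sg_lsol h φ)

theorem stronglyMeasurable_fund (h : Adm L m) (p : E n) :
    StronglyMeasurable (fun q : ℝ × ℝ => fund h q.2 p q.1) :=
  stronglyMeasurable_of_tendsto atTop
    (fun k => (continuous_lsol_two h (bump r k p)).stronglyMeasurable)
    (tendsto_pi_nhds.2 fun q => tendsto_lsol_bump h q.2 p q.1)

/-- `T₀(τ + r, τ) X₀ p`, the first continuous segment of the fundamental solution. -/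
noncomputable def fundSeg (h : Adm L m) (τ : ℝ) (p : E n) : C r n := sg r (fund h τ p) (τ + r)

theorem tendsto_T_bump (h : Adm L m) {τ t : ℝ} (ht : τ + r ≤ t) (p : E n) :
    Tendsto (fun k => T L t τ (bump r k p)) atTop (𝓝 (sg r (fund h τ p) t)) := by
  rw [Metric.tendsto_nhds]
  intro ε hε
  filter_upwards [eventually_norm_lsol_bump_sub_le h τ t p (half_pos hε)] with k hk
  rw [dist_eq_norm, T_eq_sg h (by linarith [h.pos])]
  refine (C_norm_le (half_pos hε).le fun ω => ?_).trans_lt (half_lt_self hε)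
  change ‖sg r (lsol h τ (bump r k p)) t ω - sg r (fund h τ p) t ω‖ ≤ _
  rw [sg_apply (continuous_lsol h _ _), sg_apply' (continuous_seg_fund h ht p)]
  exact hk _ ⟨by linarith [ω.2.1], by linarith [ω.2.2]⟩

theorem T_fundSeg (h : Adm L m) {τ t : ℝ} (ht : τ + r ≤ t) (p : E n) :
    T L t (τ + r) (fundSeg h τ p) = sg r (fund h τ p) t := by
  have hr := h.pos
  refine tendsto_nhds_unique (((TL h ht).continuous.tendsto _).comp (tendsto_T_bump h le_rfl p)) ?_
  refine (tendsto_T_bump h ht p).congr fun k => ?_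
  change _ = T L t (τ + r) (T L (τ + r) τ (bump r k p))
  rw [T_T h (by linarith) ht]

theorem stronglyMeasurable_fundSeg (h : Adm L m) (p : E n) :
    StronglyMeasurable (fun τ => fundSeg h τ p) := by
  refine stronglyMeasurable_of_tendsto (f := fun k τ => sg r (lsol h τ (bump r k p)) (τ + r)) atTop
    (fun k => ((continuous_sg_lsol h (bump r k p)).comp
      (f := fun τ : ℝ => (τ + r, τ)) (by fun_prop)).stronglyMeasurable)
    (tendsto_pi_nhds.2 fun τ => ?_)
  refine (tendsto_T_bump h le_rfl p).congr fun k => ?_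
  rw [T_eq_sg h (by linarith [h.pos])]

theorem fundSeg_sum (h : Adm L m) (τ : ℝ) (p : E n) :
    fundSeg h τ p = ∑ j, p j • fundSeg h τ (unitVec j) := by
  have hr := h.pos
  have hs : ∀ s : Finset (Fin n), ∀ ω, (∑ j ∈ s, p j • fundSeg h τ (unitVec j)) ω =
      ∑ j ∈ s, p j • fundSeg h τ (unitVec j) ω := by
    intro s ω
    induction s using Finset.cons_induction with
    | empty => rfl
    | cons a s ha ih => rw [Finset.sum_cons, Finset.sum_cons, ← ih]; rfl
  refine DFunLike.ext _ _ fun ω => ?_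
  rw [hs]
  unfold fundSeg
  simp_rw [sg_apply' (continuous_seg_fund h le_rfl _)]
  exact fund_sum h τ p _

end Fundamental

section Tzero

variable {r : ℝ} {n : ℕ} {L : ℝ → C r n →L[ℝ] E n} {m : ℝ → ℝ}

theorem seg_add_eq (x y : ℝ → E n) (t : ℝ) :
    seg r (fun v => x v + y v) t = fun ω => seg r x t ω + seg r y t ω := rfl

theorem bddLimit_sg {x : ℝ → E n} (hx : Continuous x) (u : ℝ) :
    BddLimit ‖sg r x u‖ (seg r x u) := by
  have := bddLimit_coe (sg r x u)
  rwa [show (fun ω => sg r x u ω) = seg r x u from funext fun ω => sg_apply hx u ω] at this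

theorem extendOp_seg {x : ℝ → E n} (hx : Continuous x) (Λ : C r n →L[ℝ] E n) (u : ℝ) :
    extendOp Λ (seg r x u) = Λ (sg r x u) := by
  rw [← extendOp_coe Λ (sg r x u)]
  congr 1
  exact funext fun ω => (sg_apply hx u ω).symm

/-- The extended operator along the fundamental solution. -/
noncomputable def fundForce (h : Adm L m) (τ : ℝ) (p : E n) (u : ℝ) : E n :=
  extendOp (L u) (seg r (fund h τ p) u)

theorem fundForce_eq (h : Adm L m) (τ : ℝ) (p : E n) (u : ℝ) :
    fundForce h τ p u = L u (sg r (fundCont h τ p) u) + stepForce L τ p u := by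
  unfold fundForce
  rw [show seg r (fund h τ p) u = fun ω => seg r (step τ p) u ω + seg r (fundCont h τ p) u ω
    from rfl, (bddLimit_step h τ p u).extendOp_add (bddLimit_sg (continuous_fundCont h τ p) u),
    extendOp_seg (continuous_fundCont h τ p), add_comm, stepForce]

theorem fundCont_eq_integral (h : Adm L m) {τ t : ℝ} (ht : τ ≤ t) (p : E n) :
    fundCont h τ p t = ∫ u in τ..t, fundForce h τ p u := by
  simp_rw [fundForce_eq]
  exact fundCont_eqn h ht p

/-- The value of the extended `Λ` on a segment of the fundamental solution is a limit of values of `Λ` on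
`C`. -/
theorem tendsto_fundForce (h : Adm L m) (τ : ℝ) (p : E n) (u : ℝ) (Λ : C r n →L[ℝ] E n) :
    Tendsto (fun k => Λ (sg r (lsol h τ (bump r k p)) u)) atTop
      (𝓝 (extendOp Λ (seg r (fund h τ p) u))) := by
  refine extendOp_tendsto (M := 2 * ‖p‖ * Real.exp (2 * Lam m τ u)) Λ (fun k => ?_) fun ω => ?_
  · refine (norm_sg_lsol_le h τ _ u).trans ?_
    gcongr
    exact norm_bump_le k p
  · simp_rw [sg_apply (continuous_lsol h _ _)]
    exact tendsto_lsol_bump h τ p (u + ω)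

theorem norm_fundForce_le (h : Adm L m) (τ : ℝ) (p : E n) (u : ℝ) :
    ‖fundForce h τ p u‖ ≤ m u * (2 * ‖p‖ * Real.exp (2 * Lam m τ u)) := by
  refine le_of_tendsto (tendsto_fundForce h τ p u (L u)).norm (Eventually.of_forall fun k => ?_)
  refine (L u).le_of_opNorm_le_of_le (h.le u) ((norm_sg_lsol_le h τ _ u).trans ?_)
  gcongr
  exact norm_bump_le k p

theorem fundForce_of_lt (h : Adm L m) {τ u : ℝ} (hu : u < τ) (p : E n) :
    fundForce h τ p u = 0 := by
  unfold fundForce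
  have : seg r (fund h τ p) u = fun ω => (0 : C r n) ω := by
    funext ω
    exact fund_of_lt h (by linarith [ω.2.2]) p
  rw [this, extendOp_coe, map_zero]

/-- The sum of a homogeneous solution and of the fundamental solution solves the equation with the
extended operators, its history being `φ + X₀ p`. -/
theorem isSolution_add_fund (h : Adm L m) (τ : ℝ) (φ : C r n) (p : E n) :
    IsSolution (fun u χ => extendOp (L u) χ) τ (fun ω => φ ω + X0 p ω)
      (fun v => lsol h τ φ v + fund h τ p v) := by
  have hl := continuous_lsol h τ φ
  have hc := continuous_fundCont h τ p
  have hli := h.locallyIntegrable hl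
  have hF : fundForce h τ p = fun u => L u (sg r (fundCont h τ p) u) + stepForce L τ p u :=
    funext fun u => fundForce_eq h τ p u
  have hFi : LocallyIntegrable (fundForce h τ p) volume := by
    rw [hF]
    exact h.locallyIntegrable_forced (locallyIntegrable_stepForce h τ p) hc
  have hg : LocallyIntegrable (fun u => L u (sg r (lsol h τ φ) u) + fundForce h τ p u) volume :=
    hli.add hFi
  have heq : ∀ t, τ ≤ t → lsol h τ φ t + fund h τ p t = (φ (zeroI h.nn) + p) +
      ∫ u in τ..t, (L u (sg r (lsol h τ φ) u) + fundForce h τ p u) := fun t ht => by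
    rw [intervalIntegral.integral_add (locInt_interval hli _ _) (locInt_interval hFi _ _),
      lsol_eqn h ht, fund_of_le h ht, fundCont_eq_integral h ht]
    abel
  refine ⟨?_, fun b hb => ?_, ?_⟩
  · funext ω
    change lsol h τ φ (τ + ω) + fund h τ p (τ + ω) = _
    rw [lsol_past h (by linarith [ω.2.2]), add_sub_cancel_left, hist_coe]
    congr 1
    unfold X0
    split_ifs with hω
    · rw [hω, add_zero, fund_self]
    · exact fund_of_lt h (by linarith [lt_of_le_of_ne ω.2.2 hω]) p
  · exact absolutelyContinuousOnInterval_of_eq_integral hb hg fun t ht => heq t ht.1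
  · filter_upwards [LocallyIntegrable.ae_hasDerivAt_integral hg] with t ht hst
    have e : extendOp (L t) (seg r (fun v => lsol h τ φ v + fund h τ p v) t) =
        L t (sg r (lsol h τ φ) t) + fundForce h τ p t := by
      have hb : BddLimit (‖p‖ + ‖sg r (fundCont h τ p) t‖) (seg r (fund h τ p) t) :=
        (bddLimit_step h τ p t).add (bddLimit_sg hc t)
      rw [seg_add_eq, (bddLimit_sg hl t).extendOp_add hb, extendOp_seg hl, fundForce]
    change HasDerivAt _ (extendOp (L t) (seg r (fun v => lsol h τ φ v + fund h τ p v) t)) t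
    rw [e]
    refine ((ht τ).const_add (φ (zeroI h.nn) + p)).congr_of_eventuallyEq ?_
    filter_upwards [lt_mem_nhds hst] with v hv
    exact heq v hv.le

/-- `T₀(t, τ)` on `C + X₀ ℝⁿ`: the solution is the sum of the homogeneous one and of the
fundamental solution. -/
theorem T0_add_X0 (h : Adm L m) {τ t : ℝ} (ht : τ ≤ t) (φ : C r n) (p : E n) (ω : I r) :
    T0 L t τ (fun ω => φ ω + X0 p ω) ω = lsol h τ φ (t + ω) + fund h τ p (t + ω) := by
  have hx := isSolution_add_fund h τ φ p
  have hy : IsSolution (fun u χ => extendOp (L u) χ) τ (fun ω => φ ω + X0 p ω)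
    (solution (fun u χ => extendOp (L u) χ) τ (fun ω => φ ω + X0 p ω)) :=
    Classical.epsilon_spec ⟨_, hx⟩
  set y := solution (fun u χ => extendOp (L u) χ) τ (fun ω => φ ω + X0 p ω) with hydef
  set x : ℝ → E n := fun v => lsol h τ φ v + fund h τ p v with hxdef
  have hd : ContinuousOn (fun v => y v - x v) (Ici (τ - r)) := by
    refine continuousOn_of_history h.nn (φ := 0) ?_ fun b hb => (hy.2.1 b hb).sub (hx.2.1 b hb)
    funext ω
    exact sub_eq_zero.2 ((congrFun hy.1 ω).trans (congrFun hx.1 ω).symm)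
  refine isSolution_unique h.nn h.int h.nonneg hy hx (fun u hu M hM hv => ?_) (t + ω)
    (by linarith [ω.2.1])
  have hdc : Continuous (seg r (fun v => y v - x v) u) := continuous_seg_of_continuousOn hd hu.le
  have hb : BddLimit (r := r) (‖sg r (lsol h τ φ) u‖ + (‖p‖ + ‖sg r (fundCont h τ p) u‖))
      (seg r x u) := (bddLimit_sg (continuous_lsol h τ φ) u).add
        ((bddLimit_step h τ p u).add (bddLimit_sg (continuous_fundCont h τ p) u))
  have e1 : (fun ω => toC (seg r (fun v => y v - x v) u) ω) = seg r (fun v => y v - x v) u :=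
    funext fun ω => toC_apply hdc ω
  have e2 : seg r y u = fun ω => toC (seg r (fun v => y v - x v) u) ω + seg r x u ω := by
    funext ω
    rw [toC_apply hdc]
    exact (sub_add_cancel _ _).symm
  change ‖extendOp (L u) (seg r y u) - extendOp (L u) (seg r x u)‖ ≤ m u * M
  rw [e2, (bddLimit_coe _).extendOp_add hb, add_sub_cancel_right, extendOp_coe]
  refine (L u).le_of_opNorm_le_of_le (h.le u) (C_norm_le hM fun ω => ?_)
  rw [toC_apply hdc]
  exact hv _ ⟨by linarith [ω.2.1], by linarith [ω.2.2]⟩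

theorem T0_X0 (h : Adm L m) {τ t : ℝ} (ht : τ ≤ t) (p : E n) (ω : I r) :
    T0 L t τ (X0 p) ω = fund h τ p (t + ω) := by
  have h1 := T0_add_X0 h ht 0 p ω
  have h2 : lsol h τ 0 (t + ω) = 0 := by
    have := lsol_smul h τ 0 0 (t + ω)
    rwa [zero_smul, zero_smul] at this
  rw [h2, zero_add] at h1
  rw [← h1]
  congr 1
  funext ω
  exact (zero_add _).symm

theorem toC_T0_X0 (h : Adm L m) (τ : ℝ) (p : E n) :
    toC (T0 L (τ + r) τ (X0 p)) = fundSeg h τ p := by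
  unfold fundSeg sg
  congr 1
  funext ω
  exact T0_X0 h (by linarith [h.pos]) p ω

theorem memC0_add_X0 (hr : 0 < r) (φ : C r n) (p : E n) : MemC0 (fun ω => φ ω + X0 p ω) := by
  have hX : ∀ ω : I r, (ω : ℝ) < 0 → φ ω + X0 p ω = φ ω := fun ω hω => by
    unfold X0
    rw [if_neg hω.ne, add_zero]
  refine ⟨(map_continuous φ).continuousOn.congr fun ω hω => hX ω hω, φ (zeroI hr.le), ?_⟩
  have h1 : comap (fun ω : I r => (ω : ℝ)) (𝓝[<] 0) ≤ 𝓝 (zeroI hr.le) := by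
    rw [nhds_subtype_eq_comap]
    exact comap_mono nhdsWithin_le_nhds
  refine (((map_continuous φ).tendsto _).mono_left h1).congr' ?_
  have : ∀ᶠ ω : I r in comap (fun ω : I r => (ω : ℝ)) (𝓝[<] 0), (ω : ℝ) < 0 :=
    (eventually_mem_nhdsWithin (a := (0 : ℝ)) (s := Iio 0)).comap _
  filter_upwards [this] with ω hω
  exact (hX ω hω).symm

end Tzero

/-! ### Variation of constants -/

section VoC

variable {r : ℝ} {n : ℕ} {L : ℝ → C r n →L[ℝ] E n} {m : ℝ → ℝ}

/-- Evaluation at `ω` as a bounded operator on `C`. -/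
noncomputable def evalL (ω : I r) : C r n →L[ℝ] E n :=
  LinearMap.mkContinuous
    { toFun := fun φ => φ ω
      map_add' := fun _ _ => rfl
      map_smul' := fun _ _ => rfl } 1 fun φ => by
    rw [one_mul]; exact norm_apply_le φ ω

theorem evalL_apply (ω : I r) (φ : C r n) : evalL ω φ = φ ω := rfl

theorem bump_sum (k : ℕ) (p : E n) : bump r k p = ∑ j, p j • bump r k (unitVec j) := by
  let Φ : E n →ₗ[ℝ] C r n :=
    { toFun := bump r k
      map_add' := bump_add k
      map_smul' := bump_smul k }
  change Φ p = ∑ j, p j • Φ (unitVec j)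
  conv_lhs => rw [← sum_smul_unitVec p, map_sum]
  simp_rw [map_smul]

theorem sg_lsol_sum (h : Adm L m) (k : ℕ) (τ : ℝ) (p : E n) (u : ℝ) :
    sg r (lsol h τ (bump r k p)) u = ∑ j, p j • sg r (lsol h τ (bump r k (unitVec j))) u := by
  let Φ : C r n →ₗ[ℝ] C r n :=
    { toFun := fun φ => sg r (lsol h τ φ) u
      map_add' := fun φ ψ => DFunLike.ext _ _ fun ω => by
        change sg r _ u ω = sg r _ u ω + sg r _ u ω
        simp_rw [sg_apply (continuous_lsol h _ _), lsol_add]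
      map_smul' := fun c φ => DFunLike.ext _ _ fun ω => by
        change sg r _ u ω = c • sg r _ u ω
        simp_rw [sg_apply (continuous_lsol h _ _), lsol_smul] }
  change Φ (bump r k p) = ∑ j, p j • Φ (bump r k (unitVec j))
  rw [bump_sum, map_sum]
  simp_rw [map_smul]

theorem aestronglyMeasurable_coord {α : Type*} [MeasurableSpace α] {μ : Measure α} {f : α → E n}
    (hf : AEStronglyMeasurable f μ) (j : Fin n) : AEStronglyMeasurable (fun a => f a j) μ :=
  (EuclideanSpace.proj (𝕜 := ℝ) j).continuous.comp_aestronglyMeasurable hf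

theorem aestronglyMeasurable_sg_lsol (h : Adm L m) (k : ℕ) {f : ℝ → E n}
    (hf : AEStronglyMeasurable f volume) (u : ℝ) :
    AEStronglyMeasurable (fun τ => sg r (lsol h τ (bump r k (f τ))) u) volume := by
  rw [funext fun τ => sg_lsol_sum h k τ (f τ) u]
  refine Finset.aestronglyMeasurable_fun_sum _ fun j _ => (aestronglyMeasurable_coord hf j).smul ?_
  exact ((continuous_sg_lsol h (bump r k (unitVec j))).comp (f := fun τ : ℝ => (u, τ))
    (by fun_prop)).aestronglyMeasurable

theorem fundForce_sum (h : Adm L m) (τ : ℝ) (p : E n) (u : ℝ) :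
    fundForce h τ p u = ∑ j, p j • fundForce h τ (unitVec j) u := by
  refine tendsto_nhds_unique (tendsto_fundForce h τ p u (L u)) ?_
  simp_rw [sg_lsol_sum h _ τ p, map_sum, map_smul]
  exact tendsto_finsetSum _ fun j _ => (tendsto_fundForce h τ (unitVec j) u (L u)).const_smul _

theorem aestronglyMeasurable_fundForce (h : Adm L m) {f : ℝ → E n}
    (hf : AEStronglyMeasurable f volume) :
    AEStronglyMeasurable (fun q : ℝ × ℝ => fundForce h q.1 (f q.1) q.2)
      (volume.prod volume) := by
  simp_rw [fundForce_sum h _ (f _)]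
  refine Finset.aestronglyMeasurable_fun_sum _ fun j _ =>
    ((aestronglyMeasurable_coord hf j).comp_fst).smul ?_
  obtain ⟨L', hL', hae⟩ := exists_measurable_version h.meas
  have h1 : StronglyMeasurable (fun q : ℝ × ℝ =>
      extendOp (L' q.2) (seg r (fund h q.1 (unitVec j)) q.2)) := by
    refine stronglyMeasurable_of_tendsto atTop (f := fun k (q : ℝ × ℝ) =>
      L' q.2 (sg r (lsol h q.1 (bump r k (unitVec j))) q.2)) (fun k => ?_)
      (tendsto_pi_nhds.2 fun q => tendsto_fundForce h q.1 _ q.2 _)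
    exact stronglyMeasurable_clm_apply hL' measurable_snd
      ((continuous_sg_lsol h (bump r k (unitVec j))).comp continuous_swap).stronglyMeasurable
  refine h1.aestronglyMeasurable.congr ?_
  have h2 : ∀ᵐ q : ℝ × ℝ ∂(volume.prod volume), L q.2 = L' q.2 :=
    Measure.quasiMeasurePreserving_snd.ae hae
  filter_upwards [h2] with q hq
  rw [fundForce, hq]

theorem aestronglyMeasurable_fund (h : Adm L m) {f : ℝ → E n}
    (hf : AEStronglyMeasurable f volume) (t : ℝ) :
    AEStronglyMeasurable (fun τ => fund h τ (f τ) t) volume := by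
  simp_rw [fund_sum h _ (f _)]
  refine Finset.aestronglyMeasurable_fun_sum _ fun j _ => (aestronglyMeasurable_coord hf j).smul ?_
  exact ((stronglyMeasurable_fund h (unitVec j)).comp_measurable
    (g := fun τ : ℝ => (t, τ)) (by fun_prop)).aestronglyMeasurable

/-- The solution of the forced equation with zero history at time `s`, given by the variation of
constants formula. -/
noncomputable def voc (h : Adm L m) (f : ℝ → E n) (s t : ℝ) : E n :=
  ∫ τ in Ioc s t, fund h τ (f τ) t

theorem voc_of_le (h : Adm L m) (f : ℝ → E n) {s t : ℝ} (ht : t ≤ s) : voc h f s t = 0 := by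
  rw [voc, Ioc_eq_empty (by linarith), Measure.restrict_empty, integral_zero_measure]

theorem integrableOn_Ioc {F : Type*} [NormedAddCommGroup F] {f : ℝ → F}
    (hf : LocallyIntegrable f volume) (s t : ℝ) : IntegrableOn f (Ioc s t) volume :=
  (hf.integrableOn_isCompact isCompact_Icc).mono_set Ioc_subset_Icc_self

theorem integrableOn_fund (h : Adm L m) {f : ℝ → E n} (hf : LocallyIntegrable f volume)
    (s b t : ℝ) : IntegrableOn (fun τ => fund h τ (f τ) t) (Ioc s b) volume := by
  refine (((integrableOn_Ioc hf s b).norm.const_mul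
    (2 * Real.exp (2 * Lam m s t)))).mono'
    (aestronglyMeasurable_fund h hf.aestronglyMeasurable t).restrict ?_
  filter_upwards [ae_restrict_mem measurableSet_Ioc] with τ hτ
  refine (norm_fund_le h τ (f τ) t).trans ?_
  have : Real.exp (2 * Lam m τ t) ≤ Real.exp (2 * Lam m s t) := by
    gcongr; exact Lam_anti h hτ.1.le t
  calc _ ≤ 2 * ‖f τ‖ * Real.exp (2 * Lam m s t) := by gcongr
    _ = _ := by ring

theorem voc_eq (h : Adm L m) (f : ℝ → E n) {s t b : ℝ} (ht : t ≤ b) :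
    voc h f s t = ∫ τ in Ioc s b, fund h τ (f τ) t := by
  rw [voc]
  refine (setIntegral_eq_of_subset_of_forall_sdiff_eq_zero measurableSet_Ioc
    (Ioc_subset_Ioc_right ht) fun τ hτ => fund_of_lt h ?_ _).symm
  by_contra hcon
  exact hτ.2 ⟨hτ.1.1, not_lt.1 hcon⟩

/-- The forcing term `L(u) v_u` of `v = voc`, see `vocForce_eq`. -/
noncomputable def vocForce (h : Adm L m) (f : ℝ → E n) (s u : ℝ) : E n :=
  ∫ τ in Ioc s u, fundForce h τ (f τ) u

theorem integrable_prod_fundForce (h : Adm L m) {f : ℝ → E n} (hf : LocallyIntegrable f volume)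
    (s t : ℝ) : Integrable (fun q : ℝ × ℝ => fundForce h q.1 (f q.1) q.2)
      ((volume.restrict (Ioc s t)).prod (volume.restrict (Ioc s t))) := by
  have h1 : Integrable (fun q : ℝ × ℝ => (2 * Real.exp (2 * Lam m s t)) * (‖f q.1‖ * m q.2))
      ((volume.restrict (Ioc s t)).prod (volume.restrict (Ioc s t))) :=
    ((integrableOn_Ioc hf s t).norm.mul_prod (integrableOn_Ioc h.int s t)).const_mul _
  refine h1.mono' ?_ ?_
  · rw [Measure.prod_restrict]
    exact (aestronglyMeasurable_fundForce h hf.aestronglyMeasurable).restrict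
  · rw [Measure.prod_restrict]
    filter_upwards [ae_restrict_mem (measurableSet_Ioc.prod measurableSet_Ioc)] with q hq
    refine (norm_fundForce_le h _ _ _).trans ?_
    have e1 : Real.exp (2 * Lam m q.1 q.2) ≤ Real.exp (2 * Lam m s t) := by
      gcongr
      exact (Lam_anti h hq.1.1.le q.2).trans (Lam_mono h.int h.nonneg s hq.2.2)
    have := h.nonneg q.2
    calc _ ≤ m q.2 * (2 * ‖f q.1‖ * Real.exp (2 * Lam m s t)) := by gcongr
      _ = _ := by ring

theorem vocForce_eq_integral (h : Adm L m) (f : ℝ → E n) {s u b : ℝ} (hu : u ≤ b) :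
    ∫ τ in Ioc s b, fundForce h τ (f τ) u = vocForce h f s u := by
  refine setIntegral_eq_of_subset_of_forall_sdiff_eq_zero measurableSet_Ioc
    (Ioc_subset_Ioc_right hu) fun τ hτ => fundForce_of_lt h ?_ _
  by_contra hcon
  exact hτ.2 ⟨hτ.1.1, not_lt.1 hcon⟩

theorem integrableOn_vocForce (h : Adm L m) {f : ℝ → E n} (hf : LocallyIntegrable f volume)
    (s t : ℝ) : IntegrableOn (vocForce h f s) (Ioc s t) volume := by
  refine (integrable_prod_fundForce h hf s t).integral_prod_right.congr ?_
  filter_upwards [ae_restrict_mem measurableSet_Ioc] with u hu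
  exact vocForce_eq_integral h f hu.2

/-- The integral equation of each fundamental solution, integrated over the starting time `τ`; Fubini
exchanges the two integrals. -/
theorem voc_eq_integral (h : Adm L m) {f : ℝ → E n} (hf : LocallyIntegrable f volume)
    (s t : ℝ) : voc h f s t = ∫ u in Ioc s t, (vocForce h f s u + f u) := by
  have hi := integrable_prod_fundForce h hf s t
  have h1 : ∀ τ ∈ Ioc s t, fund h τ (f τ) t =
      (∫ u in Ioc s t, fundForce h τ (f τ) u) + f τ := fun τ hτ => by
    rw [fund_of_le h hτ.2, fundCont_eq_integral h hτ.2, intervalIntegral.integral_of_le hτ.2,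
      add_comm, ← integral_Icc_eq_integral_Ioc]
    congr 1
    refine (setIntegral_eq_of_subset_of_forall_sdiff_eq_zero measurableSet_Ioc
      (fun v hv => ⟨hτ.1.trans_le hv.1, hv.2⟩) fun v hv => fundForce_of_lt h ?_ _).symm
    by_contra hcon
    exact hv.2 ⟨not_lt.1 hcon, hv.1.2⟩
  rw [voc, setIntegral_congr_fun measurableSet_Ioc h1,
    integral_add hi.integral_prod_left (integrableOn_Ioc hf s t),
    integral_add (integrableOn_vocForce h hf s t) (integrableOn_Ioc hf s t)]
  congr 1
  rw [integral_integral_swap hi]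
  exact setIntegral_congr_fun measurableSet_Ioc fun u hu => vocForce_eq_integral h f hu.2

theorem continuous_voc (h : Adm L m) {f : ℝ → E n} (hf : LocallyIntegrable f volume) (s : ℝ) :
    Continuous (voc h f s) := by
  set G : ℝ → E n := (Ioi s).indicator fun u => vocForce h f s u + f u with hG
  have hGi : ∀ a b, IntervalIntegrable G volume a b := fun a b => by
    rw [intervalIntegrable_iff]
    have : Integrable G (volume.restrict (Iic (max a b))) := by
      change IntegrableOn _ _ _
      rw [hG, IntegrableOn, integrable_indicator_iff measurableSet_Ioi, IntegrableOn,
        Measure.restrict_restrict measurableSet_Ioi, Ioi_inter_Iic]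
      exact (integrableOn_vocForce h hf s _).add (integrableOn_Ioc hf s _)
    exact this.mono_measure (Measure.restrict_mono (fun v hv => hv.2) le_rfl)
  have : voc h f s = fun t => ∫ u in s..t, G u := by
    funext t
    rcases le_total s t with ht | ht
    · rw [voc_eq_integral h hf s t, intervalIntegral.integral_of_le ht]
      exact setIntegral_congr_fun measurableSet_Ioc fun u hu =>
        (indicator_of_mem (show u ∈ Ioi s from hu.1)
          (fun u => vocForce h f s u + f u)).symm
    · rw [voc_of_le h f ht, intervalIntegral.integral_of_ge ht,
        setIntegral_eq_zero_of_forall_eq_zero, neg_zero]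
      exact fun u hu => indicator_of_notMem (by simpa using hu.2) _
  rw [this]
  exact intervalIntegral.continuous_primitive hGi s

/-- `L(u)` commutes with the integral that defines `voc`. Segments of fundamental solutions may jump, so
their integral is not a Bochner integral in `C`; the identity holds for the continuous approximations
`bump` and passes to the limit. -/
theorem vocForce_eq (h : Adm L m) {f : ℝ → E n} (hf : LocallyIntegrable f volume) (s u : ℝ) :
    vocForce h f s u = L u (sg r (voc h f s) u) := by
  set B := 2 * Real.exp (2 * Lam m s u) with hB
  have hint : IntegrableOn (fun τ => B * ‖f τ‖) (Ioc s u) volume :=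
    (integrableOn_Ioc hf s u).norm.const_mul _
  have hmeas := fun k => (aestronglyMeasurable_sg_lsol h k hf.aestronglyMeasurable u).restrict
    (s := Ioc s u)
  have hbound : ∀ k, ∀ᵐ τ ∂volume.restrict (Ioc s u),
      ‖sg r (lsol h τ (bump r k (f τ))) u‖ ≤ B * ‖f τ‖ := fun k => by
    filter_upwards [ae_restrict_mem measurableSet_Ioc] with τ hτ
    refine (norm_sg_lsol_le h τ _ u).trans ?_
    have e1 : Real.exp (2 * Lam m τ u) ≤ Real.exp (2 * Lam m s u) := by
      gcongr; exact Lam_anti h hτ.1.le u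
    have e2 := norm_bump_le (r := r) k (f τ)
    calc _ ≤ 2 * ‖f τ‖ * Real.exp (2 * Lam m s u) := by gcongr
      _ = _ := by rw [hB]; ring
  have hVi : ∀ k, Integrable (fun τ => sg r (lsol h τ (bump r k (f τ))) u)
      (volume.restrict (Ioc s u)) := fun k => Integrable.mono' hint (hmeas k) (hbound k)
  set V : ℕ → C r n := fun k => ∫ τ in Ioc s u, sg r (lsol h τ (bump r k (f τ))) u with hV
  have hVb : ∀ k, ‖V k‖ ≤ ∫ τ in Ioc s u, B * ‖f τ‖ := fun k =>
    norm_integral_le_of_norm_le hint (hbound k)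
  have hVω : ∀ ω, Tendsto (fun k => V k ω) atTop (𝓝 (seg r (voc h f s) u ω)) := fun ω => by
    have e : ∀ k, V k ω = ∫ τ in Ioc s u, lsol h τ (bump r k (f τ)) (u + ω) := fun k => by
      rw [← evalL_apply, hV, ← ContinuousLinearMap.integral_comp_comm _ (hVi k)]
      exact integral_congr_ae (Eventually.of_forall fun τ => sg_apply (continuous_lsol h _ _) u ω)
    simp_rw [e]
    rw [seg, voc_eq h f (show u + (ω : ℝ) ≤ u by linarith [ω.2.2])]
    refine tendsto_integral_of_dominated_convergence (fun τ => B * ‖f τ‖) (fun k => ?_) hint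
      (fun k => ?_) (Eventually.of_forall fun τ => tendsto_lsol_bump h τ (f τ) _)
    · refine ((evalL ω).continuous.comp_aestronglyMeasurable (hmeas k)).congr
        (Eventually.of_forall fun τ => sg_apply (continuous_lsol h _ _) u ω)
    · filter_upwards [hbound k] with τ hτ
      rw [← sg_apply (continuous_lsol h _ _) u ω]
      exact (norm_apply_le _ _).trans hτ
  -- both sides are limits of `L(u) (V k)`
  have h1 := extendOp_tendsto (L u) hVb hVω
  rw [extendOp_seg (continuous_voc h hf s)] at h1
  refine tendsto_nhds_unique ?_ h1
  have e : ∀ k, L u (V k) = ∫ τ in Ioc s u, L u (sg r (lsol h τ (bump r k (f τ))) u) := fun k =>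
    (ContinuousLinearMap.integral_comp_comm _ (hVi k)).symm
  simp_rw [e]
  refine tendsto_integral_of_dominated_convergence (fun τ => m u * (B * ‖f τ‖))
    (fun k => (L u).continuous.comp_aestronglyMeasurable (hmeas k)) (hint.const_mul _)
    (fun k => ?_) (Eventually.of_forall fun τ => tendsto_fundForce h τ (f τ) u (L u))
  filter_upwards [hbound k] with τ hτ
  exact (L u).le_of_opNorm_le_of_le (h.le u) hτ

/-- Variation of constants: `voc` solves the forced equation. -/
theorem linSol_voc (h : Adm L m) {f : ℝ → E n} (hf : LocallyIntegrable f volume) (s : ℝ) :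
    LinSol L f s (voc h f s) := by
  refine ⟨continuous_voc h hf s, fun t ht => ?_⟩
  rw [voc_of_le h f le_rfl, zero_add, voc_eq_integral h hf s t,
    intervalIntegral.integral_of_le ht]
  simp_rw [vocForce_eq h hf]

end VoC

/-! ### Growth rates in exponential form -/

section Growth

/-- The logarithm `ℓ` of the growth rate. -/
noncomputable def ell (μ : ℝ → ℝ) (t : ℝ) : ℝ := Real.log (μ t)

variable {μ : ℝ → ℝ} (hμ : IsDiffGrowthRate μ)
include hμ

theorem ell_mono {s t : ℝ} (h : s ≤ t) : ell μ s ≤ ell μ t :=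
  Real.log_le_log (hμ.pos s) (hμ.strictMono.monotone h)

theorem ell_zero : ell μ 0 = 0 := by rw [ell, hμ.map_zero, Real.log_one]

theorem continuous_ell : Continuous (ell μ) :=
  hμ.differentiable.continuous.log fun t => (hμ.pos t).ne'

theorem hasDerivAt_ell (t : ℝ) : HasDerivAt (ell μ) (deriv μ t / μ t) t :=
  (hμ.differentiable t).hasDerivAt.log (hμ.pos t).ne'

theorem deriv_ell (t : ℝ) : deriv (ell μ) t = deriv μ t / μ t := (hasDerivAt_ell hμ t).deriv

theorem hasDerivAt_ell' (t : ℝ) : HasDerivAt (ell μ) (deriv (ell μ) t) t := by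
  rw [deriv_ell hμ]
  exact hasDerivAt_ell hμ t

theorem deriv_ell_nonneg (t : ℝ) : 0 ≤ deriv (ell μ) t :=
  (show Monotone (ell μ) from fun _ _ => ell_mono hμ).deriv_nonneg

theorem tendsto_ell_atTop : Tendsto (ell μ) atTop atTop :=
  Real.tendsto_log_atTop.comp hμ.tendsto_atTop

theorem tendsto_ell_atBot : Tendsto (ell μ) atBot atBot :=
  Real.tendsto_log_nhdsGT_zero.comp
    (tendsto_nhdsWithin_iff.2 ⟨hμ.tendsto_atBot, Eventually.of_forall hμ.pos⟩)

theorem sign_mul_ell (t : ℝ) : Real.sign t * ell μ t = |ell μ t| := by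
  rcases lt_trichotomy t 0 with h | h | h
  · have := ell_mono hμ h.le
    rw [ell_zero hμ] at this
    rw [Real.sign_of_neg h, abs_of_nonpos this, neg_one_mul]
  · rw [h, ell_zero hμ, abs_zero, mul_zero]
  · have := ell_mono hμ h.le
    rw [ell_zero hμ] at this
    rw [Real.sign_of_pos h, abs_of_nonneg this, one_mul]

theorem rpow_sign_mul (c t : ℝ) : μ t ^ (Real.sign t * c) = Real.exp (c * |ell μ t|) := by
  rw [Real.rpow_def_of_pos (hμ.pos t), ← sign_mul_ell hμ]
  congr 1
  unfold ell
  ring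

theorem wt_eq_exp (c t : ℝ) : wt μ c t = Real.exp (c * |ell μ t|) := rpow_sign_mul hμ c t

theorem ratio_rpow (t s p : ℝ) : (μ t / μ s) ^ p = Real.exp (p * (ell μ t - ell μ s)) := by
  rw [Real.rpow_def_of_pos (div_pos (hμ.pos t) (hμ.pos s)),
    Real.log_div (hμ.pos t).ne' (hμ.pos s).ne', mul_comm]
  rfl

theorem normMu_eq_exp {V : Type*} [NormedAddCommGroup V] (ξ ε t : ℝ) (x : V) :
    normMu μ ξ ε t x = ‖x‖ * Real.exp (-((ξ + ε) * |ell μ t|)) := by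
  rw [normMu, neg_mul, ← mul_neg, rpow_sign_mul hμ, neg_mul]

theorem deriv_mul_rpow (c t : ℝ) :
    deriv μ t * μ t ^ (Real.sign t * c - 1) = deriv (ell μ) t * Real.exp (c * |ell μ t|) := by
  rw [Real.rpow_sub_one (hμ.pos t).ne', rpow_sign_mul hμ, deriv_ell hμ]
  ring

end Growth

/-! ### Exponential dichotomies -/

section Dichotomy

theorem continuous_uncurry_of_lipschitz {X V W : Type*} [TopologicalSpace X]
    [NormedAddCommGroup V] [NormedAddCommGroup W] {A : X → V → W} {c : X → ℝ} (hc : Continuous c)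
    (hlip : ∀ x v w, ‖A x v - A x w‖ ≤ c x * ‖v - w‖) (hA : ∀ v, Continuous fun x => A x v) :
    Continuous (fun q : X × V => A q.1 q.2) := by
  rw [continuous_iff_continuousAt]
  rintro ⟨x₀, v₀⟩
  rw [ContinuousAt, tendsto_iff_norm_sub_tendsto_zero]
  have h1 : Tendsto (fun q : X × V => c q.1 * ‖q.2 - v₀‖ + ‖A q.1 v₀ - A x₀ v₀‖) (𝓝 (x₀, v₀))
      (𝓝 (c x₀ * ‖v₀ - v₀‖ + ‖A x₀ v₀ - A x₀ v₀‖)) := by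
    have := hA v₀
    refine Continuous.tendsto (f := fun q : X × V => c q.1 * ‖q.2 - v₀‖ + ‖A q.1 v₀ - A x₀ v₀‖)
      ?_ (x₀, v₀)
    fun_prop
  simp only [sub_self, norm_zero, mul_zero, add_zero] at h1
  refine squeeze_zero (fun _ => norm_nonneg _) (fun q => ?_) h1
  calc _ = ‖(A q.1 q.2 - A q.1 v₀) + (A q.1 v₀ - A x₀ v₀)‖ := by rw [sub_add_sub_cancel]
    _ ≤ _ := (norm_add_le _ _).trans (by gcongr; exact hlip _ _ _)

variable {r : ℝ} {n : ℕ} {L : ℝ → C r n →L[ℝ] E n} {m μ : ℝ → ℝ} {K α β θ ν : ℝ}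
  {P : ℝ → C r n →L[ℝ] C r n}

theorem Q_apply (P : ℝ → C r n →L[ℝ] C r n) (t : ℝ) (φ : C r n) : Q P t φ = φ - P t φ := rfl

theorem Q_mem_U (P : ℝ → C r n →L[ℝ] C r n) (t : ℝ) (φ : C r n) : Q P t φ ∈ U P t :=
  (toU P t φ).2

/-- The extension `T̄(t, s) Q(s)` of `T̄(t, s)` to `C`. -/
noncomputable def W (L : ℝ → C r n →L[ℝ] E n) (P : ℝ → C r n →L[ℝ] C r n) (t s : ℝ) (φ : C r n) :
    C r n := (Tbar L P t s (toU P s φ) : C r n)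

theorem W_mem (L : ℝ → C r n →L[ℝ] E n) (P : ℝ → C r n →L[ℝ] C r n) (t s : ℝ) (φ : C r n) :
    W L P t s φ ∈ U P t := (Tbar L P t s (toU P s φ)).2

variable (h : Adm L m) (hd : HasMuDichotomy L μ K α β θ ν P)

section

include hd

theorem P_of_mem_U {t : ℝ} {φ : C r n} (hφ : φ ∈ U P t) : P t φ = 0 := by
  obtain ⟨ψ, rfl⟩ := LinearMap.mem_range.1 hφ
  change P t (ψ - P t ψ) = 0
  rw [map_sub, hd.proj, sub_self]

theorem Q_of_mem_U {t : ℝ} {φ : C r n} (hφ : φ ∈ U P t) : Q P t φ = φ := by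
  rw [Q_apply, P_of_mem_U hd hφ, sub_zero]

theorem toU_coe {t : ℝ} (b : U P t) : toU P t b = b :=
  Subtype.ext (Q_of_mem_U hd b.2)

theorem W_coe {t s : ℝ} (b : U P s) : W L P t s b = Tbar L P t s b := by
  rw [W, toU_coe hd]

theorem Q_Q (t : ℝ) (φ : C r n) : Q P t (Q P t φ) = Q P t φ := Q_of_mem_U hd (Q_mem_U P t φ)

theorem W_Q (t s : ℝ) (φ : C r n) : W L P t s (Q P s φ) = W L P t s φ := by
  unfold W
  congr 2
  exact Subtype.ext (Q_Q hd s φ)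

theorem Tbar_spec (t s : ℝ) (b : U P s) :
    if s ≤ t then (Tbar L P t s b : C r n) = T L t s b else T L s t (Tbar L P t s b) = (b : C r n) :=
  by
  have hex : ∃ c : U P t, if s ≤ t then (c : C r n) = T L t s b else T L s t c = (b : C r n) := by
    split_ifs with hst
    · exact ⟨⟨_, (hd.iso s t hst).mapsTo b.2⟩, rfl⟩
    · obtain ⟨c, hc, hcb⟩ := (hd.iso t s (not_le.1 hst).le).surjOn b.2
      exact ⟨⟨c, hc⟩, hcb⟩
  exact Classical.epsilon_spec hex

theorem Tbar_of_le {t s : ℝ} (hst : s ≤ t) (b : U P s) :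
    (Tbar L P t s b : C r n) = T L t s b := by
  have := Tbar_spec hd t s b
  rwa [if_pos hst] at this

include h

theorem T_Tbar {t s w : ℝ} (hs : s ≤ w) (ht : t ≤ w) (b : U P s) :
    T L w t (Tbar L P t s b) = T L w s b := by
  rcases le_or_gt s t with hst | hst
  · rw [Tbar_of_le hd hst, T_T h hst ht]
  · have := Tbar_spec hd t s b
    rw [if_neg (not_le.2 hst)] at this
    rw [← T_T h hst.le hs, this]

theorem T_W {t s w : ℝ} (hs : s ≤ w) (ht : t ≤ w) (φ : C r n) :
    T L w t (W L P t s φ) = T L w s (Q P s φ) := T_Tbar h hd hs ht _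

omit h in
theorem T_injOn {t w : ℝ} (ht : t ≤ w) {φ ψ : C r n} (hφ : φ ∈ U P t) (hψ : ψ ∈ U P t)
    (he : T L w t φ = T L w t ψ) : φ = ψ := (hd.iso t w ht).injOn hφ hψ he

omit h in
theorem W_of_le {t s : ℝ} (hst : s ≤ t) (φ : C r n) : W L P t s φ = T L t s (Q P s φ) :=
  Tbar_of_le hd hst _

theorem W_W (u t s : ℝ) (φ : C r n) : W L P u t (W L P t s φ) = W L P u s φ := by
  refine T_injOn hd (w := max u (max t s)) (le_max_left _ _) (W_mem ..) (W_mem ..) ?_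
  have hu := le_max_left u (max t s)
  have ht := (le_max_left t s).trans (le_max_right u (max t s))
  have hs := (le_max_right t s).trans (le_max_right u (max t s))
  rw [T_W h hd ht hu, T_W h hd hs hu, Q_of_mem_U hd (W_mem ..), T_W h hd hs ht]

theorem T_W_eq {u t : ℝ} (htu : t ≤ u) (s : ℝ) (φ : C r n) :
    T L u t (W L P t s φ) = W L P u s φ := by
  rw [← W_W h hd u t s, W_of_le hd htu, Q_of_mem_U hd (W_mem ..)]

theorem W_self (t : ℝ) (φ : C r n) : W L P t t φ = Q P t φ := by
  rw [W_of_le hd le_rfl, T_self h]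

theorem W_T {s t u : ℝ} (hst : s ≤ t) (φ : C r n) :
    W L P u t (T L t s φ) = W L P u s φ := by
  have e : Q P t (T L t s φ) = T L t s (Q P s φ) := by
    rw [Q_apply, Q_apply, T_sub h hst, hd.comm s t hst]
  rw [← W_Q hd, e, ← W_of_le hd hst, W_W h hd]

theorem W_add (t s : ℝ) (φ ψ : C r n) : W L P t s (φ + ψ) = W L P t s φ + W L P t s ψ := by
  refine T_injOn hd (w := max t s) (le_max_left _ _) (W_mem ..)
    (add_mem (W_mem ..) (W_mem ..)) ?_
  have ht := le_max_left t s
  have hs := le_max_right t s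
  rw [T_add h ht, T_W h hd hs ht, T_W h hd hs ht, T_W h hd hs ht, map_add, T_add h hs]

theorem W_smul (t s : ℝ) (c : ℝ) (φ : C r n) : W L P t s (c • φ) = c • W L P t s φ := by
  refine T_injOn hd (w := max t s) (le_max_left _ _) (W_mem ..)
    (Submodule.smul_mem _ _ (W_mem ..)) ?_
  have ht := le_max_left t s
  have hs := le_max_right t s
  rw [T_smul h ht, T_W h hd hs ht, T_W h hd hs ht, map_smul, T_smul h hs]

theorem W_sub (t s : ℝ) (φ ψ : C r n) : W L P t s (φ - ψ) = W L P t s φ - W L P t s ψ := by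
  have := W_add h hd t s φ ((-1 : ℝ) • ψ)
  rw [W_smul h hd, neg_one_smul, neg_one_smul] at this
  rw [sub_eq_add_neg, this, sub_eq_add_neg]

end

variable (hμ : IsDiffGrowthRate μ)
include hd hμ

theorem norm_T_P_le {s t : ℝ} (hst : s ≤ t) (φ : C r n) : ‖T L t s (P s φ)‖ ≤
    K * Real.exp (-α * (ell μ t - ell μ s) + θ * |ell μ s|) * ‖φ‖ := by
  have := hd.stable s t hst φ
  rwa [ratio_rpow hμ, wt_eq_exp hμ, mul_assoc K, ← Real.exp_add] at this

theorem norm_W_le {s t : ℝ} (hst : t ≤ s) (φ : C r n) : ‖W L P t s φ‖ ≤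
    K * Real.exp (-β * (ell μ s - ell μ t) + ν * |ell μ s|) * ‖φ‖ := by
  have := hd.unstable s t hst φ
  rw [ratio_rpow hμ, wt_eq_exp hμ, mul_assoc K, ← Real.exp_add] at this
  rwa [show -β * (ell μ s - ell μ t) = β * (ell μ t - ell μ s) by ring]

include h

theorem norm_P_le (t : ℝ) (φ : C r n) : ‖P t φ‖ ≤ K * Real.exp (θ * |ell μ t|) * ‖φ‖ := by
  have := norm_T_P_le hd hμ (le_refl t) φ
  rwa [T_self h, sub_self, mul_zero, zero_add] at this

theorem continuous_P_uncurry : Continuous (fun q : ℝ × C r n => P q.1 q.2) := by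
  have := continuous_ell hμ
  refine continuous_uncurry_of_lipschitz (A := fun t φ => P t φ)
    (c := fun t => K * Real.exp (θ * |ell μ t|)) (by fun_prop) (fun t φ ψ => ?_)
    hd.stronglyContinuous
  rw [← map_sub]
  exact norm_P_le h hd hμ t _

theorem continuous_Q_uncurry : Continuous (fun q : ℝ × C r n => Q P q.1 q.2) :=
  continuous_snd.sub (continuous_P_uncurry h hd hμ)

omit hd hμ in
theorem continuous_sg_lsol_uncurry (s : ℝ) :
    Continuous (fun q : ℝ × C r n => sg r (lsol h s q.2) q.1) := by
  have := continuous_Lam h.int s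
  refine continuous_uncurry_of_lipschitz (A := fun t φ => sg r (lsol h s φ) t)
    (c := fun t => 2 * Real.exp (2 * Lam m s t)) (by fun_prop) (fun t φ ψ => ?_)
    fun φ => continuous_sg (continuous_lsol h s φ)
  have e : sg r (lsol h s φ) t - sg r (lsol h s ψ) t = sg r (lsol h s (φ - ψ)) t := by
    rw [← sg_sub (continuous_lsol h s φ) (continuous_lsol h s ψ)]
    congr 1
    funext v
    have h1 := lsol_add h s φ ((-1 : ℝ) • ψ) v
    rw [lsol_smul, neg_one_smul, neg_one_smul] at h1
    rw [sub_eq_add_neg, sub_eq_add_neg, h1]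
  rw [e]
  exact (norm_sg_lsol_le h s _ t).trans (le_of_eq (by ring))

/-- Joint continuity of `(t, s, φ) ↦ T̄(t, s) Q(s) φ`. Going back to a time `u` before `t` and `s`, the
unstable bound gives continuity of `T̄(u, s) Q(s) φ`; from `u` on, the solution moves forwards. -/
theorem continuous_W : Continuous (fun q : ℝ × ℝ × C r n => W L P q.1 q.2.1 q.2.2) := by
  have hell := continuous_ell hμ
  rw [continuous_iff_continuousAt]
  rintro ⟨t₀, s₀, φ₀⟩
  set u := min t₀ s₀ - 1 with hu
  have hut : u < t₀ := by have := min_le_left t₀ s₀; linarith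
  have hus : u < s₀ := by have := min_le_right t₀ s₀; linarith
  set ψ := W L P u s₀ φ₀ with hψ
  -- continuity of `(s, φ) ↦ W(u, s) φ`
  have h1 : Tendsto (fun q : ℝ × C r n => W L P u q.1 q.2) (𝓝 (s₀, φ₀)) (𝓝 ψ) := by
    rw [tendsto_iff_norm_sub_tendsto_zero]
    have hcont : Continuous (fun q : ℝ × C r n => K * Real.exp (ν * |ell μ q.1|) *
        ‖Q P q.1 q.2 - sg r (lsol h u ψ) q.1‖) := by
      have e1 := continuous_Q_uncurry h hd hμ
      have e2 : Continuous (fun q : ℝ × C r n => sg r (lsol h u ψ) q.1) :=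
        (continuous_sg (continuous_lsol h u ψ)).comp continuous_fst
      fun_prop
    have hlim := hcont.tendsto (s₀, φ₀)
    rw [← T_eq_sg h hus.le, hψ, T_W_eq h hd hus.le, W_self h hd, sub_self, norm_zero,
      mul_zero] at hlim
    refine squeeze_zero' (Eventually.of_forall fun _ => norm_nonneg _) ?_ hlim
    have : ∀ᶠ q : ℝ × C r n in 𝓝 (s₀, φ₀), u < q.1 :=
      continuous_fst.continuousAt.eventually (lt_mem_nhds hus)
    filter_upwards [this] with q hq
    have e : W L P u q.1 q.2 - ψ = W L P u q.1 (Q P q.1 q.2 - sg r (lsol h u ψ) q.1) := by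
      rw [W_sub h hd, W_Q hd, ← T_eq_sg h hq.le, W_T h hd hq.le, W_self h hd,
        Q_of_mem_U hd (W_mem ..)]
    rw [e]
    refine (norm_W_le hd hμ hq.le _).trans ?_
    have hK := hd.one_le_K
    have hβ := hd.beta_pos
    gcongr
    have := mul_nonneg hβ.le (sub_nonneg.2 (ell_mono hμ hq.le))
    linarith
  have h2 : Tendsto (fun q : ℝ × ℝ × C r n => sg r (lsol h u (W L P u q.2.1 q.2.2)) q.1)
      (𝓝 (t₀, s₀, φ₀)) (𝓝 (sg r (lsol h u ψ) t₀)) :=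
    ((continuous_sg_lsol_uncurry h u).tendsto (t₀, ψ)).comp
      ((continuous_fst.tendsto (t₀, s₀, φ₀)).prodMk_nhds
        (h1.comp (continuous_snd.tendsto (t₀, s₀, φ₀))))
  have h3 : W L P t₀ s₀ φ₀ = sg r (lsol h u ψ) t₀ := by
    rw [← T_eq_sg h hut.le, hψ, T_W_eq h hd hut.le]
  rw [ContinuousAt, h3]
  refine h2.congr' ?_
  have : ∀ᶠ q : ℝ × ℝ × C r n in 𝓝 (t₀, s₀, φ₀), u < q.1 :=
    continuous_fst.continuousAt.eventually (lt_mem_nhds hut)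
  filter_upwards [this] with q hq
  rw [← T_eq_sg h hq.le, T_W_eq h hd hq.le]

end Dichotomy

/-! ### The operators `Q₀` and `P₀` -/

section Projections

variable {r : ℝ} {n : ℕ} {L : ℝ → C r n →L[ℝ] E n} {m μ : ℝ → ℝ} {K α β θ ν : ℝ}
  {P : ℝ → C r n →L[ℝ] C r n} (h : Adm L m) (hd : HasMuDichotomy L μ K α β θ ν P)

/-- `T̄(t, τ) Q₀(τ) p`. -/
noncomputable def unst (h : Adm L m) (P : ℝ → C r n →L[ℝ] C r n) (t τ : ℝ) (p : E n) : C r n :=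
  W L P t (τ + r) (fundSeg h τ p)

/-- `T₀(t, τ) P₀(τ) p`. -/
noncomputable def stab (h : Adm L m) (P : ℝ → C r n →L[ℝ] C r n) (t τ : ℝ) (p : E n) (ω : I r) :
    E n := fund h τ p (t + ω) - unst h P t τ p ω

theorem Q0_eq (τ : ℝ) (p : E n) : (Q0 L P τ p : C r n) = unst h P τ τ p := by
  unfold Q0 unst W
  rw [toC_T0_X0 h]

include hd

theorem Tbar_Q0 (t τ : ℝ) (p : E n) : (Tbar L P t τ (Q0 L P τ p) : C r n) = unst h P t τ p := by
  rw [← W_coe hd, Q0_eq h, unst, W_W h hd, unst]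

theorem T0_P0 {t τ : ℝ} (ht : τ ≤ t) (p : E n) (ω : I r) :
    T0 L t τ (P0 L P τ p) ω = stab h P t τ p ω := by
  have e : P0 L P τ p = fun ω => (-unst h P τ τ p) ω + X0 p ω := by
    funext ω
    unfold P0
    rw [Q0_eq h, sub_eq_add_neg, add_comm]
    rfl
  rw [e, T0_add_X0 h ht]
  have h1 := lsol_smul h τ (-1) (unst h P τ τ p) (t + ω)
  have h2 : lsol h τ (unst h P τ τ p) (t + ω) = unst h P t τ p ω := by
    rw [← sg_apply (continuous_lsol h _ _), ← T_eq_sg h ht, unst, T_W_eq h hd ht, unst]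
  rw [neg_one_smul, neg_one_smul] at h1
  rw [h1, h2, stab, sub_eq_add_neg, add_comm]

theorem stab_of_le {t τ : ℝ} (ht : τ + r ≤ t) (p : E n) (ω : I r) :
    stab h P t τ p ω = T L t (τ + r) (P (τ + r) (fundSeg h τ p)) ω := by
  have e : P (τ + r) (fundSeg h τ p) = fundSeg h τ p - Q P (τ + r) (fundSeg h τ p) := by
    rw [Q_apply, sub_sub_cancel]
  rw [stab, e, T_sub h ht, T_fundSeg h ht, unst, W_of_le hd ht]
  change _ = sg r (fund h τ p) t ω - _
  rw [sg_apply' (continuous_seg_fund h ht p)]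
  rfl

theorem unst_sum (t τ : ℝ) (p : E n) :
    unst h P t τ p = ∑ j, p j • unst h P t τ (unitVec j) := by
  unfold unst
  let Φ : C r n →ₗ[ℝ] C r n :=
    { toFun := W L P t (τ + r)
      map_add' := W_add h hd t (τ + r)
      map_smul' := W_smul h hd t (τ + r) }
  change Φ _ = ∑ j, p j • Φ _
  rw [fundSeg_sum h τ p, map_sum]
  simp_rw [map_smul]

theorem norm_stab_le {ε D : ℝ} (hD : StableBound L P μ α θ ε D) (hμ : IsDiffGrowthRate μ)
    {t τ : ℝ} (ht : τ ≤ t) (p : E n) (ω : I r) : ‖stab h P t τ p ω‖ ≤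
      D * Real.exp (-α * (ell μ t - ell μ τ) + (θ + ε) * |ell μ τ|) * ‖p‖ := by
  have := hD τ t ht p ω
  rwa [T0_P0 h hd ht, ratio_rpow hμ, wt_eq_exp hμ, mul_assoc D, ← Real.exp_add] at this

theorem norm_unst_le {ε D : ℝ} (hD : UnstableBound L P μ β ν ε D) (hμ : IsDiffGrowthRate μ)
    {t τ : ℝ} (ht : t ≤ τ) (p : E n) : ‖unst h P t τ p‖ ≤
      D * Real.exp (-β * (ell μ τ - ell μ t) + (ν + ε) * |ell μ τ|) * ‖p‖ := by
  have := hD τ t ht p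
  rw [Tbar_Q0 h hd, ratio_rpow hμ, wt_eq_exp hμ, mul_assoc D, ← Real.exp_add] at this
  rwa [show -β * (ell μ τ - ell μ t) = β * (ell μ t - ell μ τ) by ring]

omit hd in
/-- The growth bound of `T₀`, applied to the histories `X₀ p`. -/
theorem norm_fund_le_growth {Kt a ε : ℝ} (hμ : IsDiffGrowthRate μ) (hKt : 0 ≤ Kt) (ha : 0 ≤ a)
    (hg : HasBoundedGrowth L μ Kt a ε) {t τ : ℝ} (ht : τ ≤ t) (p : E n) (ω : I r) :
    ‖fund h τ p (t + ω)‖ ≤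
      Kt * Real.exp (a * (ell μ t - ell μ τ) + ε * |ell μ τ|) * ‖p‖ := by
  have hX : MemC0 (r := r) (X0 p) := by
    have := memC0_add_X0 h.pos 0 p
    rwa [show (fun ω : I r => (0 : C r n) ω + X0 p ω) = X0 p from funext fun ω => zero_add _]
      at this
  have hXn : ∀ ω : I r, ‖X0 p ω‖ ≤ ‖p‖ := fun ω => by
    unfold X0
    split_ifs
    · exact le_rfl
    · rw [norm_zero]; exact norm_nonneg p
  have := hg τ t ht (X0 p) ‖p‖ hX hXn ω
  rw [T0_X0 h ht, ratio_rpow hμ, wt_eq_exp hμ, mul_assoc Kt, ← Real.exp_add] at this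
  refine this.trans ?_
  have h1 := sub_nonneg.2 (ell_mono hμ ht)
  gcongr
  rcases ht.eq_or_lt with h2 | h2
  · simpa [h2] using ha
  · rw [Real.sign_of_pos (sub_pos.2 h2), one_mul]

include h in
/-- The dichotomy bounds pass to `T₀ P₀` and `T̄ Q₀`. The segment of the fundamental solution at time
`s + r` lies in `C`, and `ℓ(s + r) - ℓ(s) ≤ c = log N`, so that replacing `s + r` by `s` in the dichotomy
bounds costs a factor `e^{const c}`. For `s ≤ t < s + r` the stable part is the difference of the
fundamental solution, controlled by the growth bound, and of the unstable part; hence the factor `2`. -/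
theorem exists_bounds {Kt a ε N : ℝ} (hμ : IsDiffGrowthRate μ) (hKt : 1 ≤ Kt) (ha : 0 ≤ a)
    (hε : 0 < ε) (hN1 : 1 < N) (hN : ∀ s, μ (s + r) / μ s ≤ N)
    (hg : HasBoundedGrowth L μ Kt a ε) (hθ : ε + ν ≤ θ) :
    ∃ D : ℝ, K ≤ D ∧ StableBound L P μ α θ ε D ∧ UnstableBound L P μ β ν ε D := by
  have hr := h.pos
  have hK := hd.one_le_K
  have hα := hd.alpha_pos
  have hβ := hd.beta_pos
  have hν := hd.nu_nonneg
  have hθ0 := hd.theta_nonneg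
  set c := Real.log N with hc
  have hc0 : 0 ≤ c := Real.log_nonneg hN1.le
  have hell : ∀ s, ell μ (s + r) - ell μ s ≤ c := fun s => by
    have := Real.log_le_log (div_pos (hμ.pos (s + r)) (hμ.pos s)) (hN s)
    rwa [Real.log_div (hμ.pos _).ne' (hμ.pos _).ne'] at this
  have hell0 : ∀ s, ell μ s ≤ ell μ (s + r) := fun s => ell_mono hμ (by linarith)
  have habs : ∀ s, |ell μ (s + r)| ≤ |ell μ s| + c := fun s => by
    have h1 := abs_add_le (ell μ s) (ell μ (s + r) - ell μ s)
    rw [add_sub_cancel, abs_of_nonneg (sub_nonneg.2 (hell0 s))] at h1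
    linarith [hell s]
  have hY : ∀ s p, ‖fundSeg h s p‖ ≤ Kt * Real.exp (a * c + ε * |ell μ s|) * ‖p‖ := fun s p => by
    refine C_norm_le (by positivity) fun ω => ?_
    unfold fundSeg
    rw [sg_apply' (continuous_seg_fund h le_rfl p)]
    refine (norm_fund_le_growth h hμ (by linarith) ha hg (by linarith) p ω).trans ?_
    gcongr
    exact hell s
  set M := Real.exp ((a + α + θ + ν) * c) with hM
  have hM1 : 1 ≤ M := Real.one_le_exp (by positivity)
  have hU : ∀ s t, t ≤ s + r → ∀ p : E n, ‖unst h P t s p‖ ≤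
      K * Kt * Real.exp (-β * (ell μ (s + r) - ell μ t) + (a + ν) * c + (ν + ε) * |ell μ s|) *
        ‖p‖ := fun s t hts p => by
    refine (norm_W_le hd hμ hts _).trans ?_
    calc _ ≤ K * Real.exp (-β * (ell μ (s + r) - ell μ t) + ν * (|ell μ s| + c)) *
          (Kt * Real.exp (a * c + ε * |ell μ s|) * ‖p‖) := by
            gcongr
            · exact habs s
            · exact hY s p
      _ = K * Kt * (Real.exp (-β * (ell μ (s + r) - ell μ t) + ν * (|ell μ s| + c)) *
          Real.exp (a * c + ε * |ell μ s|)) * ‖p‖ := by ring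
      _ = _ := by rw [← Real.exp_add]; congr 3; ring
  have hKD : K * Kt * M ≤ 2 * (K * Kt * M) := by
    have : 0 ≤ K * Kt * M := by positivity
    linarith
  refine ⟨2 * (K * Kt * M), ?_, fun s t hst p ω => ?_, fun s t hts p => ?_⟩
  · calc K = K * 1 * 1 := by ring
      _ ≤ K * Kt * M := by gcongr
      _ ≤ _ := hKD
  · rw [T0_P0 h hd hst, ratio_rpow hμ, wt_eq_exp hμ, mul_assoc (2 * (K * Kt * M)), ← Real.exp_add]
    -- after one delay the dichotomy applies; before, the growth bound is used
    rcases le_or_gt (s + r) t with h1 | h1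
    · rw [stab_of_le h hd h1]
      refine (norm_apply_le _ _).trans ((norm_T_P_le hd hμ h1 _).trans ?_)
      calc _ ≤ K * Real.exp (-α * (ell μ t - ell μ (s + r)) + θ * (|ell μ s| + c)) *
            (Kt * Real.exp (a * c + ε * |ell μ s|) * ‖p‖) := by
              gcongr
              · exact habs s
              · exact hY s p
        _ = K * Kt * (Real.exp (-α * (ell μ t - ell μ (s + r)) + θ * (|ell μ s| + c)) *
            Real.exp (a * c + ε * |ell μ s|)) * ‖p‖ := by ring
        _ ≤ K * Kt * (M * Real.exp (-α * (ell μ t - ell μ s) + (θ + ε) * |ell μ s|)) * ‖p‖ := by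
            rw [← Real.exp_add, hM, ← Real.exp_add]
            refine mul_le_mul_of_nonneg_right (mul_le_mul_of_nonneg_left (Real.exp_le_exp.2 ?_)
              (by positivity)) (norm_nonneg p)
            have e1 := mul_le_mul_of_nonneg_left (hell s) hα.le
            have e2 := mul_nonneg hν hc0
            nlinarith
        _ = K * Kt * M * Real.exp (-α * (ell μ t - ell μ s) + (θ + ε) * |ell μ s|) * ‖p‖ := by
            ring
        _ ≤ _ := by gcongr
    · have e1 := norm_fund_le_growth h hμ (by linarith) ha hg hst p ω
      have e2 := (norm_apply_le (unst h P t s p) ω).trans (hU s t h1.le p)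
      have hts : ell μ t - ell μ s ≤ c := by linarith [hell s, ell_mono hμ h1.le]
      have hαc := mul_le_mul_of_nonneg_left hts hα.le
      have hνc := mul_nonneg hν hc0
      have hθc := mul_nonneg hθ0 hc0
      have hac := mul_nonneg ha hc0
      have habs0 := abs_nonneg (ell μ s)
      set X := M * Real.exp (-α * (ell μ t - ell μ s) + (θ + ε) * |ell μ s|) with hX
      have e1' : ‖fund h s p (t + ω)‖ ≤ K * Kt * X * ‖p‖ := by
        refine e1.trans ?_
        rw [hX, hM, ← Real.exp_add]
        have h0 : Kt ≤ K * Kt := le_mul_of_one_le_left (by linarith) hK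
        refine mul_le_mul_of_nonneg_right (mul_le_mul h0 (Real.exp_le_exp.2 ?_)
          (Real.exp_pos _).le (by positivity)) (norm_nonneg p)
        have := mul_le_mul_of_nonneg_left hts ha
        have := mul_nonneg hθ0 habs0
        nlinarith
      have e2' : ‖unst h P t s p ω‖ ≤ K * Kt * X * ‖p‖ := by
        refine e2.trans ?_
        rw [hX, hM, ← Real.exp_add]
        refine mul_le_mul_of_nonneg_right (mul_le_mul_of_nonneg_left (Real.exp_le_exp.2 ?_)
          (by positivity)) (norm_nonneg p)
        have h2 := mul_nonneg hβ.le (sub_nonneg.2 (ell_mono hμ h1.le))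
        have h3 := mul_le_mul_of_nonneg_right (show ν + ε ≤ θ + ε by linarith) habs0
        nlinarith
      calc ‖stab h P t s p ω‖ ≤ _ := norm_sub_le _ _
        _ ≤ K * Kt * X * ‖p‖ + K * Kt * X * ‖p‖ := add_le_add e1' e2'
        _ = _ := by rw [hX]; ring
  · rw [Tbar_Q0 h hd, ratio_rpow hμ, wt_eq_exp hμ, mul_assoc (2 * (K * Kt * M)), ← Real.exp_add]
    refine (hU s t (by linarith) p).trans ?_
    calc _ ≤ K * Kt * (M * Real.exp (β * (ell μ t - ell μ s) + (ν + ε) * |ell μ s|)) * ‖p‖ := by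
            rw [hM, ← Real.exp_add]
            refine mul_le_mul_of_nonneg_right (mul_le_mul_of_nonneg_left (Real.exp_le_exp.2 ?_)
              (by positivity)) (norm_nonneg p)
            have e1 := mul_le_mul_of_nonneg_left (hell0 s) hβ.le
            have e2 := mul_nonneg hα.le hc0
            have e3 := mul_nonneg hθ0 hc0
            nlinarith
      _ = K * Kt * M * Real.exp (β * (ell μ t - ell μ s) + (ν + ε) * |ell μ s|) * ‖p‖ := by
            ring
      _ ≤ _ := by gcongr

end Projections

/-! ### Bounded solutions of the forced linear equation -/

section Green

variable {r : ℝ} {n : ℕ} {L : ℝ → C r n →L[ℝ] E n} {m μ : ℝ → ℝ} {K α β θ ν D ϑ : ℝ}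
  {P : ℝ → C r n →L[ℝ] C r n}

/-- The kernel that dominates both `T₀ P₀` and `T̄ Q₀`. -/
noncomputable def ker (μ : ℝ → ℝ) (α β ϑ t τ : ℝ) : ℝ :=
  Real.exp ((if τ ≤ t then -α * (ell μ t - ell μ τ) else -β * (ell μ τ - ell μ t)) +
    ϑ * |ell μ τ|)

/-- The standing data: a linear equation with a `μ`-dichotomy whose operators `T₀ P₀` and `T̄ Q₀`
are dominated by `D` times the kernel `ker`. -/
structure Ctx (L : ℝ → C r n →L[ℝ] E n) (m μ : ℝ → ℝ) (K α β θ ν D ϑ : ℝ)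
    (P : ℝ → C r n →L[ℝ] C r n) : Prop where
  adm : Adm L m
  dich : HasMuDichotomy L μ K α β θ ν P
  rate : IsDiffGrowthRate μ
  nonneg : 0 ≤ D
  stab_le : ∀ t τ, τ ≤ t → ∀ p ω, ‖stab adm P t τ p ω‖ ≤ D * ker μ α β ϑ t τ * ‖p‖
  unst_le : ∀ t τ, t ≤ τ → ∀ p, ‖unst adm P t τ p‖ ≤ D * ker μ α β ϑ t τ * ‖p‖

/-- Forcing terms that are integrable against the kernel. -/
structure Dom (μ : ℝ → ℝ) (α β ϑ : ℝ) (f : ℝ → E n) : Prop where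
  meas : AEStronglyMeasurable f volume
  int : ∀ t, Integrable (fun τ => ker μ α β ϑ t τ * ‖f τ‖) volume

theorem ker_pos (t τ : ℝ) : 0 < ker μ α β ϑ t τ := Real.exp_pos _

theorem ker_of_le {t τ : ℝ} (h : τ ≤ t) :
    ker μ α β ϑ t τ = Real.exp (-α * (ell μ t - ell μ τ) + ϑ * |ell μ τ|) := by
  rw [ker, if_pos h]

theorem ker_of_ge {t τ : ℝ} (h : t ≤ τ) :
    ker μ α β ϑ t τ = Real.exp (-β * (ell μ τ - ell μ t) + ϑ * |ell μ τ|) := by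
  rcases h.eq_or_lt with h | h
  · rw [ker, if_pos h.ge, h, sub_self, mul_zero, mul_zero]
  · rw [ker, if_neg (not_le.2 h)]

theorem measurable_ker (hμ : IsDiffGrowthRate μ) (t : ℝ) : Measurable (ker μ α β ϑ t) := by
  have h1 := (continuous_ell hμ).measurable
  refine Real.measurable_exp.comp (Measurable.add ?_ ((measurable_abs.comp h1).const_mul ϑ))
  exact Measurable.ite measurableSet_Iic ((h1.const_sub _).const_mul _)
    ((h1.sub_const _).const_mul _)

theorem ker_le_mul_ker (hμ : IsDiffGrowthRate μ) (hα : 0 ≤ α) (hβ : 0 ≤ β) (t s τ : ℝ) :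
    ker μ α β ϑ t τ ≤ Real.exp ((α + β) * |ell μ t - ell μ s|) * ker μ α β ϑ s τ := by
  unfold ker
  rw [← Real.exp_add]
  refine Real.exp_le_exp.2 ?_
  have h1 := le_abs_self (ell μ t - ell μ s)
  have h2 := neg_abs_le (ell μ t - ell μ s)
  have h0 := abs_nonneg (ell μ t - ell μ s)
  split_ifs with ha hb hb
  · nlinarith
  · push Not at hb
    have := ell_mono hμ ha
    have := ell_mono hμ hb.le
    nlinarith
  · push Not at ha
    have := ell_mono hμ hb
    have := ell_mono hμ ha.le
    nlinarith
  · nlinarith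

theorem Dom.of_int (hμ : IsDiffGrowthRate μ) (hα : 0 ≤ α) (hβ : 0 ≤ β) {f : ℝ → E n}
    (hf : AEStronglyMeasurable f volume) {s : ℝ}
    (hi : Integrable (fun τ => ker μ α β ϑ s τ * ‖f τ‖) volume) : Dom μ α β ϑ f := by
  refine ⟨hf, fun t => (hi.const_mul (Real.exp ((α + β) * |ell μ t - ell μ s|))).mono'
    ((measurable_ker hμ t).aestronglyMeasurable.mul hf.norm) (Eventually.of_forall fun τ => ?_)⟩
  rw [Real.norm_of_nonneg (mul_nonneg (ker_pos t τ).le (norm_nonneg _)), ← mul_assoc]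
  gcongr
  exact ker_le_mul_ker hμ hα hβ t s τ

theorem Dom.locallyIntegrable (hμ : IsDiffGrowthRate μ) {f : ℝ → E n} (hf : Dom μ α β ϑ f) :
    LocallyIntegrable f volume := by
  rw [locallyIntegrable_iff]
  intro k hk
  obtain ⟨b, hb⟩ := hk.bddAbove
  have h1 := continuous_ell hμ
  have h2 : IntegrableOn (fun τ => Real.exp (-(-α * (ell μ b - ell μ τ) + ϑ * |ell μ τ|)) *
      (ker μ α β ϑ b τ * ‖f τ‖)) k volume :=
    ((hf.int b).integrableOn).continuousOn_mul (by fun_prop) hk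
  refine Integrable.mono' h2 hf.meas.restrict ?_
  filter_upwards [ae_restrict_mem hk.measurableSet] with τ hτ
  rw [ker_of_le (hb hτ), ← mul_assoc, ← Real.exp_add, neg_add_cancel, Real.exp_zero, one_mul]

theorem Dom.add {f g : ℝ → E n} (hμ : IsDiffGrowthRate μ) (hf : Dom μ α β ϑ f)
    (hg : Dom μ α β ϑ g) : Dom μ α β ϑ (fun τ => f τ + g τ) := by
  refine ⟨hf.meas.add hg.meas, fun t => ((hf.int t).add (hg.int t)).mono'
    ((measurable_ker hμ t).aestronglyMeasurable.mul (hf.meas.add hg.meas).norm)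
    (Eventually.of_forall fun τ => ?_)⟩
  rw [Real.norm_of_nonneg (mul_nonneg (ker_pos t τ).le (norm_nonneg _))]
  change _ ≤ ker μ α β ϑ t τ * ‖f τ‖ + ker μ α β ϑ t τ * ‖g τ‖
  rw [← mul_add]
  gcongr
  · exact (ker_pos t τ).le
  · exact norm_add_le _ _

theorem Dom.smul {f : ℝ → E n} (hf : Dom μ α β ϑ f) (c : ℝ) : Dom μ α β ϑ (fun τ => c • f τ) := by
  refine ⟨hf.meas.const_smul c, fun t => ?_⟩
  simp_rw [norm_smul, mul_left_comm _ ‖c‖]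
  exact (hf.int t).const_mul _

theorem Dom.sub {f g : ℝ → E n} (hμ : IsDiffGrowthRate μ) (hf : Dom μ α β ϑ f)
    (hg : Dom μ α β ϑ g) : Dom μ α β ϑ (fun τ => f τ - g τ) := by
  have := hf.add hμ (hg.smul (-1))
  simpa only [neg_one_smul, ← sub_eq_add_neg] using this

variable (c : Ctx L m μ K α β θ ν D ϑ P)
include c

theorem Ctx.aestronglyMeasurable_unst {f : ℝ → E n} (hf : AEStronglyMeasurable f volume) (t : ℝ) :
    AEStronglyMeasurable (fun τ => unst c.adm P t τ (f τ)) volume := by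
  rw [funext fun τ => unst_sum c.adm c.dich t τ (f τ)]
  refine Finset.aestronglyMeasurable_fun_sum _ fun j _ => (aestronglyMeasurable_coord hf j).smul ?_
  have h1 := continuous_W c.adm c.dich c.rate
  have h2 : StronglyMeasurable (fun τ : ℝ => (t, τ + r, fundSeg c.adm τ (unitVec j))) :=
    stronglyMeasurable_const.prodMk ((by fun_prop : Continuous fun τ : ℝ => τ + r).stronglyMeasurable.prodMk
      (stronglyMeasurable_fundSeg c.adm (unitVec j)))
  exact (h1.comp_stronglyMeasurable h2).aestronglyMeasurable

theorem Ctx.aestronglyMeasurable_stab {f : ℝ → E n} (hf : AEStronglyMeasurable f volume) (t : ℝ)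
    (ω : I r) : AEStronglyMeasurable (fun τ => stab c.adm P t τ (f τ) ω) volume :=
  (aestronglyMeasurable_fund c.adm hf (t + ω)).sub
    ((evalL ω).continuous.comp_aestronglyMeasurable (c.aestronglyMeasurable_unst hf t))

theorem Ctx.integrableOn_stab {f : ℝ → E n} (hf : Dom μ α β ϑ f) (t : ℝ) (ω : I r) :
    IntegrableOn (fun τ => stab c.adm P t τ (f τ) ω) (Iic t) volume := by
  refine (((hf.int t).const_mul D).integrableOn (s := Iic t)).mono'
    (c.aestronglyMeasurable_stab hf.meas t ω).restrict ?_
  filter_upwards [ae_restrict_mem measurableSet_Iic] with τ hτ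
  rw [← mul_assoc]
  exact c.stab_le t τ hτ _ ω

theorem Ctx.integrableOn_unst {f : ℝ → E n} (hf : Dom μ α β ϑ f) (t : ℝ) :
    IntegrableOn (fun τ => unst c.adm P t τ (f τ)) (Ioi t) volume := by
  refine (((hf.int t).const_mul D).integrableOn (s := Ioi t)).mono'
    (c.aestronglyMeasurable_unst hf.meas t).restrict ?_
  filter_upwards [ae_restrict_mem measurableSet_Ioi] with τ hτ
  rw [← mul_assoc]
  exact c.unst_le t τ (le_of_lt hτ) _

theorem Ctx.integrableOn_unst_apply {f : ℝ → E n} (hf : Dom μ α β ϑ f) (t : ℝ) (ω : I r) :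
    IntegrableOn (fun τ => unst c.adm P t τ (f τ) ω) (Ioi t) volume :=
  (evalL ω).integrable_comp (c.integrableOn_unst hf t)

omit c in
/-- `∫_{-∞}^t T₀(t, τ) P₀(τ) f(τ) dτ - ∫_t^∞ T̄(t, τ) Q₀(τ) f(τ) dτ`, evaluated at `ω`. -/
noncomputable def green (h : Adm L m) (P : ℝ → C r n →L[ℝ] C r n) (f : ℝ → E n) (t : ℝ)
    (ω : I r) : E n :=
  (∫ τ in Iic t, stab h P t τ (f τ) ω) - ∫ τ in Ioi t, unst h P t τ (f τ) ω

omit c in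
/-- `T₀(t, τ) P₀(τ) p` as an element of `C`, for `τ + r ≤ t`. -/
noncomputable def stabC (h : Adm L m) (P : ℝ → C r n →L[ℝ] C r n) (t τ : ℝ) (p : E n) : C r n :=
  T L t (τ + r) (P (τ + r) (fundSeg h τ p))

theorem Ctx.stabC_apply {t τ : ℝ} (ht : τ + r ≤ t) (p : E n) (ω : I r) :
    stabC c.adm P t τ p ω = stab c.adm P t τ p ω := (stab_of_le c.adm c.dich ht p ω).symm

/-- For `τ ≤ t - r` the stable kernel takes values in `C`, where its integral is a Bochner integral. -/
theorem Ctx.integrableOn_stabC {f : ℝ → E n} (hf : Dom μ α β ϑ f) {s t : ℝ} (hst : s + r ≤ t) :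
    IntegrableOn (fun τ => stabC c.adm P t τ (f τ)) (Iic s) volume := by
  have hr := c.adm.pos
  have hmeas : AEStronglyMeasurable (fun τ => stabC c.adm P t τ (f τ)) (volume.restrict (Iic s)) := by
    have h1 : AEStronglyMeasurable (fun τ => sg r (fund c.adm τ (f τ)) t)
        (volume.restrict (Iic s)) := by
      refine aestronglyMeasurable_of_tendsto_ae (u := atTop)
        (f := fun k τ => sg r (lsol c.adm τ (bump r k (f τ))) t)
        (fun k => (aestronglyMeasurable_sg_lsol c.adm k hf.meas t).restrict) ?_
      filter_upwards [ae_restrict_mem measurableSet_Iic] with τ hτ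
      have hτt : τ + r ≤ t := by linarith [mem_Iic.1 hτ]
      refine (tendsto_T_bump c.adm hτt (f τ)).congr fun k => ?_
      rw [T_eq_sg c.adm (by linarith)]
    refine (h1.sub (c.aestronglyMeasurable_unst hf.meas t).restrict).congr ?_
    filter_upwards [ae_restrict_mem measurableSet_Iic] with τ hτ
    have hτt : τ + r ≤ t := by linarith [mem_Iic.1 hτ]
    refine DFunLike.ext _ _ fun ω => ?_
    rw [c.stabC_apply hτt]
    change sg r (fund c.adm τ (f τ)) t ω - _ = _
    rw [sg_apply' (continuous_seg_fund c.adm hτt (f τ))]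
    rfl
  refine (((hf.int t).const_mul D).integrableOn (s := Iic s)).mono' hmeas ?_
  filter_upwards [ae_restrict_mem measurableSet_Iic] with τ hτ
  have hτt : τ + r ≤ t := by linarith [mem_Iic.1 hτ]
  have hD := c.nonneg
  have hk := (ker_pos (μ := μ) (α := α) (β := β) (ϑ := ϑ) t τ).le
  refine C_norm_le (by positivity) fun ω => ?_
  rw [c.stabC_apply hτt, ← mul_assoc]
  exact c.stab_le t τ (by linarith) _ ω

omit c in
/-- The local representation of `green`: a sum of two homogeneous solutions and of the solution
given by variation of constants. -/
noncomputable def greenLoc (h : Adm L m) (P : ℝ → C r n →L[ℝ] C r n) (f : ℝ → E n) (s v : ℝ) :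
    E n :=
  (lsol h (s + r) (∫ τ in Iic s, stabC h P (s + r) τ (f τ)) v + voc h f s v) +
    (-1 : ℝ) • lsol h s (∫ τ in Ioi s, unst h P s τ (f τ)) v

/-- After time `s + r` the integrals in `green` split at `s`. The stable part over `(-∞, s]` and the
unstable part over `(s, ∞)` are homogeneous solutions; the segments of the
former lie in `C` only from time `s + r` on, hence its starting time. The remaining parts over `(s, t]` combine to `voc`, as
`P₀ + Q₀ = X₀`. -/
theorem Ctx.green_eq_greenLoc {f : ℝ → E n} (hf : Dom μ α β ϑ f) {s t : ℝ} (hst : s + r ≤ t)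
    (ω : I r) : green c.adm P f t ω = greenLoc c.adm P f s (t + ω) := by
  have hr := c.adm.pos
  have hs : s ≤ t := by linarith
  have hfl := hf.locallyIntegrable c.rate
  have hA := c.integrableOn_stabC hf (le_refl (s + r))
  have hB := c.integrableOn_unst hf s
  -- the contribution of `(-∞, s]`
  have e1 : ∫ τ in Iic s, stab c.adm P t τ (f τ) ω =
      lsol c.adm (s + r) (∫ τ in Iic s, stabC c.adm P (s + r) τ (f τ)) (t + ω) := by
    rw [← sg_apply (continuous_lsol c.adm _ _), ← T_eq_sg c.adm hst, ← TL_apply c.adm hst,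
      ← evalL_apply, ← ContinuousLinearMap.integral_comp_comm _ hA,
      ← ContinuousLinearMap.integral_comp_comm _ ((TL c.adm hst).integrable_comp hA)]
    refine setIntegral_congr_fun measurableSet_Iic fun τ hτ => ?_
    have hτs : τ ≤ s := hτ
    change _ = T L t (s + r) (T L (s + r) (τ + r) _) ω
    rw [T_T c.adm (by linarith) hst]
    exact (c.stabC_apply (by linarith) _ _).symm
  -- the contribution of the unstable part
  have hBt : IntegrableOn (fun τ => unst c.adm P t τ (f τ) ω) (Ioi s) volume := by
    refine ((evalL ω).integrable_comp ((TL c.adm hs).integrable_comp hB)).congr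
      (Eventually.of_forall fun τ => ?_)
    change T L t s (W L P s (τ + r) _) ω = W L P t (τ + r) _ ω
    rw [T_W_eq c.adm c.dich hs]
  have e2 : ∫ τ in Ioi s, unst c.adm P t τ (f τ) ω =
      lsol c.adm s (∫ τ in Ioi s, unst c.adm P s τ (f τ)) (t + ω) := by
    rw [← sg_apply (continuous_lsol c.adm _ _), ← T_eq_sg c.adm hs, ← TL_apply c.adm hs,
      ← evalL_apply, ← ContinuousLinearMap.integral_comp_comm _ hB,
      ← ContinuousLinearMap.integral_comp_comm _ ((TL c.adm hs).integrable_comp hB)]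
    refine setIntegral_congr_fun measurableSet_Ioi fun τ hτ => ?_
    change W L P t (τ + r) _ ω = T L t s (W L P s (τ + r) _) ω
    rw [T_W_eq c.adm c.dich hs]
  have e3 : ∫ τ in Ioc s t, stab c.adm P t τ (f τ) ω =
      voc c.adm f s (t + ω) - ∫ τ in Ioc s t, unst c.adm P t τ (f τ) ω := by
    rw [voc_eq c.adm f (show t + (ω : ℝ) ≤ t by linarith [ω.2.2])]
    exact integral_sub (integrableOn_fund c.adm hfl s t _) (hBt.mono_set Ioc_subset_Ioi_self)
  have hstab := c.integrableOn_stab hf t ω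
  have e4 : ∫ τ in Iic t, stab c.adm P t τ (f τ) ω = (∫ τ in Iic s, stab c.adm P t τ (f τ) ω) +
      ∫ τ in Ioc s t, stab c.adm P t τ (f τ) ω := by
    rw [← Iic_union_Ioc_eq_Iic hs]
    refine setIntegral_union ?_ measurableSet_Ioc (hstab.mono_set (Iic_subset_Iic.2 hs))
      (hstab.mono_set Ioc_subset_Iic_self)
    exact Set.disjoint_left.2 fun τ h1 h2 => not_lt.2 h1 h2.1
  have e5 : ∫ τ in Ioi s, unst c.adm P t τ (f τ) ω =
      (∫ τ in Ioc s t, unst c.adm P t τ (f τ) ω) + ∫ τ in Ioi t, unst c.adm P t τ (f τ) ω := by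
    rw [← Ioc_union_Ioi_eq_Ioi hs]
    refine setIntegral_union ?_ measurableSet_Ioi (hBt.mono_set Ioc_subset_Ioi_self)
      (hBt.mono_set (Ioi_subset_Ioi hs))
    exact Set.disjoint_left.2 fun τ h1 h2 => not_lt.2 h1.2 h2
  rw [green, greenLoc, ← e1, ← e2, e4, e3, e5, neg_one_smul]
  abel

/-- The sum of two homogeneous solutions and of `voc` solves the forced equation. -/
theorem Ctx.linSol_greenLoc {f : ℝ → E n} (hf : Dom μ α β ϑ f) (s : ℝ) :
    LinSol L f (s + r) (greenLoc c.adm P f s) := by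
  have hfl := hf.locallyIntegrable c.rate
  have hr := c.adm.pos
  have h0 := locallyIntegrable_zero' (F := E n)
  have h1 := (linSol_lsol c.adm (s + r) (∫ τ in Iic s, stabC c.adm P (s + r) τ (f τ))).add c.adm h0
    hfl ((linSol_voc c.adm hfl s).mono c.adm hfl (by linarith : s ≤ s + r))
  have h2 := ((linSol_lsol c.adm s (∫ τ in Ioi s, unst c.adm P s τ (f τ))).mono c.adm h0
    (by linarith : s ≤ s + r)).smul (-1)
  have h3 := h1.add c.adm (h0.add hfl) (h0.smul (-1 : ℝ)) h2
  refine ⟨h3.1, fun t ht => (h3.2 t ht).trans ?_⟩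
  congr 1
  refine intervalIntegral.integral_congr fun u _ => ?_
  change _ + ((0 + f u) + (-1 : ℝ) • (0 : E n)) = _ + f u
  rw [zero_add, smul_zero, add_zero]
  rfl

omit c in
/-- The function `z` with `green f t ω = z (t + ω)`. -/
noncomputable def greenSol (h : Adm L m) (P : ℝ → C r n →L[ℝ] C r n) (f : ℝ → E n) (t : ℝ) :
    E n := green h P f t (zeroI h.nn)

theorem Ctx.greenSol_eq {f : ℝ → E n} (hf : Dom μ α β ϑ f) {s t : ℝ} (hst : s + r ≤ t) :
    greenSol c.adm P f t = greenLoc c.adm P f s t := by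
  rw [greenSol, c.green_eq_greenLoc hf hst]
  simp [zeroI]

theorem Ctx.green_eq {f : ℝ → E n} (hf : Dom μ α β ϑ f) (t : ℝ) (ω : I r) :
    green c.adm P f t ω = greenSol c.adm P f (t + ω) := by
  have hr := c.adm.pos
  have := ω.2.1
  rw [c.green_eq_greenLoc hf (s := t - 2 * r) (by linarith),
    c.greenSol_eq hf (s := t - 2 * r) (by linarith)]

theorem Ctx.continuous_greenSol {f : ℝ → E n} (hf : Dom μ α β ϑ f) :
    Continuous (greenSol c.adm P f) := by
  rw [continuous_iff_continuousAt]
  intro t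
  refine ((c.linSol_greenLoc hf (t - r - 1)).1.continuousAt (x := t)).congr ?_
  filter_upwards [lt_mem_nhds (show t - 1 < t by linarith)] with v hv
  exact (c.greenSol_eq hf (by linarith)).symm

/-- `greenSol f` is a solution of the forced equation on the whole line. -/
theorem Ctx.linSol_greenSol {f : ℝ → E n} (hf : Dom μ α β ϑ f) (s : ℝ) :
    LinSol L f s (greenSol c.adm P f) := by
  have hr := c.adm.pos
  refine ⟨c.continuous_greenSol hf, fun t ht => ?_⟩
  have h1 := ((c.linSol_greenLoc hf (s - 2 * r)).mono c.adm (hf.locallyIntegrable c.rate)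
    (show s - 2 * r + r ≤ s by linarith)).2 t ht
  rw [c.greenSol_eq hf (s := s - 2 * r) (by linarith), h1,
    c.greenSol_eq hf (s := s - 2 * r) (t := s) (by linarith)]
  congr 1
  refine intervalIntegral.integral_congr fun u hu => ?_
  rw [uIcc_of_le ht] at hu
  congr 2
  refine sg_congr fun v hv => (c.greenSol_eq hf ?_).symm
  linarith [hu.1, hv.1]

theorem Ctx.norm_green_le {f : ℝ → E n} (hf : Dom μ α β ϑ f) (t : ℝ) (ω : I r) :
    ‖green c.adm P f t ω‖ ≤ D * ∫ τ, ker μ α β ϑ t τ * ‖f τ‖ := by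
  have hi := (hf.int t).const_mul D
  rw [← integral_const_mul, ← integral_add_compl measurableSet_Iic hi, compl_Iic]
  refine (norm_sub_le _ _).trans (add_le_add ?_ ?_)
  · refine norm_integral_le_of_norm_le hi.integrableOn ?_
    filter_upwards [ae_restrict_mem measurableSet_Iic] with τ hτ
    rw [← mul_assoc]
    exact c.stab_le t τ hτ _ ω
  · refine norm_integral_le_of_norm_le hi.integrableOn ?_
    filter_upwards [ae_restrict_mem measurableSet_Ioi] with τ hτ
    rw [← mul_assoc]
    exact (norm_apply_le _ _).trans (c.unst_le t τ (le_of_lt hτ) _)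

omit c in
/-- `green f t` as an element of `C`. -/
noncomputable def greenC (h : Adm L m) (P : ℝ → C r n →L[ℝ] C r n) (f : ℝ → E n) (t : ℝ) :
    C r n := sg r (greenSol h P f) t

theorem Ctx.greenC_apply {f : ℝ → E n} (hf : Dom μ α β ϑ f) (t : ℝ) (ω : I r) :
    greenC c.adm P f t ω = green c.adm P f t ω := by
  rw [greenC, sg_apply (c.continuous_greenSol hf), c.green_eq hf]

theorem Ctx.norm_greenC_le {f : ℝ → E n} (hf : Dom μ α β ϑ f) (t : ℝ) :
    ‖greenC c.adm P f t‖ ≤ D * ∫ τ, ker μ α β ϑ t τ * ‖f τ‖ := by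
  refine C_norm_le (mul_nonneg c.nonneg (integral_nonneg fun τ => ?_)) fun ω => ?_
  · exact mul_nonneg (ker_pos t τ).le (norm_nonneg _)
  · rw [c.greenC_apply hf]
    exact c.norm_green_le hf t ω

theorem Ctx.continuous_greenC {f : ℝ → E n} (hf : Dom μ α β ϑ f) :
    Continuous (greenC c.adm P f) := continuous_sg (c.continuous_greenSol hf)

theorem Ctx.greenC_add {f g : ℝ → E n} (hf : Dom μ α β ϑ f) (hg : Dom μ α β ϑ g) (t : ℝ) :
    greenC c.adm P (fun τ => f τ + g τ) t = greenC c.adm P f t + greenC c.adm P g t := by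
  have hfund : ∀ t τ (p p' : E n), unst c.adm P t τ (p + p') =
      unst c.adm P t τ p + unst c.adm P t τ p' := fun t τ p p' => by
    rw [unst_sum c.adm c.dich, unst_sum c.adm c.dich t τ p, unst_sum c.adm c.dich t τ p',
      ← Finset.sum_add_distrib]
    exact Finset.sum_congr rfl fun j _ => add_smul _ _ _
  refine DFunLike.ext _ _ fun ω => ?_
  change _ = greenC c.adm P f t ω + greenC c.adm P g t ω
  rw [c.greenC_apply hf, c.greenC_apply hg, c.greenC_apply (hf.add c.rate hg), green, green, green,
    sub_add_sub_comm, ← integral_add (c.integrableOn_stab hf t ω) (c.integrableOn_stab hg t ω),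
    ← integral_add (c.integrableOn_unst_apply hf t ω) (c.integrableOn_unst_apply hg t ω)]
  congr 2
  · funext τ
    unfold stab
    rw [fund_add, hfund, sub_add_sub_comm]
    rfl
  · funext τ
    rw [hfund]
    rfl

theorem Ctx.greenC_smul {f : ℝ → E n} (hf : Dom μ α β ϑ f) (k t : ℝ) :
    greenC c.adm P (fun τ => k • f τ) t = k • greenC c.adm P f t := by
  have hfund : ∀ t τ (p : E n), unst c.adm P t τ (k • p) =
      k • unst c.adm P t τ p := fun t τ p => by
    rw [unst_sum c.adm c.dich, unst_sum c.adm c.dich t τ p, Finset.smul_sum]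
    exact Finset.sum_congr rfl fun j _ => mul_smul _ _ _
  refine DFunLike.ext _ _ fun ω => ?_
  change _ = k • greenC c.adm P f t ω
  rw [c.greenC_apply hf, c.greenC_apply (hf.smul k), green, green, smul_sub, ← integral_smul,
    ← integral_smul]
  congr 2
  · funext τ
    unfold stab
    rw [fund_smul, hfund, smul_sub]
    rfl
  · funext τ
    rw [hfund]
    rfl

theorem Ctx.greenC_sub {f g : ℝ → E n} (hf : Dom μ α β ϑ f) (hg : Dom μ α β ϑ g) (t : ℝ) :
    greenC c.adm P (fun τ => f τ - g τ) t = greenC c.adm P f t - greenC c.adm P g t := by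
  have := c.greenC_add hf (hg.smul (-1)) t
  rw [c.greenC_smul hg, neg_one_smul, ← sub_eq_add_neg] at this
  simpa only [neg_one_smul, ← sub_eq_add_neg] using this

/-- A bounded function that is transported by `T` along the whole line vanishes. -/
theorem Ctx.eq_zero_of_bounded {d : ℝ → C r n} (hT : ∀ s t, s ≤ t → T L t s (d s) = d t) {M : ℝ}
    (hM : ∀ t, ‖d t‖ ≤ M) (t : ℝ) : d t = 0 := by
  have hK := c.dich.one_le_K
  have hM0 : 0 ≤ M := (norm_nonneg _).trans (hM t)
  have hα := c.dich.alpha_pos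
  have hβ := c.dich.beta_pos
  have hθα : θ < α := c.dich.theta_lt
  have hνβ : ν < β := c.dich.nu_lt
  -- the stable part, going back to `-∞`
  have h1 : P t (d t) = 0 := by
    have hb : ∀ᶠ s in atBot, ‖P t (d t)‖ ≤
        K * M * Real.exp (-α * ell μ t + (α - θ) * ell μ s) := by
      filter_upwards [eventually_le_atBot t, eventually_le_atBot (0 : ℝ)] with s hs hs0
      rw [← hT s t hs, ← c.dich.comm s t hs]
      refine (norm_T_P_le c.dich c.rate hs _).trans ?_
      have e0 : ell μ s ≤ 0 := by have := ell_mono c.rate hs0; rwa [ell_zero c.rate] at this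
      rw [abs_of_nonpos e0]
      calc _ ≤ K * Real.exp (-α * (ell μ t - ell μ s) + θ * -ell μ s) * M := by gcongr; exact hM s
        _ = K * M * Real.exp (-α * (ell μ t - ell μ s) + θ * -ell μ s) := by ring
        _ = _ := by congr 2; ring
    have hlim : Tendsto (fun s => K * M * Real.exp (-α * ell μ t + (α - θ) * ell μ s)) atBot
        (𝓝 0) := by
      rw [← mul_zero (K * M)]
      refine (Real.tendsto_exp_atBot.comp ?_).const_mul _
      exact tendsto_atBot_add_const_left _ _
        ((tendsto_ell_atBot c.rate).const_mul_atBot (by linarith))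
    exact norm_le_zero_iff.1 (ge_of_tendsto hlim hb)
  -- the unstable part, going to `+∞`
  have h2 : Q P t (d t) = 0 := by
    have hb : ∀ᶠ s in atTop, ‖Q P t (d t)‖ ≤
        K * M * Real.exp (β * ell μ t + (-(β - ν)) * ell μ s) := by
      filter_upwards [eventually_ge_atTop t, eventually_ge_atTop (0 : ℝ)] with s hs hs0
      have e0 : 0 ≤ ell μ s := by have := ell_mono c.rate hs0; rwa [ell_zero c.rate] at this
      rw [← W_self c.adm c.dich, ← W_T c.adm c.dich hs, hT t s hs]
      refine (norm_W_le c.dich c.rate hs _).trans ?_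
      rw [abs_of_nonneg e0]
      calc _ ≤ K * Real.exp (-β * (ell μ s - ell μ t) + ν * ell μ s) * M := by gcongr; exact hM s
        _ = K * M * Real.exp (-β * (ell μ s - ell μ t) + ν * ell μ s) := by ring
        _ = _ := by congr 2; ring
    have hlim : Tendsto (fun s => K * M * Real.exp (β * ell μ t + (-(β - ν)) * ell μ s)) atTop
        (𝓝 0) := by
      rw [← mul_zero (K * M)]
      refine (Real.tendsto_exp_atBot.comp ?_).const_mul _
      exact tendsto_atBot_add_const_left _ _
        ((tendsto_ell_atTop c.rate).const_mul_atTop_of_neg (by linarith))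
    exact norm_le_zero_iff.1 (ge_of_tendsto hlim hb)
  rw [Q_apply, h1, sub_zero] at h2
  exact h2

/-- Uniqueness of bounded solutions: a bounded solution on `ℝ` of the forced equation is given by
`green`, if the latter is bounded. -/
theorem Ctx.eq_greenC_of_bounded {f : ℝ → E n} (hf : Dom μ α β ϑ f) {x : ℝ → E n}
    (hx : ∀ s, LinSol L f s x) {b : ℝ → C r n} (hb : ∀ s t, s ≤ t → T L t s (b s) = b t) {M M' : ℝ}
    (hM : ∀ t, ‖sg r x t - b t‖ ≤ M) (hM' : ∀ t, ‖greenC c.adm P f t‖ ≤ M') (t : ℝ) :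
    sg r x t - b t = greenC c.adm P f t := by
  have := c.eq_zero_of_bounded (d := fun t => sg r x t - greenC c.adm P f t - b t)
    (fun s t hst => by
      rw [T_sub c.adm hst, hb s t hst]
      congr 1
      exact (hx s).T_sub_eq c.adm (hf.locallyIntegrable c.rate) (c.linSol_greenSol hf s) hst)
    (M := M + M') (fun t => by
      rw [sub_right_comm]
      exact (norm_sub_le _ _).trans (add_le_add (hM t) (hM' t))) t
  rw [sub_right_comm] at this
  exact sub_eq_zero.1 this

end Green

/-! ### The unstable subspaces are finite-dimensional -/

section FiniteDim

variable {r : ℝ} {n : ℕ} {L : ℝ → C r n →L[ℝ] E n} {m μ : ℝ → ℝ} {K α β θ ν : ℝ}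
  {P : ℝ → C r n →L[ℝ] C r n}

/-- Bounded subsets of `C` with a common modulus of continuity are relatively compact. -/
theorem isCompact_of_modulus (B : ℝ) {Ψ : I r → ℝ} (hΨ : Continuous Ψ) :
    IsCompact {φ : C r n | (∀ ω, ‖φ ω‖ ≤ B) ∧ ∀ ω ω', ‖φ ω - φ ω'‖ ≤ |Ψ ω - Ψ ω'|} := by
  let A : Set (BoundedContinuousFunction (I r) (E n)) :=
    {φ | (∀ ω, ‖φ ω‖ ≤ B) ∧ ∀ ω ω', ‖φ ω - φ ω'‖ ≤ |Ψ ω - Ψ ω'|}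
  have hA : IsCompact A := by
    refine BoundedContinuousFunction.arzela_ascoli₂ (Metric.closedBall 0 B)
      (isCompact_closedBall _ _) A ?_ (fun f x hf => by simpa using hf.1 x) ?_
    · have e : A = (⋂ ω, {φ | ‖φ ω‖ ≤ B}) ∩ ⋂ ω, ⋂ ω', {φ | ‖φ ω - φ ω'‖ ≤ |Ψ ω - Ψ ω'|} := by
        ext φ
        simp only [A, mem_ofPred_eq, mem_inter_iff, mem_iInter]
      rw [e]
      refine (isClosed_iInter fun ω => ?_).inter (isClosed_iInter fun ω => isClosed_iInter fun ω' => ?_)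
      · exact isClosed_le (by fun_prop) continuous_const
      · exact isClosed_le (by fun_prop) continuous_const
    · intro ω₀
      rw [Metric.equicontinuousAt_iff]
      intro ε hε
      have h1 := Metric.tendsto_nhds.1 (hΨ.tendsto ω₀) ε hε
      obtain ⟨η, hη, h2⟩ := Metric.eventually_nhds_iff.1 h1
      refine ⟨η, hη, fun ω hω φ => ?_⟩
      rw [dist_comm, dist_eq_norm]
      refine (φ.2.2 ω ω₀).trans_lt ?_
      have := h2 hω
      rwa [Real.dist_eq] at this
  have h3 := hA.image (ContinuousMap.isometryEquivBoundedOfCompact (I r) (E n)).symm.continuous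
  have e : {φ : C r n | (∀ ω, ‖φ ω‖ ≤ B) ∧ ∀ ω ω', ‖φ ω - φ ω'‖ ≤ |Ψ ω - Ψ ω'|} =
      (ContinuousMap.isometryEquivBoundedOfCompact (I r) (E n)).symm '' A := by
    ext φ
    constructor
    · intro hφ
      exact ⟨ContinuousMap.isometryEquivBoundedOfCompact (I r) (E n) φ, hφ,
        (ContinuousMap.isometryEquivBoundedOfCompact (I r) (E n)).symm_apply_apply φ⟩
    · rintro ⟨ψ, hψ, rfl⟩
      exact hψ
  rw [e]
  exact h3

/-- `T(t, t - r)` is a compact operator. -/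
theorem isCompact_closure_T (h : Adm L m) (t R : ℝ) :
    ∃ S : Set (C r n), IsCompact S ∧ ∀ φ : C r n, ‖φ‖ ≤ R → T L t (t - r) φ ∈ S := by
  have hr := h.pos
  set B := 2 * R * Real.exp (2 * Lam m (t - r) t) with hB
  set Ψ : I r → ℝ := fun ω => B * ∫ u in (t - r)..(t + ω), m u with hΨ
  have hΨc : Continuous Ψ := by
    have := intervalIntegral.continuous_primitive (fun a b => locInt_interval h.int a b) (t - r)
    exact continuous_const.mul (this.comp (by fun_prop))
  refine ⟨_, isCompact_of_modulus B hΨc, fun φ hφ => ?_⟩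
  have hR : 0 ≤ R := (norm_nonneg φ).trans hφ
  have hB0 : 0 ≤ B := by positivity
  have hsg : ∀ u ≤ t, ‖sg r (lsol h (t - r) φ) u‖ ≤ B := fun u hu => by
    refine (norm_sg_lsol_le h (t - r) φ u).trans ?_
    rw [hB]
    gcongr
    exact Lam_mono h.int h.nonneg _ hu
  rw [T_eq_sg h (by linarith)]
  have key : ∀ ω ω' : I r, (ω : ℝ) ≤ ω' →
      ‖sg r (lsol h (t - r) φ) t ω - sg r (lsol h (t - r) φ) t ω'‖ ≤ |Ψ ω - Ψ ω'| := by
    intro ω ω' hωω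
    have hω := ω.2.1
    have hω' := ω'.2.2
    have hxi := h.locallyIntegrable (continuous_lsol h (t - r) φ)
    have hmi := fun a b => locInt_interval h.int a b
    have e1 : sg r (lsol h (t - r) φ) t ω' - sg r (lsol h (t - r) φ) t ω =
        ∫ u in (t + ω)..(t + ω'), L u (sg r (lsol h (t - r) φ) u) := by
      rw [sg_apply (continuous_lsol h _ _), sg_apply (continuous_lsol h _ _),
        lsol_eqn h (by linarith), lsol_eqn h (by linarith), add_sub_add_left_eq_sub,
        intervalIntegral.integral_interval_sub_left (locInt_interval hxi _ _)
          (locInt_interval hxi _ _)]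
    have e2 : Ψ ω' - Ψ ω = ∫ u in (t + ω)..(t + ω'), m u * B := by
      rw [hΨ, ← mul_sub, intervalIntegral.integral_interval_sub_left (hmi _ _) (hmi _ _),
        intervalIntegral.integral_mul_const, mul_comm]
    rw [norm_sub_rev, e1, abs_sub_comm, e2]
    refine (intervalIntegral.norm_integral_le_of_norm_le (by linarith)
      (Eventually.of_forall fun u hu => ?_) ((hmi _ _).mul_const _)).trans (le_abs_self _)
    exact (L u).le_of_opNorm_le_of_le (h.le u) (hsg u (by linarith [hu.2]))
  refine ⟨fun ω => (norm_apply_le _ _).trans (hsg t le_rfl), fun ω ω' => ?_⟩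
  rcases le_total (ω : ℝ) ω' with h1 | h1
  · exact key ω ω' h1
  · rw [norm_sub_rev, abs_sub_comm]
    exact key ω' ω h1

/-- The bounded operator `T̄(t, s) Q(s)`. -/
noncomputable def WL (h : Adm L m) (hd : HasMuDichotomy L μ K α β θ ν P)
    (hμ : IsDiffGrowthRate μ) (t s : ℝ) : C r n →L[ℝ] C r n :=
  ⟨{ toFun := W L P t s
     map_add' := W_add h hd t s
     map_smul' := W_smul h hd t s },
   (continuous_W h hd hμ).comp (f := fun φ : C r n => (t, s, φ)) (by fun_prop)⟩

theorem isClosed_U (hd : HasMuDichotomy L μ K α β θ ν P) (t : ℝ) :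
    IsClosed (U P t : Set (C r n)) := by
  have : (U P t : Set (C r n)) = {φ | P t φ = 0} := by
    ext φ
    refine ⟨fun hφ => P_of_mem_U hd hφ, fun hφ => ?_⟩
    have : Q P t φ = φ := by rw [Q_apply, show P t φ = 0 from hφ, sub_zero]
    rw [← this]
    exact Q_mem_U P t φ
  rw [this]
  exact isClosed_eq (P t).continuous continuous_const

/-- The unit ball of `U(t)` is contained in the image of a bounded set under the compact operator
`T(t, t - r)`, because `T̄(t - r, t)` is bounded. -/
theorem finiteDimensional_U (h : Adm L m) (hd : HasMuDichotomy L μ K α β θ ν P)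
    (hμ : IsDiffGrowthRate μ) (t : ℝ) : FiniteDimensional ℝ (U P t) := by
  obtain ⟨S, hS, hTS⟩ := isCompact_closure_T h t (‖WL h hd hμ (t - r) t‖ * 1)
  refine FiniteDimensional.of_isCompact_closedBall₀ ℝ (one_pos) ?_
  rw [Subtype.isCompact_iff]
  have hcl : IsClosed ((Subtype.val : U P t → C r n) '' Metric.closedBall 0 1) :=
    (isClosed_U hd t).isClosedEmbedding_subtypeVal.isClosedMap _ Metric.isClosed_closedBall
  refine hS.of_isClosed_subset hcl ?_
  rintro _ ⟨b, hb, rfl⟩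
  have hb1 : ‖(b : C r n)‖ ≤ 1 := by simpa using hb
  have e : (b : C r n) = T L t (t - r) (W L P (t - r) t b) := by
    rw [T_W_eq h hd (by linarith [h.pos]), W_self h hd, Q_of_mem_U hd b.2]
  rw [e]
  exact hTS _ ((WL h hd hμ (t - r) t).le_of_opNorm_le_of_le le_rfl hb1)

end FiniteDim

/-! ### Two-sided exponential kernels -/

section Kernel

variable {μ : ℝ → ℝ} (hμ : IsDiffGrowthRate μ)

/-- The kernel `A e^{-a(ℓ(t) - ℓ(τ))} ℓ'(τ)` for `τ ≤ t`, and `B e^{-b(ℓ(τ) - ℓ(t))} ℓ'(τ)` for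
`τ > t`. -/
noncomputable def expKer (μ : ℝ → ℝ) (A B a b t τ : ℝ) : ℝ :=
  if τ ≤ t then A * (Real.exp (-a * (ell μ t - ell μ τ)) * deriv (ell μ) τ)
  else B * (Real.exp (-b * (ell μ τ - ell μ t)) * deriv (ell μ) τ)

include hμ

theorem expKer_nonneg {A B : ℝ} (hA : 0 ≤ A) (hB : 0 ≤ B) (a b t τ : ℝ) :
    0 ≤ expKer μ A B a b t τ := by
  have := deriv_ell_nonneg hμ τ
  unfold expKer
  split_ifs <;> positivity

theorem integrableOn_expKer_left {a : ℝ} (ha : 0 < a) (t : ℝ) :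
    IntegrableOn (fun τ => Real.exp (-a * (ell μ t - ell μ τ)) * deriv (ell μ) τ) (Iic t) volume ∧
    ∫ τ in Iic t, Real.exp (-a * (ell μ t - ell μ τ)) * deriv (ell μ) τ = 1 / a := by
  set G : ℝ → ℝ := fun τ => Real.exp (-a * (ell μ t - ell μ τ)) / a with hG
  have hGd : ∀ τ, HasDerivAt G (Real.exp (-a * (ell μ t - ell μ τ)) * deriv (ell μ) τ) τ := by
    intro τ
    have h1 := ((((hasDerivAt_ell' hμ τ).const_sub (ell μ t)).const_mul (-a)).exp).div_const a
    refine h1.congr_deriv ?_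
    field_simp
  have hlim : Tendsto G atBot (𝓝 0) := by
    rw [← zero_div a]
    refine (Real.tendsto_exp_atBot.comp ?_).div_const a
    have h2 : Tendsto (fun τ => ell μ t - ell μ τ) atBot atTop :=
      tendsto_atTop_add_const_left _ _ (tendsto_neg_atBot_atTop.comp (tendsto_ell_atBot hμ))
    exact h2.const_mul_atTop_of_neg (by linarith)
  have hi : IntegrableOn (fun τ => Real.exp (-a * (ell μ t - ell μ τ)) * deriv (ell μ) τ) (Iic t)
      volume := by
    have h3 : IntegrableOn (fun τ => -(Real.exp (-a * (ell μ t - ell μ (-τ))) *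
        deriv (ell μ) (-τ))) (Ioi (-t)) volume := by
      refine integrableOn_Ioi_deriv_of_nonpos' (g := fun τ => G (-τ)) (fun τ _ => ?_)
        (fun τ _ => ?_) (hlim.comp tendsto_neg_atTop_atBot)
      · have := (hGd (-τ)).comp τ (hasDerivAt_neg τ)
        rwa [mul_neg_one] at this
      · have := deriv_ell_nonneg hμ (-τ)
        exact neg_nonpos.2 (by positivity)
    have h4 : IntegrableOn (fun τ => Real.exp (-a * (ell μ t - ell μ (-τ))) *
        deriv (ell μ) (-τ)) (Ioi (-t)) volume := by
      have := h3.neg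
      simpa only [Pi.neg_def, neg_neg] using this
    rw [← integrableOn_Ici_iff_integrableOn_Ioi] at h4
    have h5 := (Measure.measurePreserving_neg (volume : Measure ℝ)).integrableOn_comp_preimage
      (MeasurableEquiv.neg ℝ).measurableEmbedding (s := Iic t)
      (f := fun τ => Real.exp (-a * (ell μ t - ell μ τ)) * deriv (ell μ) τ)
    rw [← h5]
    rw [show Neg.neg ⁻¹' Iic t = Ici (-t) by ext x; simp]
    exact h4
  refine ⟨hi, ?_⟩
  rw [integral_Iic_of_hasDerivAt_of_tendsto' (fun τ _ => hGd τ) hi hlim, hG]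
  simp

theorem integrableOn_expKer_right {b : ℝ} (hb : 0 < b) (t : ℝ) :
    IntegrableOn (fun τ => Real.exp (-b * (ell μ τ - ell μ t)) * deriv (ell μ) τ) (Ioi t) volume ∧
    ∫ τ in Ioi t, Real.exp (-b * (ell μ τ - ell μ t)) * deriv (ell μ) τ = 1 / b := by
  set G : ℝ → ℝ := fun τ => -(Real.exp (-b * (ell μ τ - ell μ t)) / b) with hG
  have hGd : ∀ τ, HasDerivAt G (Real.exp (-b * (ell μ τ - ell μ t)) * deriv (ell μ) τ) τ := by
    intro τ
    have h1 := (((((hasDerivAt_ell' hμ τ).sub_const (ell μ t)).const_mul (-b)).exp).div_const b).neg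
    refine h1.congr_deriv ?_
    field_simp
  have hlim : Tendsto G atTop (𝓝 0) := by
    rw [show (0 : ℝ) = -(0 / b) by simp]
    refine ((Real.tendsto_exp_atBot.comp ?_).div_const b).neg
    have h2 : Tendsto (fun τ => ell μ τ - ell μ t) atTop atTop :=
      tendsto_atTop_add_const_right _ _ (tendsto_ell_atTop hμ)
    exact h2.const_mul_atTop_of_neg (by linarith)
  have hpos : ∀ τ ∈ Ioi t, 0 ≤ Real.exp (-b * (ell μ τ - ell μ t)) * deriv (ell μ) τ := by
    intro τ _
    have := deriv_ell_nonneg hμ τ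
    positivity
  refine ⟨integrableOn_Ioi_deriv_of_nonneg' (fun τ _ => hGd τ) hpos hlim, ?_⟩
  rw [integral_Ioi_of_hasDerivAt_of_nonneg' (fun τ _ => hGd τ) hpos hlim, hG]
  simp

/-- The substitution `u = ℓ(τ)` evaluates both halves of the kernel: its integral is `A/a + B/b`. -/
theorem integrable_expKer (A B : ℝ) {a b : ℝ} (ha : 0 < a) (hb : 0 < b) (t : ℝ) :
    Integrable (expKer μ A B a b t) volume ∧ ∫ τ, expKer μ A B a b t τ = A / a + B / b := by
  obtain ⟨h1, h2⟩ := integrableOn_expKer_left hμ ha t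
  obtain ⟨h3, h4⟩ := integrableOn_expKer_right hμ hb t
  have e1 : EqOn (expKer μ A B a b t)
      (fun τ => A * (Real.exp (-a * (ell μ t - ell μ τ)) * deriv (ell μ) τ)) (Iic t) :=
    fun τ hτ => if_pos hτ
  have e2 : EqOn (expKer μ A B a b t)
      (fun τ => B * (Real.exp (-b * (ell μ τ - ell μ t)) * deriv (ell μ) τ)) (Ioi t) :=
    fun τ hτ => if_neg (not_le.2 hτ)
  have i1 : IntegrableOn (expKer μ A B a b t) (Iic t) volume :=
    IntegrableOn.congr_fun (h1.const_mul A) e1.symm measurableSet_Iic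
  have i2 : IntegrableOn (expKer μ A B a b t) (Ioi t) volume :=
    IntegrableOn.congr_fun (h3.const_mul B) e2.symm measurableSet_Ioi
  have hi : Integrable (expKer μ A B a b t) volume := by
    rw [← integrableOn_univ, ← Iic_union_Ioi (a := t)]
    exact i1.union i2
  refine ⟨hi, ?_⟩
  rw [← integral_add_compl measurableSet_Iic hi, compl_Iic, setIntegral_congr_fun measurableSet_Iic e1,
    setIntegral_congr_fun measurableSet_Ioi e2, integral_const_mul, integral_const_mul, h2, h4]
  ring

end Kernel

/-! ### The operator `F` -/

section Perturbation

variable {r : ℝ} {n : ℕ} {L : ℝ → C r n →L[ℝ] E n} {m μ : ℝ → ℝ}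
  {K α β θ ν D Kt a ε ξ γ δ lam : ℝ} {P : ℝ → C r n →L[ℝ] C r n} {g : ℝ → C r n → E n}

/-- The standing data for the perturbed equation, with all weights in exponential form. -/
structure Pert (L : ℝ → C r n →L[ℝ] E n) (m μ : ℝ → ℝ) (K α β θ ν D : ℝ)
    (P : ℝ → C r n →L[ℝ] C r n) (g : ℝ → C r n → E n) (Kt a ε ξ γ δ lam : ℝ) : Prop where
  ctx : Ctx L m μ K α β θ ν D (θ + ε) P
  eps_pos : 0 < ε
  delta_nonneg : 0 ≤ δ
  lam_nonneg : 0 ≤ lam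
  Kt_nonneg : 0 ≤ Kt
  theta_le : θ ≤ γ
  nu_lt : ν + ε < ξ
  abs_lt : |a - β| + ε < ξ
  growth : ∀ s t, s ≤ t → ∀ φ,
    ‖T L t s φ‖ ≤ Kt * Real.exp (a * (ell μ t - ell μ s) + ε * |ell μ s|) * ‖φ‖
  g_zero : ∀ t, g t 0 = 0
  g_smooth : ContDiff ℝ 1 (fun p : ℝ × C r n => g p.1 p.2)
  dg_zero : ∀ t, fderiv ℝ (g t) 0 = 0
  g_lip : ∀ t φ ψ, ‖g t φ - g t ψ‖ ≤ δ * min 1 (‖φ - ψ‖ * Real.exp (-((ξ + ε) * |ell μ t|))) *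
    (deriv (ell μ) t * Real.exp (-((γ + ε) * |ell μ t|)))
  dg_lip : ∀ t φ ψ, ‖fderiv ℝ (g t) φ - fderiv ℝ (g t) ψ‖ ≤
    lam * min 1 (‖φ - ψ‖ * Real.exp (-((ξ + ε) * |ell μ t|))) *
      (deriv (ell μ) t * Real.exp (-((γ + ε + 2 * ξ) * |ell μ t|)))

/-- The forcing term `τ ↦ g(τ, h^τ(T̄(τ, t) b))`. -/
noncomputable def forcing (L : ℝ → C r n →L[ℝ] E n) (P : ℝ → C r n →L[ℝ] C r n)
    (g : ℝ → C r n → E n) (η : Fam P) (t : ℝ) (b : U P t) (τ : ℝ) : E n :=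
  g τ (hmap η τ (Tbar L P τ t b))

/-- `F(η)` as a family of elements of `C`. -/
noncomputable def Fop (h : Adm L m) (P : ℝ → C r n →L[ℝ] C r n) (g : ℝ → C r n → E n)
    (η : Fam P) : Fam P := fun t b => greenC h P (forcing L P g η t b) t

variable (p : Pert L m μ K α β θ ν D P g Kt a ε ξ γ δ lam)
include p

theorem Pert.weight_nonneg (c τ : ℝ) : 0 ≤ deriv (ell μ) τ * Real.exp (-(c * |ell μ τ|)) :=
  mul_nonneg (deriv_ell_nonneg p.ctx.rate τ) (Real.exp_pos _).le

theorem Pert.continuous_g : Continuous (fun q : ℝ × C r n => g q.1 q.2) := p.g_smooth.continuous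

theorem Pert.contDiff_g (t : ℝ) : ContDiff ℝ 1 (g t) :=
  p.g_smooth.comp (contDiff_const.prodMk contDiff_id : ContDiff ℝ 1 fun φ : C r n => (t, φ))

theorem Pert.hasFDerivAt_g (t : ℝ) (φ : C r n) : HasFDerivAt (g t) (fderiv ℝ (g t) φ) φ :=
  ((p.contDiff_g t).differentiable one_ne_zero φ).hasFDerivAt

theorem Pert.continuous_dg (t : ℝ) : Continuous (fderiv ℝ (g t)) :=
  (p.contDiff_g t).continuous_fderiv one_ne_zero

theorem Pert.norm_g_sub_le (t : ℝ) (φ ψ : C r n) : ‖g t φ - g t ψ‖ ≤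
    δ * (deriv (ell μ) t * Real.exp (-((γ + ε) * |ell μ t|))) := by
  have := p.delta_nonneg
  have := p.weight_nonneg (γ + ε) t
  refine (p.g_lip t φ ψ).trans ?_
  gcongr
  exact mul_le_of_le_one_right ‹_› (min_le_left _ _)

theorem Pert.norm_g_le (t : ℝ) (φ : C r n) : ‖g t φ‖ ≤
    δ * (deriv (ell μ) t * Real.exp (-((γ + ε) * |ell μ t|))) := by
  have := p.norm_g_sub_le t φ 0
  rwa [p.g_zero, sub_zero] at this

theorem Pert.norm_dg_le (t : ℝ) (φ : C r n) : ‖fderiv ℝ (g t) φ‖ ≤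
    lam * (deriv (ell μ) t * Real.exp (-((γ + ε + 2 * ξ) * |ell μ t|))) := by
  have := p.lam_nonneg
  have := p.weight_nonneg (γ + ε + 2 * ξ) t
  have h1 := p.dg_lip t φ 0
  rw [p.dg_zero, sub_zero] at h1
  refine h1.trans ?_
  gcongr
  exact mul_le_of_le_one_right ‹_› (min_le_left _ _)

/-- The decay `e^{-(γ+ε)|ℓ(τ)|}` of `g`, with `γ ≥ θ`, outweighs the nonuniformity of the dichotomy. -/
theorem Pert.ker_mul_le (t τ : ℝ) : ker μ α β (θ + ε) t τ *
    (deriv (ell μ) τ * Real.exp (-((γ + ε) * |ell μ τ|))) ≤ expKer μ 1 1 α β t τ := by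
  have h0 := deriv_ell_nonneg p.ctx.rate τ
  have h1 : (θ + ε) * |ell μ τ| ≤ (γ + ε) * |ell μ τ| := by
    have := p.theta_le; gcongr
  unfold expKer
  split_ifs with h
  · rw [ker_of_le h, mul_left_comm, ← Real.exp_add, one_mul, mul_comm]
    gcongr
    linarith
  · rw [ker_of_ge (not_le.1 h).le, mul_left_comm, ← Real.exp_add, one_mul, mul_comm]
    gcongr
    linarith

/-- Forcing terms with the decay of `g` are integrable against the kernel, uniformly in `t`. -/
theorem Pert.dom_of_le {f : ℝ → E n} (hf : AEStronglyMeasurable f volume) {M : ℝ} (hM : 0 ≤ M)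
    (hb : ∀ τ, ‖f τ‖ ≤ M * (deriv (ell μ) τ * Real.exp (-((γ + ε) * |ell μ τ|)))) :
    Dom μ α β (θ + ε) f ∧
      ∀ t, ∫ τ, ker μ α β (θ + ε) t τ * ‖f τ‖ ≤ M * (1 / α + 1 / β) := by
  have hle : ∀ t τ, ker μ α β (θ + ε) t τ * ‖f τ‖ ≤ M * expKer μ 1 1 α β t τ := fun t τ => by
    have hk := ker_pos (μ := μ) (α := α) (β := β) (ϑ := θ + ε) t τ
    calc _ ≤ ker μ α β (θ + ε) t τ *
          (M * (deriv (ell μ) τ * Real.exp (-((γ + ε) * |ell μ τ|)))) := by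
          gcongr
          exact hb τ
      _ = M * (ker μ α β (θ + ε) t τ *
          (deriv (ell μ) τ * Real.exp (-((γ + ε) * |ell μ τ|)))) := by ring
      _ ≤ _ := by gcongr; exact p.ker_mul_le t τ
  have hd : Dom μ α β (θ + ε) f := by
    refine ⟨hf, fun t => ((integrable_expKer p.ctx.rate 1 1 p.ctx.dich.alpha_pos
      p.ctx.dich.beta_pos t).1.const_mul M).mono'
      ((measurable_ker p.ctx.rate t).aestronglyMeasurable.mul hf.norm)
      (Eventually.of_forall fun τ => ?_)⟩
    rw [Real.norm_of_nonneg (mul_nonneg (ker_pos t τ).le (norm_nonneg _))]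
    exact hle t τ
  refine ⟨hd, fun t => ?_⟩
  obtain ⟨h1, h2⟩ := integrable_expKer p.ctx.rate 1 1 p.ctx.dich.alpha_pos p.ctx.dich.beta_pos t
  rw [← h2, ← integral_const_mul]
  exact integral_mono (hd.int t) (h1.const_mul M) fun τ => hle t τ

theorem Pert.continuous_forcing_uncurry {η : Fam P} (hη : JointContinuous η) :
    Continuous (fun q : {p : ℝ × C r n // p.2 ∈ U P p.1} × ℝ =>
      forcing L P g η q.1.1.1 ⟨q.1.1.2, q.1.2⟩ q.2) := by
  have hW := continuous_W p.ctx.adm p.ctx.dich p.ctx.rate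
  have h1 : Continuous (fun q : {p : ℝ × C r n // p.2 ∈ U P p.1} × ℝ =>
      (Tbar L P q.2 q.1.1.1 ⟨q.1.1.2, q.1.2⟩ : C r n)) := by
    have : ∀ q : {p : ℝ × C r n // p.2 ∈ U P p.1} × ℝ,
        (Tbar L P q.2 q.1.1.1 ⟨q.1.1.2, q.1.2⟩ : C r n) = W L P q.2 q.1.1.1 q.1.1.2 := fun q =>
      (W_coe p.ctx.dich ⟨q.1.1.2, q.1.2⟩).symm
    simp_rw [this]
    exact hW.comp (f := fun q : {p : ℝ × C r n // p.2 ∈ U P p.1} × ℝ =>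
      (q.2, q.1.1.1, q.1.1.2)) (by fun_prop)
  have h2 : Continuous (fun q : {p : ℝ × C r n // p.2 ∈ U P p.1} × ℝ =>
      (⟨(q.2, (Tbar L P q.2 q.1.1.1 ⟨q.1.1.2, q.1.2⟩ : C r n)),
        (Tbar L P q.2 q.1.1.1 ⟨q.1.1.2, q.1.2⟩).2⟩ : {p : ℝ × C r n // p.2 ∈ U P p.1})) :=
    (continuous_snd.prodMk h1).subtype_mk _
  exact p.continuous_g.comp (continuous_snd.prodMk (h1.add (hη.comp h2)))

theorem Pert.continuous_forcing {η : Fam P} (hη : JointContinuous η) (t : ℝ) (b : U P t) :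
    Continuous (forcing L P g η t b) :=
  (p.continuous_forcing_uncurry hη).comp (f := fun τ : ℝ =>
    ((⟨(t, (b : C r n)), b.2⟩ : {p : ℝ × C r n // p.2 ∈ U P p.1}), τ)) (by fun_prop)

theorem Pert.dom_forcing {η : Fam P} (hη : JointContinuous η) (t : ℝ) (b : U P t) :
    Dom μ α β (θ + ε) (forcing L P g η t b) :=
  (p.dom_of_le (p.continuous_forcing hη t b).aestronglyMeasurable p.delta_nonneg fun τ =>
    p.norm_g_le τ _).1

theorem Pert.norm_Fop_le {η : Fam P} (hη : JointContinuous η) (t : ℝ) (b : U P t) :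
    ‖Fop p.ctx.adm P g η t b‖ ≤ D * (δ * (1 / α + 1 / β)) := by
  refine (p.ctx.norm_greenC_le (p.dom_forcing hη t b) t).trans ?_
  have := p.ctx.nonneg
  gcongr
  exact (p.dom_of_le (p.continuous_forcing hη t b).aestronglyMeasurable p.delta_nonneg fun τ =>
    p.norm_g_le τ _).2 t

/-- A weighted bound of `η - η'` is enough for an unweighted bound of the difference of the forcing
terms. -/
theorem Pert.norm_forcing_sub_le {η η' : Fam P} {M : ℝ}
    (hM : ∀ t b, ‖η t b - η' t b‖ ≤ M * Real.exp ((ξ + ε) * |ell μ t|)) (t : ℝ) (b : U P t)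
    (τ : ℝ) : ‖forcing L P g η t b τ - forcing L P g η' t b τ‖ ≤
      (δ * M) * (deriv (ell μ) τ * Real.exp (-((γ + ε) * |ell μ τ|))) := by
  refine (p.g_lip τ _ _).trans ?_
  have := p.delta_nonneg
  have := p.weight_nonneg (γ + ε) τ
  gcongr
  refine (min_le_right _ _).trans ?_
  rw [hmap, hmap, add_sub_add_left_eq_sub, Real.exp_neg, ← div_eq_mul_inv, div_le_iff₀ (Real.exp_pos _)]
  exact hM τ _

/-- `F` is Lipschitz continuous for the weighted supremum norm. -/
theorem Pert.norm_Fop_sub_le {η η' : Fam P} (hη : JointContinuous η) (hη' : JointContinuous η')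
    {M : ℝ} (hM0 : 0 ≤ M) (hM : ∀ t b, ‖η t b - η' t b‖ ≤ M * Real.exp ((ξ + ε) * |ell μ t|))
    (t : ℝ) (b : U P t) : ‖Fop p.ctx.adm P g η t b - Fop p.ctx.adm P g η' t b‖ ≤
      D * (δ * (1 / α + 1 / β)) * M := by
  have hm := ((p.continuous_forcing hη t b).sub (p.continuous_forcing hη' t b)).aestronglyMeasurable
    (μ := volume)
  have hd := p.dom_of_le hm (mul_nonneg p.delta_nonneg hM0) (p.norm_forcing_sub_le hM t b)
  unfold Fop
  rw [← p.ctx.greenC_sub (p.dom_forcing hη t b) (p.dom_forcing hη' t b)]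
  refine (p.ctx.norm_greenC_le hd.1 t).trans ?_
  have := p.ctx.nonneg
  calc _ ≤ D * (δ * M * (1 / α + 1 / β)) := by gcongr; exact hd.2 t
    _ = _ := by ring

theorem Pert.stableIntegrand_eq (η : Fam P) (t : ℝ) (b : U P t) (ω : I r) :
    EqOn (stableIntegrand L P g η t b ω)
      (fun τ => stab p.ctx.adm P t τ (forcing L P g η t b τ) ω) (Iic t) := fun _ hτ =>
  T0_P0 p.ctx.adm p.ctx.dich hτ _ ω

theorem Pert.unstableIntegrand_eq (η : Fam P) (t : ℝ) (b : U P t) (ω : I r) :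
    unstableIntegrand L P g η t b ω =
      fun τ => unst p.ctx.adm P t τ (forcing L P g η t b τ) ω := by
  funext τ
  unfold unstableIntegrand
  rw [Tbar_Q0 p.ctx.adm p.ctx.dich]
  rfl

theorem Pert.fConverges {η : Fam P} (hη : JointContinuous η) : FConverges L P g η := by
  intro t b ω
  have hf := p.dom_forcing hη t b
  refine ⟨(p.ctx.integrableOn_stab hf t ω).congr_fun (p.stableIntegrand_eq η t b ω).symm
    measurableSet_Iic, ?_⟩
  rw [p.unstableIntegrand_eq]
  exact p.ctx.integrableOn_unst_apply hf t ω

theorem Pert.F_eq {η : Fam P} (hη : JointContinuous η) (t : ℝ) (b : U P t) (ω : I r) :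
    F L P g η t b ω = Fop p.ctx.adm P g η t b ω := by
  rw [Fop, p.ctx.greenC_apply (p.dom_forcing hη t b), green, F,
    setIntegral_congr_fun measurableSet_Iic (p.stableIntegrand_eq η t b ω),
    p.unstableIntegrand_eq]

theorem Pert.isFixedPoint_iff {η : Fam P} (hη : JointContinuous η) :
    IsFixedPoint L P g η ↔ Fop p.ctx.adm P g η = η := by
  constructor
  · intro h
    funext t b
    refine DFunLike.ext _ _ fun ω => ?_
    rw [← p.F_eq hη]
    exact h t b ω
  · intro h t b ω
    rw [p.F_eq hη, h]

/-- `F(η)` is jointly continuous. Near `t₀` the kernel at `t` is comparable to the one at `t₀`, which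
separates the dependence of the Green operator on `t` from that on the forcing term; the latter is
dominated convergence. -/
theorem Pert.jointContinuous_Fop {η : Fam P} (hη : JointContinuous η) :
    JointContinuous (Fop p.ctx.adm P g η) := by
  have hα := p.ctx.dich.alpha_pos
  have hβ := p.ctx.dich.beta_pos
  have hδ := p.delta_nonneg
  have hell := continuous_ell p.ctx.rate
  have hu := p.continuous_forcing_uncurry hη
  unfold JointContinuous
  rw [continuous_iff_continuousAt]
  intro q₀
  set t₀ := q₀.1.1 with ht₀
  set f : {p : ℝ × C r n // p.2 ∈ U P p.1} → ℝ → E n :=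
    fun q => forcing L P g η q.1.1 ⟨q.1.2, q.2⟩ with hf
  have hfc : ∀ q, Continuous (f q) := fun q => p.continuous_forcing hη _ _
  have hfd : ∀ q, Dom μ α β (θ + ε) (f q) := fun q => p.dom_forcing hη _ _
  change Tendsto (fun q => greenC p.ctx.adm P (f q) q.1.1) (𝓝 q₀)
    (𝓝 (greenC p.ctx.adm P (f q₀) t₀))
  rw [tendsto_iff_norm_sub_tendsto_zero]
  -- the integral that controls the dependence on the forcing term
  have h1 : Tendsto (fun q => ∫ τ, ker μ α β (θ + ε) t₀ τ * ‖f q τ - f q₀ τ‖) (𝓝 q₀) (𝓝 0) := by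
    have h0 : (0 : ℝ) = ∫ τ, ker μ α β (θ + ε) t₀ τ * ‖f q₀ τ - f q₀ τ‖ := by simp
    rw [h0]
    refine tendsto_integral_filter_of_dominated_convergence (fun τ => δ * expKer μ 1 1 α β t₀ τ)
      (Eventually.of_forall fun q => ?_) (Eventually.of_forall fun q =>
        Eventually.of_forall fun τ => ?_)
      ((integrable_expKer p.ctx.rate 1 1 hα hβ t₀).1.const_mul δ)
      (Eventually.of_forall fun τ => ?_)
    · exact (measurable_ker p.ctx.rate t₀).aestronglyMeasurable.mul
        ((hfc q).sub (hfc q₀)).norm.aestronglyMeasurable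
    · rw [Real.norm_of_nonneg (mul_nonneg (ker_pos _ τ).le (norm_nonneg _))]
      have hk := ker_pos (μ := μ) (α := α) (β := β) (ϑ := θ + ε) t₀ τ
      calc _ ≤ ker μ α β (θ + ε) t₀ τ *
            (δ * (deriv (ell μ) τ * Real.exp (-((γ + ε) * |ell μ τ|)))) := by
            gcongr
            exact p.norm_g_sub_le τ _ _
        _ = δ * (ker μ α β (θ + ε) t₀ τ *
            (deriv (ell μ) τ * Real.exp (-((γ + ε) * |ell μ τ|)))) := by ring
        _ ≤ _ := by gcongr; exact p.ker_mul_le t₀ τ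
    · have h2 : Continuous fun q => f q τ :=
        hu.comp (f := fun q : {p : ℝ × C r n // p.2 ∈ U P p.1} => (q, τ)) (by fun_prop)
      exact (((h2.sub continuous_const).norm).const_mul _).tendsto q₀
  have h2 : Tendsto (fun q : {p : ℝ × C r n // p.2 ∈ U P p.1} =>
      D * (Real.exp ((α + β) * |ell μ q.1.1 - ell μ t₀|) *
        ∫ τ, ker μ α β (θ + ε) t₀ τ * ‖f q τ - f q₀ τ‖) +
      ‖greenC p.ctx.adm P (f q₀) q.1.1 - greenC p.ctx.adm P (f q₀) t₀‖) (𝓝 q₀)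
      (𝓝 (D * (Real.exp ((α + β) * |ell μ t₀ - ell μ t₀|) * 0) +
        ‖greenC p.ctx.adm P (f q₀) t₀ - greenC p.ctx.adm P (f q₀) t₀‖)) := by
    have hg := p.ctx.continuous_greenC (hfd q₀)
    have e1 : Continuous (fun q : {p : ℝ × C r n // p.2 ∈ U P p.1} =>
      Real.exp ((α + β) * |ell μ q.1.1 - ell μ t₀|)) := by fun_prop
    have e2 : Continuous (fun q : {p : ℝ × C r n // p.2 ∈ U P p.1} =>
      ‖greenC p.ctx.adm P (f q₀) q.1.1 - greenC p.ctx.adm P (f q₀) t₀‖) := by fun_prop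
    exact (((e1.tendsto q₀).mul h1).const_mul D).add (e2.tendsto q₀)
  rw [sub_self (greenC p.ctx.adm P (f q₀) t₀), norm_zero, mul_zero, mul_zero, add_zero] at h2
  refine squeeze_zero (fun _ => norm_nonneg _) (fun q => ?_) h2
  have hsub := (hfd q).sub p.ctx.rate (hfd q₀)
  calc ‖greenC p.ctx.adm P (f q) q.1.1 - greenC p.ctx.adm P (f q₀) t₀‖
      = ‖greenC p.ctx.adm P (fun τ => f q τ - f q₀ τ) q.1.1 +
          (greenC p.ctx.adm P (f q₀) q.1.1 - greenC p.ctx.adm P (f q₀) t₀)‖ := by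
        rw [p.ctx.greenC_sub (hfd q) (hfd q₀), sub_add_sub_cancel]
    _ ≤ _ := (norm_add_le _ _).trans (add_le_add ?_ le_rfl)
  refine (p.ctx.norm_greenC_le hsub q.1.1).trans ?_
  have := p.ctx.nonneg
  gcongr
  rw [← integral_const_mul]
  refine integral_mono (hsub.int _) ((hsub.int t₀).const_mul _) fun τ => ?_
  simp only
  rw [← mul_assoc]
  gcongr
  exact ker_le_mul_ker p.ctx.rate hα.le hβ.le _ _ _

end Perturbation

/-! ### Differentiability of `F(η)` -/

section Derivative

variable {r : ℝ} {n : ℕ} {L : ℝ → C r n →L[ℝ] E n} {m μ : ℝ → ℝ}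
  {K α β θ ν D Kt a ε ξ γ δ lam : ℝ} {P : ℝ → C r n →L[ℝ] C r n} {g : ℝ → C r n → E n}

/-- `T̄(τ, t)` as a bounded operator from `U(t)` to `U(τ)`. -/
noncomputable def TbarL (h : Adm L m) (hd : HasMuDichotomy L μ K α β θ ν P)
    (hμ : IsDiffGrowthRate μ) (τ t : ℝ) : U P t →L[ℝ] U P τ :=
  ((WL h hd hμ τ t).comp (U P t).subtypeL).codRestrict (U P τ) fun b => W_mem L P τ t b

theorem TbarL_apply (h : Adm L m) (hd : HasMuDichotomy L μ K α β θ ν P)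
    (hμ : IsDiffGrowthRate μ) (τ t : ℝ) (b : U P t) : TbarL h hd hμ τ t b = Tbar L P τ t b :=
  Subtype.ext (W_coe hd b)

/-- Families `η` that are continuous and `C¹` in `b`, with `‖∂η/∂b‖_μ ≤ N`. -/
structure Reg (P : ℝ → C r n →L[ℝ] C r n) (μ : ℝ → ℝ) (ξ ε N : ℝ) (η : Fam P) : Prop where
  cont : JointContinuous η
  smooth : ∀ t, ContDiff ℝ 1 (η t)
  nonneg : 0 ≤ N
  bound : ∀ t b, ‖fderiv ℝ (η t) b‖ ≤ N * Real.exp ((ξ + ε) * |ell μ t|)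

/-- The derivative of the forcing term with respect to `b`. -/
noncomputable def linForcing (h : Adm L m) (hd : HasMuDichotomy L μ K α β θ ν P)
    (hμ : IsDiffGrowthRate μ) (g : ℝ → C r n → E n) (η : Fam P) (t : ℝ) (b : U P t) (τ : ℝ) :
    U P t →L[ℝ] E n :=
  (fderiv ℝ (g τ) (hmap η τ (Tbar L P τ t b))).comp
    (((U P τ).subtypeL + fderiv ℝ (η τ) (Tbar L P τ t b)).comp (TbarL h hd hμ τ t))

theorem hasFDerivAt_hmap {η : Fam P} {N : ℝ} (hη : Reg P μ ξ ε N η) (t : ℝ) (b : U P t) :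
    HasFDerivAt (hmap η t) ((U P t).subtypeL + fderiv ℝ (η t) b) b :=
  (U P t).subtypeL.hasFDerivAt.add (((hη.smooth t).differentiable one_ne_zero b).hasFDerivAt)

variable (p : Pert L m μ K α β θ ν D P g Kt a ε ξ γ δ lam)
include p

theorem Pert.rate_pos : 0 < ξ - ε + β - a := by
  have := p.abs_lt
  have := le_abs_self (a - β)
  linarith

theorem Pert.eps_lt : ε < ξ := by
  have := p.nu_lt
  have := p.ctx.dich.nu_nonneg
  linarith

/-- The pointwise estimate behind the bound of the derivative of `F(η)`. For `τ ≤ t` the unstable bound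
gives `‖T̄(τ,t) x‖` the decay `e^{-β(ℓ(t) - ℓ(τ))}`, which adds to the decay rate `α` of the kernel. For
`τ > t` the growth bound gives the factor `e^{a(ℓ(τ) - ℓ(t))}`, which the decay rate `β` of the
kernel need not compensate; the missing decay comes from `e^{-(ξ-ε)|ℓ(τ)|} ≤ e^{-(ξ-ε)(ℓ(τ) - ℓ(t))} e^{(ξ-ε)|ℓ(t)|}`, and leaves the positive
rate `ξ - ε + β - a`. -/
theorem Pert.ker_mul_norm_W_le (t τ : ℝ) (x : U P t) : ker μ α β (θ + ε) t τ *
    (deriv (ell μ) τ * Real.exp (-((γ + ε + 2 * ξ) * |ell μ τ|)) *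
      (Real.exp ((ξ + ε) * |ell μ τ|) * ‖W L P τ t x‖)) ≤
    Real.exp ((ξ + ε) * |ell μ t|) * expKer μ K Kt (α + β) (ξ - ε + β - a) t τ * ‖x‖ := by
  have hK := p.ctx.dich.one_le_K
  have hKt := p.Kt_nonneg
  have hd := deriv_ell_nonneg p.ctx.rate τ
  have hεξ := p.eps_lt
  have hε := p.eps_pos
  have hx : ‖(x : C r n)‖ = ‖x‖ := rfl
  have h1 : (θ - γ + ε - ξ) * |ell μ τ| ≤ (ε - ξ) * |ell μ τ| := by
    have := p.theta_le; gcongr; linarith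
  have hu0 := abs_nonneg (ell μ t)
  have hv0 := abs_nonneg (ell μ τ)
  unfold expKer
  split_ifs with h
  · have h2 := norm_W_le p.ctx.dich p.ctx.rate h (x : C r n)
    rw [hx] at h2
    have h3 : (ν - ξ - ε) * |ell μ t| ≤ 0 :=
      mul_nonpos_of_nonpos_of_nonneg (by linarith [p.nu_lt]) hu0
    have h4 : (ε - ξ) * |ell μ τ| ≤ 0 := mul_nonpos_of_nonpos_of_nonneg (by linarith) hv0
    rw [ker_of_le h]
    calc _ ≤ Real.exp (-α * (ell μ t - ell μ τ) + (θ + ε) * |ell μ τ|) *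
          (deriv (ell μ) τ * Real.exp (-((γ + ε + 2 * ξ) * |ell μ τ|)) *
          (Real.exp ((ξ + ε) * |ell μ τ|) *
            (K * Real.exp (-β * (ell μ t - ell μ τ) + ν * |ell μ t|) * ‖x‖))) := by gcongr
      _ = K * (Real.exp ((-α * (ell μ t - ell μ τ) + (θ + ε) * |ell μ τ|) +
          -((γ + ε + 2 * ξ) * |ell μ τ|) + (ξ + ε) * |ell μ τ| +
          (-β * (ell μ t - ell μ τ) + ν * |ell μ t|)) * deriv (ell μ) τ) * ‖x‖ := by
          simp only [Real.exp_add]; ring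
      _ ≤ K * (Real.exp ((ξ + ε) * |ell μ t| + -(α + β) * (ell μ t - ell μ τ)) *
          deriv (ell μ) τ) * ‖x‖ := by
          have : (-α * (ell μ t - ell μ τ) + (θ + ε) * |ell μ τ|) +
            -((γ + ε + 2 * ξ) * |ell μ τ|) + (ξ + ε) * |ell μ τ| +
            (-β * (ell μ t - ell μ τ) + ν * |ell μ t|) ≤
            (ξ + ε) * |ell μ t| + -(α + β) * (ell μ t - ell μ τ) := by nlinarith
          gcongr
      _ = _ := by rw [Real.exp_add]; ring
  · have hle := (not_le.1 h).le
    have h2 : ‖W L P τ t x‖ ≤ Kt * Real.exp (a * (ell μ τ - ell μ t) + ε * |ell μ t|) * ‖x‖ := by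
      rw [W_of_le p.ctx.dich hle, Q_of_mem_U p.ctx.dich x.2]
      exact p.growth t τ hle _
    have h3 : (ξ - ε) * (ell μ τ - ell μ t) ≤ (ξ - ε) * (|ell μ τ| + |ell μ t|) := by
      have e1 := le_abs_self (ell μ τ)
      have e2 := neg_abs_le (ell μ t)
      have : 0 ≤ ξ - ε := by linarith
      gcongr
      linarith
    have h4 := mul_nonneg hε.le hu0
    rw [ker_of_ge hle]
    calc _ ≤ Real.exp (-β * (ell μ τ - ell μ t) + (θ + ε) * |ell μ τ|) *
          (deriv (ell μ) τ * Real.exp (-((γ + ε + 2 * ξ) * |ell μ τ|)) *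
          (Real.exp ((ξ + ε) * |ell μ τ|) *
            (Kt * Real.exp (a * (ell μ τ - ell μ t) + ε * |ell μ t|) * ‖x‖))) := by gcongr
      _ = Kt * (Real.exp ((-β * (ell μ τ - ell μ t) + (θ + ε) * |ell μ τ|) +
          -((γ + ε + 2 * ξ) * |ell μ τ|) + (ξ + ε) * |ell μ τ| +
          (a * (ell μ τ - ell μ t) + ε * |ell μ t|)) * deriv (ell μ) τ) * ‖x‖ := by
          simp only [Real.exp_add]; ring
      _ ≤ Kt * (Real.exp ((ξ + ε) * |ell μ t| + -(ξ - ε + β - a) * (ell μ τ - ell μ t)) *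
          deriv (ell μ) τ) * ‖x‖ := by
          have : (-β * (ell μ τ - ell μ t) + (θ + ε) * |ell μ τ|) +
            -((γ + ε + 2 * ξ) * |ell μ τ|) + (ξ + ε) * |ell μ τ| +
            (a * (ell μ τ - ell μ t) + ε * |ell μ t|) ≤
            (ξ + ε) * |ell μ t| + -(ξ - ε + β - a) * (ell μ τ - ell μ t) := by nlinarith
          gcongr
      _ = _ := by rw [Real.exp_add]; ring

/-- Forcing terms bounded by the weighted orbit of `x` are integrable against the kernel, with an
integral that has the weight of the derivative of an element of `𝓑`. -/
theorem Pert.dom_of_le_W {t : ℝ} {x : U P t} {f : ℝ → E n} (hf : AEStronglyMeasurable f volume)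
    {M : ℝ} (hM : 0 ≤ M)
    (hb : ∀ τ, ‖f τ‖ ≤ M * (deriv (ell μ) τ * Real.exp (-((γ + ε + 2 * ξ) * |ell μ τ|)) *
      (Real.exp ((ξ + ε) * |ell μ τ|) * ‖W L P τ t x‖))) :
    Dom μ α β (θ + ε) f ∧ ∫ τ, ker μ α β (θ + ε) t τ * ‖f τ‖ ≤
      M * (K / (α + β) + Kt / (ξ - ε + β - a)) * Real.exp ((ξ + ε) * |ell μ t|) * ‖x‖ := by
  have hα := p.ctx.dich.alpha_pos
  have hβ := p.ctx.dich.beta_pos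
  have hle : ∀ τ, ker μ α β (θ + ε) t τ * ‖f τ‖ ≤ (M * Real.exp ((ξ + ε) * |ell μ t|) * ‖x‖) *
      expKer μ K Kt (α + β) (ξ - ε + β - a) t τ := fun τ => by
    have hk := ker_pos (μ := μ) (α := α) (β := β) (ϑ := θ + ε) t τ
    calc _ ≤ ker μ α β (θ + ε) t τ *
          (M * (deriv (ell μ) τ * Real.exp (-((γ + ε + 2 * ξ) * |ell μ τ|)) *
            (Real.exp ((ξ + ε) * |ell μ τ|) * ‖W L P τ t x‖))) := by
          gcongr
          exact hb τ
      _ = M * (ker μ α β (θ + ε) t τ *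
          (deriv (ell μ) τ * Real.exp (-((γ + ε + 2 * ξ) * |ell μ τ|)) *
            (Real.exp ((ξ + ε) * |ell μ τ|) * ‖W L P τ t x‖))) := by ring
      _ ≤ M * (Real.exp ((ξ + ε) * |ell μ t|) * expKer μ K Kt (α + β) (ξ - ε + β - a) t τ *
          ‖x‖) := mul_le_mul_of_nonneg_left (p.ker_mul_norm_W_le t τ x) hM
      _ = _ := by ring
  obtain ⟨h1, h2⟩ := integrable_expKer p.ctx.rate K Kt (show 0 < α + β by linarith) p.rate_pos t
  have hi : Integrable (fun τ => ker μ α β (θ + ε) t τ * ‖f τ‖) volume := by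
    refine (h1.const_mul (M * Real.exp ((ξ + ε) * |ell μ t|) * ‖x‖)).mono'
      ((measurable_ker p.ctx.rate t).aestronglyMeasurable.mul hf.norm)
      (Eventually.of_forall fun τ => ?_)
    rw [Real.norm_of_nonneg (mul_nonneg (ker_pos t τ).le (norm_nonneg _))]
    exact hle τ
  refine ⟨Dom.of_int p.ctx.rate hα.le hβ.le hf hi, ?_⟩
  calc _ ≤ ∫ τ, (M * Real.exp ((ξ + ε) * |ell μ t|) * ‖x‖) *
        expKer μ K Kt (α + β) (ξ - ε + β - a) t τ := integral_mono hi (h1.const_mul _) hle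
    _ = _ := by rw [integral_const_mul, h2]; ring

variable {N : ℝ} {η : Fam P} (hη : Reg P μ ξ ε N η)
include hη

theorem Pert.hasFDerivAt_forcing (t : ℝ) (b : U P t) (τ : ℝ) :
    HasFDerivAt (fun b => forcing L P g η t b τ)
      (linForcing p.ctx.adm p.ctx.dich p.ctx.rate g η t b τ) b := by
  have h1 := (TbarL p.ctx.adm p.ctx.dich p.ctx.rate τ t).hasFDerivAt (x := b)
  have h2 := hasFDerivAt_hmap hη τ (TbarL p.ctx.adm p.ctx.dich p.ctx.rate τ t b)
  have h3 := (p.hasFDerivAt_g τ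
    (hmap η τ (TbarL p.ctx.adm p.ctx.dich p.ctx.rate τ t b))).comp b (h2.comp b h1)
  have e : (fun b => forcing L P g η t b τ) =
      g τ ∘ (hmap η τ ∘ TbarL p.ctx.adm p.ctx.dich p.ctx.rate τ t) := by
    funext b'
    rw [Function.comp_apply, Function.comp_apply, TbarL_apply, forcing]
  rw [e, linForcing, ← TbarL_apply p.ctx.adm p.ctx.dich p.ctx.rate]
  exact h3

theorem Pert.norm_add_apply_le (τ : ℝ) (b x : U P τ) :
    ‖((U P τ).subtypeL + fderiv ℝ (η τ) b) x‖ ≤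
      (1 + N) * (Real.exp ((ξ + ε) * |ell μ τ|) * ‖x‖) := by
  have h1 : 1 ≤ Real.exp ((ξ + ε) * |ell μ τ|) := by
    have := p.eps_pos
    have := p.eps_lt
    have := abs_nonneg (ell μ τ)
    exact Real.one_le_exp (mul_nonneg (by linarith) this)
  have h2 : ‖fderiv ℝ (η τ) b x‖ ≤ N * Real.exp ((ξ + ε) * |ell μ τ|) * ‖x‖ :=
    (fderiv ℝ (η τ) b).le_of_opNorm_le (hη.bound τ b) x
  have h3 : ‖((U P τ).subtypeL + fderiv ℝ (η τ) b) x‖ ≤ ‖x‖ + ‖fderiv ℝ (η τ) b x‖ := by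
    rw [add_apply]
    exact norm_add_le _ _
  calc _ ≤ ‖x‖ + N * Real.exp ((ξ + ε) * |ell μ τ|) * ‖x‖ := h3.trans (by gcongr)
    _ ≤ Real.exp ((ξ + ε) * |ell μ τ|) * ‖x‖ + N * Real.exp ((ξ + ε) * |ell μ τ|) * ‖x‖ := by
        gcongr
        exact le_mul_of_one_le_left (norm_nonneg x) h1
    _ = _ := by ring

theorem Pert.norm_linForcing_le (t : ℝ) (b x : U P t) (τ : ℝ) :
    ‖linForcing p.ctx.adm p.ctx.dich p.ctx.rate g η t b τ x‖ ≤
      lam * (1 + N) * (deriv (ell μ) τ * Real.exp (-((γ + ε + 2 * ξ) * |ell μ τ|)) *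
        (Real.exp ((ξ + ε) * |ell μ τ|) * ‖W L P τ t x‖)) := by
  have h1 := p.norm_add_apply_le hη τ (Tbar L P τ t b)
    (TbarL p.ctx.adm p.ctx.dich p.ctx.rate τ t x)
  refine ((fderiv ℝ (g τ) (hmap η τ (Tbar L P τ t b))).le_of_opNorm_le_of_le
    (p.norm_dg_le τ _) h1).trans (le_of_eq ?_)
  change _ * (_ * (_ * ‖W L P τ t x‖)) = _
  ring

/-- The derivative of the forcing term depends Lipschitz continuously on `η`. -/
theorem Pert.norm_linForcing_sub_le {η' : Fam P} {M₀ M₁ : ℝ}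
    (h₀ : ∀ t b, ‖η t b - η' t b‖ ≤ M₀ * Real.exp ((ξ + ε) * |ell μ t|))
    (h₁ : ∀ t b, ‖fderiv ℝ (η t) b - fderiv ℝ (η' t) b‖ ≤ M₁ * Real.exp ((ξ + ε) * |ell μ t|))
    (t : ℝ) (b x : U P t) (τ : ℝ) :
    ‖linForcing p.ctx.adm p.ctx.dich p.ctx.rate g η t b τ x -
      linForcing p.ctx.adm p.ctx.dich p.ctx.rate g η' t b τ x‖ ≤
      lam * ((1 + N) * M₀ + M₁) *
        (deriv (ell μ) τ * Real.exp (-((γ + ε + 2 * ξ) * |ell μ τ|)) *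
        (Real.exp ((ξ + ε) * |ell μ τ|) * ‖W L P τ t x‖)) := by
  set bτ := Tbar L P τ t b with hbτ
  set y := TbarL p.ctx.adm p.ctx.dich p.ctx.rate τ t x with hy
  have hyn : ‖y‖ = ‖W L P τ t x‖ := rfl
  have hw := p.weight_nonneg (γ + ε + 2 * ξ) τ
  have hl := p.lam_nonneg
  have hN := hη.nonneg
  have e : linForcing p.ctx.adm p.ctx.dich p.ctx.rate g η t b τ x -
      linForcing p.ctx.adm p.ctx.dich p.ctx.rate g η' t b τ x =
      (fderiv ℝ (g τ) (hmap η τ bτ) - fderiv ℝ (g τ) (hmap η' τ bτ))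
        (((U P τ).subtypeL + fderiv ℝ (η τ) bτ) y) +
      fderiv ℝ (g τ) (hmap η' τ bτ) ((fderiv ℝ (η τ) bτ - fderiv ℝ (η' τ) bτ) y) := by
    change fderiv ℝ (g τ) (hmap η τ bτ) ((y : C r n) + fderiv ℝ (η τ) bτ y) -
      fderiv ℝ (g τ) (hmap η' τ bτ) ((y : C r n) + fderiv ℝ (η' τ) bτ y) =
      (fderiv ℝ (g τ) (hmap η τ bτ) ((y : C r n) + fderiv ℝ (η τ) bτ y) -
        fderiv ℝ (g τ) (hmap η' τ bτ) ((y : C r n) + fderiv ℝ (η τ) bτ y)) +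
      fderiv ℝ (g τ) (hmap η' τ bτ) (fderiv ℝ (η τ) bτ y - fderiv ℝ (η' τ) bτ y)
    simp only [map_add, map_sub]
    abel
  have hA : ‖fderiv ℝ (g τ) (hmap η τ bτ) - fderiv ℝ (g τ) (hmap η' τ bτ)‖ ≤
      lam * M₀ * (deriv (ell μ) τ * Real.exp (-((γ + ε + 2 * ξ) * |ell μ τ|))) := by
    refine (p.dg_lip τ _ _).trans ?_
    gcongr
    refine (min_le_right _ _).trans ?_
    rw [hmap, hmap, add_sub_add_left_eq_sub, Real.exp_neg, ← div_eq_mul_inv,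
      div_le_iff₀ (Real.exp_pos _)]
    exact h₀ τ bτ
  rw [e]
  refine (norm_add_le _ _).trans ((add_le_add (ContinuousLinearMap.le_of_opNorm_le_of_le _ hA
    (p.norm_add_apply_le hη τ bτ y)) (ContinuousLinearMap.le_of_opNorm_le_of_le _
    (p.norm_dg_le τ _) (ContinuousLinearMap.le_of_opNorm_le _ (h₁ τ bτ) y))).trans (le_of_eq ?_))
  rw [hyn]
  ring

theorem Pert.aestronglyMeasurable_linForcing (t : ℝ) (b x : U P t) : AEStronglyMeasurable
    (fun τ => linForcing p.ctx.adm p.ctx.dich p.ctx.rate g η t b τ x) volume := by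
  have hc : Tendsto (fun k : ℕ => ‖((k : ℝ))‖) atTop atTop := by
    simpa using tendsto_natCast_atTop_atTop (R := ℝ)
  -- the derivative is a limit of difference quotients, which are continuous in `τ`
  refine aestronglyMeasurable_of_tendsto_ae (u := atTop) (f := fun (k : ℕ) τ =>
      (k : ℝ) • (forcing L P g η t (b + (k : ℝ)⁻¹ • x) τ - forcing L P g η t b τ)) (fun k => ?_)
    (Eventually.of_forall fun τ => (p.hasFDerivAt_forcing hη t b τ).lim x hc)
  exact (((p.continuous_forcing hη.cont t _).sub
    (p.continuous_forcing hη.cont t b)).const_smul (k : ℝ)).aestronglyMeasurable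

theorem Pert.dom_linForcing (t : ℝ) (b x : U P t) : Dom μ α β (θ + ε)
    (fun τ => linForcing p.ctx.adm p.ctx.dich p.ctx.rate g η t b τ x) :=
  (p.dom_of_le_W (p.aestronglyMeasurable_linForcing hη t b x)
    (mul_nonneg p.lam_nonneg (by linarith [hη.nonneg])) (p.norm_linForcing_le hη t b x)).1

theorem Pert.norm_greenC_linForcing_le (t : ℝ) (b x : U P t) :
    ‖greenC p.ctx.adm P (fun τ => linForcing p.ctx.adm p.ctx.dich p.ctx.rate g η t b τ x) t‖ ≤
      D * (lam * (1 + N) * (K / (α + β) + Kt / (ξ - ε + β - a))) *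
        Real.exp ((ξ + ε) * |ell μ t|) * ‖x‖ := by
  have h1 := p.dom_of_le_W (p.aestronglyMeasurable_linForcing hη t b x)
    (mul_nonneg p.lam_nonneg (by linarith [hη.nonneg])) (p.norm_linForcing_le hη t b x)
  refine (p.ctx.norm_greenC_le h1.1 t).trans ?_
  refine (mul_le_mul_of_nonneg_left h1.2 p.ctx.nonneg).trans (le_of_eq (by ring))

/-- The derivative of `F(η)(t, ·)` at `b`. -/
noncomputable def Pert.derivFop (t : ℝ) (b : U P t) : U P t →L[ℝ] C r n :=
  LinearMap.mkContinuous
    { toFun := fun x =>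
        greenC p.ctx.adm P (fun τ => linForcing p.ctx.adm p.ctx.dich p.ctx.rate g η t b τ x) t
      map_add' := fun x y => by
        simp only [map_add]
        exact p.ctx.greenC_add (p.dom_linForcing hη t b x) (p.dom_linForcing hη t b y) t
      map_smul' := fun k x => by
        simp only [map_smul]
        exact p.ctx.greenC_smul (p.dom_linForcing hη t b x) k t } _
    (p.norm_greenC_linForcing_le hη t b)

theorem Pert.derivFop_apply (t : ℝ) (b x : U P t) : p.derivFop hη t b x =
    greenC p.ctx.adm P (fun τ => linForcing p.ctx.adm p.ctx.dich p.ctx.rate g η t b τ x) t := rfl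

/-- Differentiation under the integral sign. The remainder of the forcing term, divided by
`‖b' - b‖`, tends to zero pointwise and is dominated by twice the bound of the derivative. -/
theorem Pert.hasFDerivAt_Fop (t : ℝ) (b : U P t) :
    HasFDerivAt (Fop p.ctx.adm P g η t) (p.derivFop hη t b) b := by
  have hα := p.ctx.dich.alpha_pos
  have hβ := p.ctx.dich.beta_pos
  set l := linForcing p.ctx.adm p.ctx.dich p.ctx.rate g η t with hl
  set M := lam * (1 + N) * Real.exp ((ξ + ε) * |ell μ t|) with hM
  have hM0 : 0 ≤ M :=
    mul_nonneg (mul_nonneg p.lam_nonneg (by linarith [hη.nonneg])) (Real.exp_pos _).le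
  set G : ℝ → ℝ := fun τ => M * expKer μ K Kt (α + β) (ξ - ε + β - a) t τ with hG
  have hGi : Integrable G volume :=
    (integrable_expKer p.ctx.rate K Kt (show 0 < α + β by linarith) p.rate_pos t).1.const_mul M
  have hk := fun τ => ker_pos (μ := μ) (α := α) (β := β) (ϑ := θ + ε) t τ
  -- a bound of the derivative of the forcing term, and the resulting Lipschitz bound
  have hop : ∀ b' τ, ‖l b' τ‖ ≤ G τ / ker μ α β (θ + ε) t τ := fun b' τ => by
    have hG0 : 0 ≤ G τ := mul_nonneg hM0 (expKer_nonneg p.ctx.rate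
      (by linarith [p.ctx.dich.one_le_K]) p.Kt_nonneg _ _ _ _)
    refine ContinuousLinearMap.opNorm_le_bound _ (div_nonneg hG0 (hk τ).le) fun x => ?_
    rw [div_mul_eq_mul_div, le_div_iff₀ (hk τ)]
    calc _ ≤ lam * (1 + N) * (deriv (ell μ) τ * Real.exp (-((γ + ε + 2 * ξ) * |ell μ τ|)) *
          (Real.exp ((ξ + ε) * |ell μ τ|) * ‖W L P τ t x‖)) * ker μ α β (θ + ε) t τ :=
          mul_le_mul_of_nonneg_right (p.norm_linForcing_le hη t b' x τ) (hk τ).le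
      _ = lam * (1 + N) * (ker μ α β (θ + ε) t τ *
          (deriv (ell μ) τ * Real.exp (-((γ + ε + 2 * ξ) * |ell μ τ|)) *
          (Real.exp ((ξ + ε) * |ell μ τ|) * ‖W L P τ t x‖))) := by ring
      _ ≤ lam * (1 + N) * _ := mul_le_mul_of_nonneg_left (p.ker_mul_norm_W_le t τ x)
          (mul_nonneg p.lam_nonneg (by linarith [hη.nonneg]))
      _ = _ := by rw [hG, hM]; ring
  have hlip : ∀ b' τ, ‖forcing L P g η t b' τ - forcing L P g η t b τ‖ ≤
      G τ / ker μ α β (θ + ε) t τ * ‖b' - b‖ := fun b' τ =>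
    Convex.norm_image_sub_le_of_norm_hasFDerivWithin_le (s := univ)
      (f := fun b => forcing L P g η t b τ)
      (fun b'' _ => (p.hasFDerivAt_forcing hη t b'' τ).hasFDerivWithinAt)
      (fun b'' _ => hop b'' τ) convex_univ (mem_univ _) (mem_univ _)
  set R : U P t → ℝ → E n := fun b' τ =>
    forcing L P g η t b' τ - forcing L P g η t b τ - l b τ (b' - b) with hR
  have hfd := fun b' => p.dom_forcing hη.cont t b'
  have hRd : ∀ b', Dom μ α β (θ + ε) (R b') := fun b' =>
    ((hfd b').sub p.ctx.rate (hfd b)).sub p.ctx.rate (p.dom_linForcing hη t b (b' - b))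
  have hRb : ∀ b' τ, ker μ α β (θ + ε) t τ * ‖R b' τ‖ ≤ 2 * G τ * ‖b' - b‖ := fun b' τ => by
    have h1 : ‖R b' τ‖ ≤ 2 * (G τ / ker μ α β (θ + ε) t τ * ‖b' - b‖) := by
      refine (norm_sub_le _ _).trans ?_
      have := (l b τ).le_of_opNorm_le (hop b τ) (b' - b)
      linarith [hlip b' τ]
    have := hk τ
    calc _ ≤ ker μ α β (θ + ε) t τ * (2 * (G τ / ker μ α β (θ + ε) t τ * ‖b' - b‖)) := by gcongr
      _ = _ := by field_simp
  rw [hasFDerivAt_iff_tendsto]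
  have hlim : Tendsto (fun b' => D * ∫ τ, ‖b' - b‖⁻¹ * (ker μ α β (θ + ε) t τ * ‖R b' τ‖)) (𝓝 b)
      (𝓝 (D * 0)) := by
    refine Tendsto.const_mul D ?_
    have h0 : (0 : ℝ) = ∫ _ : ℝ, (0 : ℝ) := by simp
    rw [h0]
    refine tendsto_integral_filter_of_dominated_convergence (fun τ => 2 * G τ)
      (Eventually.of_forall fun b' => ((hRd b').int t).aestronglyMeasurable.const_mul _)
      (Eventually.of_forall fun b' => Eventually.of_forall fun τ => ?_) (hGi.const_mul 2)
      (Eventually.of_forall fun τ => ?_)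
    · rw [Real.norm_of_nonneg (by have := hk τ; positivity)]
      rcases eq_or_ne ‖b' - b‖ 0 with h1 | h1
      · rw [h1, inv_zero, zero_mul]
        have : 0 ≤ G τ := mul_nonneg hM0 (expKer_nonneg p.ctx.rate
          (by linarith [p.ctx.dich.one_le_K]) p.Kt_nonneg _ _ _ _)
        positivity
      · rw [inv_mul_le_iff₀ ((norm_nonneg _).lt_of_ne' h1), mul_comm ‖b' - b‖]
        exact hRb b' τ
    · have h1 := (hasFDerivAt_iff_tendsto.1 (p.hasFDerivAt_forcing hη t b τ)).const_mul
        (ker μ α β (θ + ε) t τ)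
      rw [mul_zero] at h1
      refine h1.congr fun b' => ?_
      rw [mul_left_comm]
  rw [mul_zero] at hlim
  refine squeeze_zero (fun b' => by positivity) (fun b' => ?_) hlim
  have e : Fop p.ctx.adm P g η t b' - Fop p.ctx.adm P g η t b - p.derivFop hη t b (b' - b) =
      greenC p.ctx.adm P (R b') t := by
    rw [p.derivFop_apply hη, Fop, Fop, ← p.ctx.greenC_sub (hfd b') (hfd b),
      ← p.ctx.greenC_sub ((hfd b').sub p.ctx.rate (hfd b)) (p.dom_linForcing hη t b (b' - b))]
  rw [e, integral_const_mul, mul_left_comm]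
  exact mul_le_mul_of_nonneg_left (p.ctx.norm_greenC_le (hRd b') t) (by positivity)

theorem Pert.fderiv_Fop (t : ℝ) (b : U P t) :
    fderiv ℝ (Fop p.ctx.adm P g η t) b = p.derivFop hη t b := (p.hasFDerivAt_Fop hη t b).fderiv

theorem Pert.norm_fderiv_Fop_le (t : ℝ) (b : U P t) : ‖fderiv ℝ (Fop p.ctx.adm P g η t) b‖ ≤
    D * (lam * (1 + N) * (K / (α + β) + Kt / (ξ - ε + β - a))) *
      Real.exp ((ξ + ε) * |ell μ t|) := by
  rw [p.fderiv_Fop hη]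
  refine ContinuousLinearMap.opNorm_le_bound _ ?_ (p.norm_greenC_linForcing_le hη t b)
  have h1 := p.ctx.nonneg
  have h2 := p.lam_nonneg
  have h3 := hη.nonneg
  have h4 := p.Kt_nonneg
  have h5 := p.rate_pos
  have h6 := p.ctx.dich.one_le_K
  have h7 := p.ctx.dich.alpha_pos
  have h8 := p.ctx.dich.beta_pos
  positivity

theorem Pert.continuous_fderiv_Fop (t : ℝ) : Continuous (fderiv ℝ (Fop p.ctx.adm P g η t)) := by
  have hα := p.ctx.dich.alpha_pos
  have hβ := p.ctx.dich.beta_pos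
  -- on a finite-dimensional space, continuity of the derivative can be tested on vectors
  have := finiteDimensional_U p.ctx.adm p.ctx.dich p.ctx.rate t
  rw [continuous_clm_apply]
  intro x
  simp_rw [p.fderiv_Fop hη, p.derivFop_apply hη]
  rw [continuous_iff_continuousAt]
  intro b
  rw [ContinuousAt, tendsto_iff_norm_sub_tendsto_zero]
  set l := linForcing p.ctx.adm p.ctx.dich p.ctx.rate g η t with hl
  have hd := fun b' => p.dom_linForcing hη t b' x
  have hlim : Tendsto (fun b' => D * ∫ τ, ker μ α β (θ + ε) t τ * ‖l b' τ x - l b τ x‖) (𝓝 b)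
      (𝓝 (D * 0)) := by
    refine Tendsto.const_mul D ?_
    have h0 : (0 : ℝ) = ∫ _ : ℝ, (0 : ℝ) := by simp
    rw [h0]
    refine tendsto_integral_filter_of_dominated_convergence
      (fun τ => 2 * (lam * (1 + N) * (Real.exp ((ξ + ε) * |ell μ t|) *
        expKer μ K Kt (α + β) (ξ - ε + β - a) t τ * ‖x‖)))
      (Eventually.of_forall fun b' => (((hd b').sub p.ctx.rate (hd b)).int t).aestronglyMeasurable)
      (Eventually.of_forall fun b' => Eventually.of_forall fun τ => ?_)
      (((((integrable_expKer p.ctx.rate K Kt (show 0 < α + β by linarith) p.rate_pos t).1.const_mul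
        _).mul_const _).const_mul _).const_mul _)
      (Eventually.of_forall fun τ => ?_)
    · have hk := ker_pos (μ := μ) (α := α) (β := β) (ϑ := θ + ε) t τ
      rw [Real.norm_of_nonneg (by positivity)]
      have hone : ∀ b', ker μ α β (θ + ε) t τ * ‖l b' τ x‖ ≤
          lam * (1 + N) * (Real.exp ((ξ + ε) * |ell μ t|) *
            expKer μ K Kt (α + β) (ξ - ε + β - a) t τ * ‖x‖) := fun b' => by
        calc _ ≤ ker μ α β (θ + ε) t τ * (lam * (1 + N) *
              (deriv (ell μ) τ * Real.exp (-((γ + ε + 2 * ξ) * |ell μ τ|)) *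
              (Real.exp ((ξ + ε) * |ell μ τ|) * ‖W L P τ t x‖))) :=
              mul_le_mul_of_nonneg_left (p.norm_linForcing_le hη t b' x τ) hk.le
          _ = lam * (1 + N) * (ker μ α β (θ + ε) t τ *
              (deriv (ell μ) τ * Real.exp (-((γ + ε + 2 * ξ) * |ell μ τ|)) *
              (Real.exp ((ξ + ε) * |ell μ τ|) * ‖W L P τ t x‖))) := by ring
          _ ≤ _ := mul_le_mul_of_nonneg_left (p.ker_mul_norm_W_le t τ x)
              (mul_nonneg p.lam_nonneg (by linarith [hη.nonneg]))
      calc _ ≤ ker μ α β (θ + ε) t τ * (‖l b' τ x‖ + ‖l b τ x‖) := by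
            gcongr; exact norm_sub_le _ _
        _ ≤ _ := by rw [mul_add]; linarith [hone b', hone b]
    · have hT := (TbarL p.ctx.adm p.ctx.dich p.ctx.rate τ t).continuous
      have h1 : Continuous fun b' => l b' τ x := by
        have hη1 := (hη.smooth τ).continuous
        have hη2 := (hη.smooth τ).continuous_fderiv one_ne_zero
        have hg := p.continuous_dg τ
        have hh : Continuous (hmap η τ) := continuous_subtype_val.add hη1
        simp only [hl, linForcing, ← TbarL_apply p.ctx.adm p.ctx.dich p.ctx.rate]
        exact (hg.comp (hh.comp hT)).clm_apply
          ((continuous_const.add (hη2.comp hT)).clm_apply continuous_const)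
      have h2 := ((h1.sub continuous_const).norm.const_mul (ker μ α β (θ + ε) t τ)).tendsto b
        (f := fun b' => ker μ α β (θ + ε) t τ * ‖l b' τ x - l b τ x‖)
      simpa using h2
  rw [mul_zero] at hlim
  refine squeeze_zero (fun b' => norm_nonneg _) (fun b' => ?_) hlim
  rw [← p.ctx.greenC_sub (hd b') (hd b)]
  exact p.ctx.norm_greenC_le ((hd b').sub p.ctx.rate (hd b)) t

theorem Pert.reg_Fop : Reg P μ ξ ε (D * (lam * (1 + N) * (K / (α + β) + Kt / (ξ - ε + β - a))))
    (Fop p.ctx.adm P g η) where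
  cont := p.jointContinuous_Fop hη.cont
  smooth t := contDiff_one_iff_fderiv.2
    ⟨fun b => (p.hasFDerivAt_Fop hη t b).differentiableAt, p.continuous_fderiv_Fop hη t⟩
  nonneg := by
    have h1 := p.ctx.nonneg
    have h2 := p.lam_nonneg
    have h3 := hη.nonneg
    have h4 := p.Kt_nonneg
    have h5 := p.rate_pos
    have h6 := p.ctx.dich.one_le_K
    have h7 := p.ctx.dich.alpha_pos
    have h8 := p.ctx.dich.beta_pos
    positivity
  bound t b := p.norm_fderiv_Fop_le hη t b

theorem Pert.norm_fderiv_Fop_sub_le {η' : Fam P} {N' : ℝ} (hη' : Reg P μ ξ ε N' η') {M₀ M₁ : ℝ}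
    (hM₀ : 0 ≤ M₀) (hM₁ : 0 ≤ M₁)
    (h₀ : ∀ t b, ‖η t b - η' t b‖ ≤ M₀ * Real.exp ((ξ + ε) * |ell μ t|))
    (h₁ : ∀ t b, ‖fderiv ℝ (η t) b - fderiv ℝ (η' t) b‖ ≤ M₁ * Real.exp ((ξ + ε) * |ell μ t|))
    (t : ℝ) (b : U P t) :
    ‖fderiv ℝ (Fop p.ctx.adm P g η t) b - fderiv ℝ (Fop p.ctx.adm P g η' t) b‖ ≤
      D * (lam * ((1 + N) * M₀ + M₁) * (K / (α + β) + Kt / (ξ - ε + β - a))) *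
        Real.exp ((ξ + ε) * |ell μ t|) := by
  have h2 := p.lam_nonneg
  have h3 := hη.nonneg
  have hM : 0 ≤ lam * ((1 + N) * M₀ + M₁) := by positivity
  rw [p.fderiv_Fop hη, p.fderiv_Fop hη']
  refine ContinuousLinearMap.opNorm_le_bound _ ?_ fun x => ?_
  · have h1 := p.ctx.nonneg
    have h4 := p.Kt_nonneg
    have h5 := p.rate_pos
    have h6 := p.ctx.dich.one_le_K
    have h7 := p.ctx.dich.alpha_pos
    have h8 := p.ctx.dich.beta_pos
    positivity
  · change ‖p.derivFop hη t b x - p.derivFop hη' t b x‖ ≤ _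
    rw [p.derivFop_apply hη, p.derivFop_apply hη',
      ← p.ctx.greenC_sub (p.dom_linForcing hη t b x) (p.dom_linForcing hη' t b x)]
    have h4 := p.dom_of_le_W ((p.aestronglyMeasurable_linForcing hη t b x).sub
      (p.aestronglyMeasurable_linForcing hη' t b x)) hM
      (p.norm_linForcing_sub_le hη h₀ h₁ t b x)
    refine (p.ctx.norm_greenC_le h4.1 t).trans ?_
    refine (mul_le_mul_of_nonneg_left h4.2 p.ctx.nonneg).trans (le_of_eq (by ring))

end Derivative

/-! ### The fixed point of `F` -/

section FixedPoint

variable {r : ℝ} {n : ℕ} {L : ℝ → C r n →L[ℝ] E n} {m μ : ℝ → ℝ}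
  {K α β θ ν D Kt a ε ξ γ δ lam q : ℝ} {P : ℝ → C r n →L[ℝ] C r n} {g : ℝ → C r n → E n}

/-- A sequence of `C¹` functions whose increments and derivative increments decay geometrically
converges to a `C¹` function. -/
theorem exists_contDiff_limit {V W : Type*} [NormedAddCommGroup V] [NormedSpace ℝ V]
    [NormedAddCommGroup W] [NormedSpace ℝ W] [CompleteSpace W] {f : ℕ → V → W}
    (hf : ∀ k, ContDiff ℝ 1 (f k)) {c c' ρ : ℝ} (hρ0 : 0 ≤ ρ) (hρ1 : ρ < 1)
    (h0 : ∀ k b, ‖f (k + 1) b - f k b‖ ≤ c * ρ ^ k)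
    (h1 : ∀ k b, ‖fderiv ℝ (f (k + 1)) b - fderiv ℝ (f k) b‖ ≤ c' * ρ ^ k) :
    ∃ F : V → W, ContDiff ℝ 1 F ∧ (∀ k b, ‖f k b - F b‖ ≤ c * ρ ^ k / (1 - ρ)) ∧
      ∀ N, (∀ k b, ‖fderiv ℝ (f k) b‖ ≤ N) → ∀ b, ‖fderiv ℝ F b‖ ≤ N := by
  have hd0 : ∀ b k, dist (f k b) (f (k + 1) b) ≤ c * ρ ^ k := fun b k => by
    rw [dist_comm, dist_eq_norm]
    exact h0 k b
  have hd1 : ∀ b k, dist (fderiv ℝ (f k) b) (fderiv ℝ (f (k + 1)) b) ≤ c' * ρ ^ k := fun b k => by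
    rw [dist_comm, dist_eq_norm]
    exact h1 k b
  have hex0 : ∀ b, ∃ z, Tendsto (fun k => f k b) atTop (𝓝 z) := fun b =>
    cauchySeq_tendsto_of_complete (cauchySeq_of_le_geometric ρ c hρ1 (hd0 b))
  have hex1 : ∀ b, ∃ z, Tendsto (fun k => fderiv ℝ (f k) b) atTop (𝓝 z) := fun b =>
    cauchySeq_tendsto_of_complete (cauchySeq_of_le_geometric ρ c' hρ1 (hd1 b))
  choose F hF using hex0
  choose F₁ hF₁ using hex1
  have hunif : TendstoUniformly (fun k => fderiv ℝ (f k)) F₁ atTop := by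
    rw [Metric.tendstoUniformly_iff]
    intro e he
    have hz : Tendsto (fun k => c' * ρ ^ k / (1 - ρ)) atTop (𝓝 0) := by
      simpa using ((tendsto_pow_atTop_nhds_zero_of_lt_one hρ0 hρ1).const_mul c').div_const (1 - ρ)
    filter_upwards [hz.eventually_lt_const he] with k hk b
    rw [dist_comm]
    exact (dist_le_of_le_geometric_of_tendsto ρ _ hρ1 (hd1 b) (hF₁ b) k).trans_lt hk
  have hder : ∀ b, HasFDerivAt F (F₁ b) b := fun b =>
    hasFDerivAt_of_tendstoUniformly hunif (fun k b =>
      ((hf k).differentiable one_ne_zero b).hasFDerivAt) hF b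
  have hfd : fderiv ℝ F = F₁ := funext fun b => (hder b).fderiv
  refine ⟨F, contDiff_one_iff_fderiv.2 ⟨fun b => (hder b).differentiableAt, ?_⟩, fun k b => ?_,
    fun N hN b => ?_⟩
  · rw [hfd]
    exact hunif.continuous (Frequently.of_forall fun k => (hf k).continuous_fderiv one_ne_zero)
  · rw [← dist_eq_norm]
    exact dist_le_of_le_geometric_of_tendsto ρ c hρ1 (hd0 b) (hF b) k
  · rw [hfd]
    exact le_of_tendsto (hF₁ b).norm (Eventually.of_forall fun k => hN k b)

theorem Reg.mono {N N' : ℝ} {η : Fam P} (hη : Reg P μ ξ ε N η) (h : N ≤ N') :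
    Reg P μ ξ ε N' η where
  cont := hη.cont
  smooth := hη.smooth
  nonneg := hη.nonneg.trans h
  bound t b := (hη.bound t b).trans (by gcongr)

theorem reg_zero (hq : 0 ≤ q) : Reg P μ ξ ε q (fun _ _ => 0 : Fam P) where
  cont := continuous_const
  smooth _ := contDiff_const
  nonneg := hq
  bound t b := by
    have : fderiv ℝ (fun _ : U P t => (0 : C r n)) b = 0 := by simp
    rw [this]
    exact (norm_zero (E := U P t →L[ℝ] C r n)).trans_le (by positivity)

theorem Reg.memBall {η : Fam P} {A N : ℝ} (hμ : IsDiffGrowthRate μ) (hc : 0 ≤ ξ + ε)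
    (hη : Reg P μ ξ ε N η) (hA : 0 ≤ A) (hb : ∀ t b, ‖η t b‖ ≤ A) (hq : A + N ≤ q) :
    MemBall μ ξ ε q η := by
  refine ⟨hη.cont, hη.smooth, le_trans (add_le_add (b := ENNReal.ofReal A) (d := ENNReal.ofReal N)
    (iSup₂_le fun t b => ENNReal.ofReal_le_ofReal ?_)
    (iSup₂_le fun t b => ENNReal.ofReal_le_ofReal ?_)) ?_⟩
  · rw [normMu_eq_exp hμ]
    refine (mul_le_of_le_one_right (norm_nonneg _) ?_).trans (hb t b)
    rw [Real.exp_le_one_iff]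
    have := mul_nonneg hc (abs_nonneg (ell μ t))
    linarith
  · rw [normMu_eq_exp hμ, Real.exp_neg, ← div_eq_mul_inv, div_le_iff₀ (Real.exp_pos _)]
    exact hη.bound t b
  · rw [← ENNReal.ofReal_add hA hη.nonneg]
    exact ENNReal.ofReal_le_ofReal hq

variable (p : Pert L m μ K α β θ ν D P g Kt a ε ξ γ δ lam)
include p

theorem Pert.lipConst_nonneg : 0 ≤ D * (δ * (1 / α + 1 / β)) := by
  have h1 := p.ctx.nonneg
  have h2 := p.delta_nonneg
  have h7 := p.ctx.dich.alpha_pos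
  have h8 := p.ctx.dich.beta_pos
  positivity

theorem Pert.derivConst_nonneg : 0 ≤ D * (lam * (K / (α + β) + Kt / (ξ - ε + β - a))) := by
  have h1 := p.ctx.nonneg
  have h2 := p.lam_nonneg
  have h4 := p.Kt_nonneg
  have h5 := p.rate_pos
  have h6 := p.ctx.dich.one_le_K
  have h7 := p.ctx.dich.alpha_pos
  have h8 := p.ctx.dich.beta_pos
  positivity

theorem Pert.weight_ge_one (t : ℝ) : 1 ≤ Real.exp ((ξ + ε) * |ell μ t|) := by
  have h1 := p.eps_pos
  have h2 := p.eps_lt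
  rw [Real.one_le_exp_iff]
  have := abs_nonneg (ell μ t)
  have : 0 ≤ ξ + ε := by linarith
  positivity

variable (hq : 0 < q) (hA : D * (δ * (1 / α + 1 / β)) * (1 + q) ^ 2 ≤ q)
  (hB : D * (lam * (K / (α + β) + Kt / (ξ - ε + β - a))) * (1 + q) ^ 3 ≤ q ^ 2)

include hB hq in
/-- `F` maps the regular elements with derivative bound `q` into themselves, by
`(1 + q) B ≤ q² / (1 + q)²`. -/
theorem Pert.reg_Fop_ball {η : Fam P} (hη : Reg P μ ξ ε q η) :
    Reg P μ ξ ε (q ^ 2 / (1 + q) ^ 2) (Fop p.ctx.adm P g η) := by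
  refine (p.reg_Fop hη).mono ?_
  rw [le_div_iff₀ (by positivity)]
  linarith

omit p in
theorem sq_div_le (hq : 0 < q) : q ^ 2 / (1 + q) ^ 2 ≤ q := by
  rw [div_le_iff₀ (by positivity)]
  nlinarith [sq_nonneg q, pow_pos hq 3]

include hq hA hB in
/-- `F` contracts the ball with respect to `‖·‖_{1,μ}`, with factor `q / (1 + q)`. -/
theorem Pert.contraction {η η' : Fam P} (hη : Reg P μ ξ ε q η) (hη' : Reg P μ ξ ε q η')
    {M₀ M₁ : ℝ} (hM₀ : 0 ≤ M₀) (hM₁ : 0 ≤ M₁)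
    (h₀ : ∀ t b, ‖η t b - η' t b‖ ≤ M₀ * Real.exp ((ξ + ε) * |ell μ t|))
    (h₁ : ∀ t b, ‖fderiv ℝ (η t) b - fderiv ℝ (η' t) b‖ ≤ M₁ * Real.exp ((ξ + ε) * |ell μ t|)) :
    ∃ M₀' M₁', 0 ≤ M₀' ∧ 0 ≤ M₁' ∧ M₀' + M₁' ≤ q / (1 + q) * (M₀ + M₁) ∧
      (∀ t b, ‖Fop p.ctx.adm P g η t b - Fop p.ctx.adm P g η' t b‖ ≤ M₀') ∧
      ∀ t b, ‖fderiv ℝ (Fop p.ctx.adm P g η t) b - fderiv ℝ (Fop p.ctx.adm P g η' t) b‖ ≤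
        M₁' * Real.exp ((ξ + ε) * |ell μ t|) := by
  have hA0 := p.lipConst_nonneg
  have hB0 := p.derivConst_nonneg
  set A := D * (δ * (1 / α + 1 / β)) with hAd
  set B := D * (lam * (K / (α + β) + Kt / (ξ - ε + β - a))) with hBd
  refine ⟨A * M₀, B * ((1 + q) * M₀ + M₁), by positivity, by positivity, ?_,
    fun t b => p.norm_Fop_sub_le hη.cont hη'.cont hM₀ h₀ t b, fun t b =>
      (p.norm_fderiv_Fop_sub_le hη hη' hM₀ hM₁ h₀ h₁ t b).trans (le_of_eq (by rw [hBd]; ring))⟩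
  -- the coefficients of `M₀` and of `M₁` are `A + B (1 + q)` and `B`
  have h3 : (A + B * (1 + q)) * (1 + q) ≤ q := by
    have : (A + B * (1 + q)) * (1 + q) * (1 + q) ≤ q * (1 + q) := by nlinarith
    exact le_of_mul_le_mul_right this (by positivity)
  have h4 : B * (1 + q) ≤ q := by
    nlinarith [mul_nonneg hA0 (show 0 ≤ 1 + q by positivity),
      mul_nonneg hB0 (show 0 ≤ (1 + q) * q by positivity)]
  have h5 : A + B * (1 + q) ≤ q / (1 + q) := by rwa [le_div_iff₀ (by positivity)]
  have h6 : B ≤ q / (1 + q) := by rwa [le_div_iff₀ (by positivity)]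
  nlinarith [mul_le_mul_of_nonneg_right h5 hM₀, mul_le_mul_of_nonneg_right h6 hM₁]

/-- The Picard iterates of `F`. -/
noncomputable def picard (h : Adm L m) (P : ℝ → C r n →L[ℝ] C r n) (g : ℝ → C r n → E n) :
    ℕ → Fam P
  | 0 => fun _ _ => 0
  | k + 1 => Fop h P g (picard h P g k)

include hq hB in
theorem Pert.reg_picard (k : ℕ) : Reg P μ ξ ε q (picard p.ctx.adm P g k) := by
  induction k with
  | zero => exact reg_zero hq.le
  | succ k ih => exact (p.reg_Fop_ball hq hB ih).mono (sq_div_le hq)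

include hq hA hB in
/-- The increments of the Picard iterates decay geometrically, with the ratio of `Pert.contraction`. The
increments of the values are bounded without weight, because `F(η)` is. -/
theorem Pert.norm_picard_sub_le : ∃ c, 0 ≤ c ∧ ∀ k,
    (∀ t b, ‖picard p.ctx.adm P g (k + 1) t b - picard p.ctx.adm P g k t b‖ ≤
      c * (q / (1 + q)) ^ k) ∧
    ∀ t b, ‖fderiv ℝ (picard p.ctx.adm P g (k + 1) t) b - fderiv ℝ (picard p.ctx.adm P g k t) b‖ ≤
      c * Real.exp ((ξ + ε) * |ell μ t|) * (q / (1 + q)) ^ k := by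
  have hA0 := p.lipConst_nonneg
  set A := D * (δ * (1 / α + 1 / β)) with hAd
  have hall : ∀ k : ℕ, ∃ M₀ M₁ : ℝ, 0 ≤ M₀ ∧ 0 ≤ M₁ ∧ M₀ + M₁ ≤ (A + q) * (q / (1 + q)) ^ k ∧
      (∀ t b, ‖picard p.ctx.adm P g (k + 1) t b - picard p.ctx.adm P g k t b‖ ≤ M₀) ∧
      ∀ t b, ‖fderiv ℝ (picard p.ctx.adm P g (k + 1) t) b -
        fderiv ℝ (picard p.ctx.adm P g k t) b‖ ≤ M₁ * Real.exp ((ξ + ε) * |ell μ t|) := by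
    intro k
    induction k with
    | zero =>
      refine ⟨A, q, hA0, hq.le, by rw [pow_zero, mul_one], fun t b => ?_, fun t b => ?_⟩
      · have := p.norm_Fop_le (η := picard p.ctx.adm P g 0) continuous_const t b
        change ‖_ - (0 : C r n)‖ ≤ _
        rwa [sub_zero]
      · have h0 : fderiv ℝ (picard p.ctx.adm P g 0 t) b = 0 := by simp [picard]
        rw [h0, sub_zero]
        exact (p.reg_picard hq hB 1).bound t b
    | succ k ih =>
      obtain ⟨M₀, M₁, hM₀, hM₁, hs, h₀, h₁⟩ := ih
      obtain ⟨M₀', M₁', hM₀', hM₁', hs', h₀', h₁'⟩ := p.contraction hq hA hB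
        (p.reg_picard hq hB (k + 1)) (p.reg_picard hq hB k) hM₀ hM₁ (fun t b => (h₀ t b).trans
          (le_mul_of_one_le_right hM₀ (p.weight_ge_one t))) h₁
      refine ⟨M₀', M₁', hM₀', hM₁', hs'.trans ?_, h₀', h₁'⟩
      rw [pow_succ]
      calc _ ≤ q / (1 + q) * ((A + q) * (q / (1 + q)) ^ k) := by gcongr
        _ = _ := by ring
  refine ⟨A + q, by positivity, fun k => ?_⟩
  obtain ⟨M₀, M₁, hM₀, hM₁, hs, h₀, h₁⟩ := hall k
  refine ⟨fun t b => (h₀ t b).trans (by linarith), fun t b => (h₁ t b).trans ?_⟩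
  rw [mul_right_comm]
  gcongr
  linarith

include hq hA hB in
/-- The Picard iterates converge, uniformly together with their derivatives at each fixed time. -/
theorem Pert.exists_fixedPoint :
    ∃ η : Fam P, Reg P μ ξ ε q η ∧ Fop p.ctx.adm P g η = η := by
  obtain ⟨c, hc, hpic⟩ := p.norm_picard_sub_le hq hA hB
  have hreg := p.reg_picard hq hB
  set ρ := q / (1 + q) with hρ
  set y := picard p.ctx.adm P g with hy
  have hρ1 : ρ < 1 := by rw [hρ, div_lt_one (by positivity)]; linarith
  have hρ0 : 0 ≤ ρ := by positivity
  have hlim : Tendsto (fun k => ρ ^ k) atTop (𝓝 0) := tendsto_pow_atTop_nhds_zero_of_lt_one hρ0 hρ1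
  choose η hηs hdη hηN using fun t => exists_contDiff_limit (fun k => (hreg k).smooth t) hρ0 hρ1
    (fun k b => (hpic k).1 t b) (fun k b => (hpic k).2 t b)
  have hz : Tendsto (fun k => c * ρ ^ k / (1 - ρ)) atTop (𝓝 0) := by
    simpa using (hlim.const_mul c).div_const (1 - ρ)
  have hRη : Reg P μ ξ ε q η := by
    refine ⟨?_, hηs, hq.le, fun t => hηN t _ fun k b => (hreg k).bound t b⟩
    refine TendstoUniformly.continuous (F := fun k (p : {p : ℝ × C r n // p.2 ∈ U P p.1}) =>
      y k p.1.1 ⟨p.1.2, p.2⟩) (p := atTop) ?_ (Frequently.of_forall fun k => (hreg k).cont)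
    rw [Metric.tendstoUniformly_iff]
    intro e he
    filter_upwards [hz.eventually_lt_const he] with k hk b
    rw [dist_comm, dist_eq_norm]
    exact (hdη _ k _).trans_lt hk
  refine ⟨η, hRη, funext fun t => funext fun b => ?_⟩
  have hη : Tendsto (fun k => y k t b) atTop (𝓝 (η t b)) :=
    tendsto_iff_norm_sub_tendsto_zero.2 (squeeze_zero (fun _ => norm_nonneg _)
      (fun k => hdη t k b) hz)
  refine tendsto_nhds_unique ?_ (hη.comp (tendsto_add_atTop_nat 1))
  rw [tendsto_iff_norm_sub_tendsto_zero]
  have h1ρ : 0 < 1 - ρ := by linarith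
  refine squeeze_zero (fun _ => norm_nonneg _) (fun k => ?_)
    (by simpa only [mul_zero] using hz.const_mul (D * (δ * (1 / α + 1 / β))))
  exact p.norm_Fop_sub_le (hreg k).cont hRη.cont (by positivity) (fun t b => (hdη t k b).trans
    (le_mul_of_one_le_right (by positivity) (p.weight_ge_one t))) t b

include hq hA in
theorem Pert.lipConst_lt_one : D * (δ * (1 / α + 1 / β)) < 1 := by
  have := p.lipConst_nonneg
  by_contra h
  nlinarith [mul_le_mul_of_nonneg_right (not_lt.1 h) (sq_nonneg (1 + q))]

include hq hA in
/-- Continuous fixed points of `F` are bounded, and `F` contracts the supremum norm. -/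
theorem Pert.fixedPoint_unique {η η' : Fam P} (hη : JointContinuous η) (hη' : JointContinuous η')
    (h : Fop p.ctx.adm P g η = η) (h' : Fop p.ctx.adm P g η' = η') : η' = η := by
  have hA0 := p.lipConst_nonneg
  have hA1 := p.lipConst_lt_one hq hA
  set A := D * (δ * (1 / α + 1 / β)) with hAd
  have hb : ∀ k : ℕ, ∀ t b, ‖η' t b - η t b‖ ≤ A ^ k * (A + A) := by
    intro k
    induction k with
    | zero =>
      intro t b
      rw [pow_zero, one_mul]
      refine (norm_sub_le _ _).trans (add_le_add ?_ ?_)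
      · rw [← h']; exact p.norm_Fop_le hη' t b
      · rw [← h]; exact p.norm_Fop_le hη t b
    | succ k ih =>
      intro t b
      have := p.norm_Fop_sub_le hη' hη (M := A ^ k * (A + A)) (by positivity) (fun t b =>
        (ih t b).trans (le_mul_of_one_le_right (by positivity) (p.weight_ge_one t))) t b
      rw [h, h'] at this
      rw [pow_succ']
      linarith
  funext t b
  have hlim : Tendsto (fun k => A ^ k * (A + A)) atTop (𝓝 0) := by
    simpa using (tendsto_pow_atTop_nhds_zero_of_lt_one hA0 hA1).mul_const (A + A)
  have := ge_of_tendsto' hlim fun k => hb k t b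
  exact sub_eq_zero.1 (norm_le_zero_iff.1 this)

include hq hA hB in
/-- A fixed point with derivative bound `q` lies in `𝓑`: being in the image of `F`, it satisfies the
better bounds `A ≤ q / (1 + q)²` and `q² / (1 + q)²`, whose sum is at most `q`. -/
theorem Pert.memBall_of_fixedPoint {η : Fam P} (hη : Reg P μ ξ ε q η)
    (h : Fop p.ctx.adm P g η = η) : MemBall μ ξ ε q η := by
  have h1 := p.reg_Fop_ball hq hB hη
  rw [h] at h1
  have he1 := p.eps_pos
  have he2 := p.eps_lt
  refine h1.memBall p.ctx.rate (by linarith) p.lipConst_nonneg (fun t b => ?_) ?_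
  · conv_lhs => rw [← h]
    exact p.norm_Fop_le hη.cont t b
  · rw [← le_div_iff₀ (by positivity)] at hA
    have : q / (1 + q) ^ 2 + q ^ 2 / (1 + q) ^ 2 ≤ q := by
      rw [← add_div, div_le_iff₀ (by positivity)]
      nlinarith [pow_pos hq 2, pow_pos hq 3]
    linarith

end FixedPoint

/-! ### The conjugacy -/

section Conjugacy

variable {r : ℝ} {n : ℕ} {L : ℝ → C r n →L[ℝ] E n} {m μ : ℝ → ℝ}
  {K α β θ ν D Kt a ε ξ γ δ lam q : ℝ} {P : ℝ → C r n →L[ℝ] C r n} {g : ℝ → C r n → E n}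

/-- A curve in `C` that is transported by the solution operator along the whole line consists of
the segments of one solution on `ℝ`. -/
theorem exists_entire_of_flow (hr : 0 ≤ r) {f : ℝ → C r n → E n} {k : ℝ → ℝ} (hf : Cara f k)
    {Y : ℝ → C r n} (hY : ∀ s t, s ≤ t → flow f t s (Y s) = Y t) :
    ∃ x : ℝ → E n, Continuous x ∧ (∀ t, sg r x t = Y t) ∧
      ∀ s t, s ≤ t → x t = x s + ∫ u in s..t, f u (Y u) := by
  have hx : ∀ s v, s ≤ v → Y v (zeroI hr) = sol hr f s (Y s) v := fun s v hv => by
    rw [← hY s v hv, flow_eq_sg hr hf hv, sg_apply (niceSol_sol hr hf s (Y s)).cont]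
    simp [zeroI]
  have hc : Continuous fun v => Y v (zeroI hr) := by
    rw [continuous_iff_continuousAt]
    intro t
    refine (niceSol_sol hr hf (t - 1) (Y (t - 1))).cont.continuousAt.congr ?_
    filter_upwards [lt_mem_nhds (show t - 1 < t by linarith)] with v hv
    exact (hx _ _ hv.le).symm
  have hs : ∀ t, sg r (fun v => Y v (zeroI hr)) t = Y t := fun t => by
    rw [← hY (t - r) t (by linarith), flow_eq_sg hr hf (by linarith)]
    refine sg_congr fun v hv => ?_
    rw [← hx (t - r) v hv.1]
  refine ⟨_, hc, hs, fun s t hst => ?_⟩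
  rw [hx s t hst, (niceSol_sol hr hf s (Y s)).eqn t hst]
  congr 1
  refine intervalIntegral.integral_congr fun u hu => ?_
  rw [uIcc_of_le hst] at hu
  rw [← flow_eq_sg hr hf hu.1, hY s u hu.1]

theorem locallyIntegrable_deriv_ell (hμ : IsDiffGrowthRate μ) :
    LocallyIntegrable (deriv (ell μ)) volume := by
  intro t
  have hmono : MonotoneOn (ell μ) (uIcc (t - 1) (t + 1)) :=
    fun _ _ _ _ h => ell_mono hμ h
  refine ⟨Ioc (t - 1) (t + 1), Ioc_mem_nhds (by linarith) (by linarith), ?_⟩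
  exact (intervalIntegrable_iff_integrableOn_Ioc_of_le (by linarith)).1
    hmono.intervalIntegrable_deriv

theorem Tbar_cocycle (h : Adm L m) (hd : HasMuDichotomy L μ K α β θ ν P) (u t s : ℝ) (b : U P s) :
    Tbar L P u t (Tbar L P t s b) = Tbar L P u s b := by
  refine Subtype.ext ?_
  rw [← W_coe hd, ← W_coe hd, ← W_coe hd, W_W h hd]

theorem Tbar_self (h : Adm L m) (hd : HasMuDichotomy L μ K α β θ ν P) (t : ℝ) (b : U P t) :
    Tbar L P t t b = b := by
  refine Subtype.ext ?_
  rw [Tbar_of_le hd le_rfl, T_self h]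

/-- A curve in `U` that is transported by `T` comes from a solution on `ℝ`. -/
theorem exists_linSol_W (h : Adm L m) (hd : HasMuDichotomy L μ K α β θ ν P) (s : ℝ) (φ : C r n) :
    ∃ x : ℝ → E n, (∀ t, sg r x t = W L P t s φ) ∧ ∀ t, LinSol L (fun _ => 0) t x := by
  obtain ⟨x, hx, hxs, hxe⟩ := exists_entire_of_flow h.nn h.cara (Y := fun t => W L P t s φ)
    fun u t hut => T_W_eq h hd hut s φ
  refine ⟨x, hxs, fun u => ⟨hx, fun t hut => ?_⟩⟩
  simp_rw [hxs, add_zero]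
  exact hxe u t hut

variable (p : Pert L m μ K α β θ ν D P g Kt a ε ξ γ δ lam)
include p

theorem Pert.norm_g_lip_le (u : ℝ) (φ ψ : C r n) :
    ‖g u φ - g u ψ‖ ≤ δ * deriv (ell μ) u * ‖φ - ψ‖ := by
  have h0 := deriv_ell_nonneg p.ctx.rate u
  have hδ := p.delta_nonneg
  have hε := p.eps_pos
  have hξ := p.eps_lt
  have hγ := p.theta_le
  have hθ := p.ctx.dich.theta_nonneg
  have hle : ∀ c, 0 ≤ c → Real.exp (-(c * |ell μ u|)) ≤ 1 := fun c hc => by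
    rw [Real.exp_le_one_iff]
    have := mul_nonneg hc (abs_nonneg (ell μ u))
    linarith
  calc _ ≤ _ := p.g_lip u φ ψ
    _ ≤ δ * (‖φ - ψ‖ * 1) * (deriv (ell μ) u * 1) := by
      gcongr
      · exact (min_le_right _ _).trans
          (mul_le_mul_of_nonneg_left (hle (ξ + ε) (by linarith)) (norm_nonneg _))
      · exact hle (γ + ε) (by linarith)
    _ = _ := by ring

theorem Pert.cara : Cara (fun u φ => L u φ + g u φ) (fun u => m u + δ * deriv (ell μ) u) := by
  refine p.ctx.adm.cara.add ⟨fun Y hY => ?_, ?_, fun u => ?_, p.norm_g_lip_le, fun u => ?_⟩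
  · exact (p.continuous_g.comp (continuous_id.prodMk hY)).aestronglyMeasurable
  · exact (locallyIntegrable_deriv_ell p.ctx.rate).smul δ
  · exact mul_nonneg p.delta_nonneg (deriv_ell_nonneg p.ctx.rate u)
  · rw [p.g_zero, norm_zero]
    exact mul_nonneg p.delta_nonneg (deriv_ell_nonneg p.ctx.rate u)

omit p in
theorem R_eq_flow (t s : ℝ) (φ : C r n) :
    R L g t s φ = flow (fun u φ => L u φ + g u φ) t s φ := rfl

theorem Pert.forcing_Tbar (η : Fam P) (t s : ℝ) (b : U P s) :
    forcing L P g η t (Tbar L P t s b) = forcing L P g η s b := by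
  funext τ
  rw [forcing, Tbar_cocycle p.ctx.adm p.ctx.dich, forcing]

/-- A continuous fixed point of `F` maps orbits in `U` to orbits of the perturbed equation, also
backwards in time. -/
theorem Pert.orbit_of_fixedPoint {η : Fam P} (hη : JointContinuous η)
    (h : Fop p.ctx.adm P g η = η) (s : ℝ) (b : U P s) {u t : ℝ} (hut : u ≤ t) :
    R L g t u (hmap η u (Tbar L P u s b)) = hmap η t (Tbar L P t s b) := by
  obtain ⟨x₀, hx₀, hxl⟩ := exists_linSol_W p.ctx.adm p.ctx.dich s (b : C r n)
  have hf := p.dom_forcing hη s b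
  set f := forcing L P g η s b with hfd
  have hfi := hf.locallyIntegrable p.ctx.rate
  have hsum : ∀ u, LinSol L (fun u => 0 + f u) u (fun v => x₀ v + greenSol p.ctx.adm P f v) :=
    fun u => (hxl u).add p.ctx.adm locallyIntegrable_zero' hfi (p.ctx.linSol_greenSol hf u)
  have hseg : ∀ t, sg r (fun v => x₀ v + greenSol p.ctx.adm P f v) t =
      hmap η t (Tbar L P t s b) := fun t => by
    rw [sg_add (hxl 0).1 (p.ctx.continuous_greenSol hf), hx₀, W_coe p.ctx.dich, hmap]
    conv_rhs => rw [← h, Fop, p.forcing_Tbar]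
    rfl
  have := flow_eq_of_eqn p.ctx.adm.nn p.cara (hsum u).1 (s := u) (fun t ht => by
    simp_rw [hseg]
    have := (hsum u).2 t ht
    simp_rw [hseg, zero_add] at this
    exact this) hut
  rwa [hseg, hseg] at this

theorem Pert.conjugates_of_fixedPoint {η : Fam P} (hη : JointContinuous η)
    (h : Fop p.ctx.adm P g η = η) : Conjugates L P g η := by
  intro s t hst b
  have := p.orbit_of_fixedPoint hη h s b hst
  rw [Tbar_self p.ctx.adm p.ctx.dich] at this
  exact this.symm

/-- A bounded continuous conjugacy is a fixed point of `F`: the difference between an orbit of the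
perturbed equation and the orbit in `U` is a bounded solution of the forced linear equation. -/
theorem Pert.fixedPoint_of_conjugates {η : Fam P} (hη : MemM η) (h : Conjugates L P g η) :
    Fop p.ctx.adm P g η = η := by
  obtain ⟨hη, M, hM⟩ := hη
  funext s b
  have hY : ∀ u t, u ≤ t → flow (fun u φ => L u φ + g u φ) t u (hmap η u (Tbar L P u s b)) =
      hmap η t (Tbar L P t s b) := fun u t hut => by
    rw [← R_eq_flow, ← h u t hut, Tbar_cocycle p.ctx.adm p.ctx.dich]
  obtain ⟨x, hx, hxs, hxe⟩ := exists_entire_of_flow p.ctx.adm.nn p.cara hY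
  have hlin : ∀ u, LinSol L (forcing L P g η s b) u x := fun u => ⟨hx, fun t hut => by
    simp_rw [hxs]
    exact hxe u t hut⟩
  have hsub : ∀ t, sg r x t - W L P t s b = η t (Tbar L P t s b) := fun t => by
    rw [hxs, W_coe p.ctx.dich, hmap, add_sub_cancel_left]
  have hb := p.dom_of_le (p.continuous_forcing hη s b).aestronglyMeasurable p.delta_nonneg fun τ =>
    p.norm_g_le τ _
  have key := p.ctx.eq_greenC_of_bounded hb.1 hlin (b := fun t => W L P t s b)
    (fun u t hut => T_W_eq p.ctx.adm p.ctx.dich hut s b) (fun t => by rw [hsub]; exact hM t _)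
    (fun t => (p.ctx.norm_greenC_le hb.1 t).trans
      (mul_le_mul_of_nonneg_left (hb.2 t) p.ctx.nonneg)) s
  rw [hsub, Tbar_self p.ctx.adm p.ctx.dich] at key
  exact key.symm

/-- Continuous fixed points are bounded, because the Green operator bounds `F(η)` by `Dδ(1/α + 1/β)`. -/
theorem Pert.memM_of_fixedPoint {η : Fam P} (hη : JointContinuous η)
    (h : Fop p.ctx.adm P g η = η) : MemM η :=
  ⟨hη, _, fun t b => by
    conv_lhs => rw [← h]
    exact p.norm_Fop_le hη t b⟩

end Conjugacy

/-! ### The maps `h^t` are diffeomorphisms onto their images -/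

section Diffeo

/-- An injective bounded operator on a finite-dimensional space has a bounded left inverse. -/
theorem exists_leftInverse_of_finiteDimensional {V W : Type*} [NormedAddCommGroup V]
    [NormedSpace ℝ V] [FiniteDimensional ℝ V] [NormedAddCommGroup W] [NormedSpace ℝ W]
    (A : V →L[ℝ] W) (hA : Function.Injective A) : ∃ B : W →L[ℝ] V, ∀ v, B (A v) = v := by
  set e := LinearEquiv.ofInjective (A : V →ₗ[ℝ] W) hA with he
  have := LinearEquiv.finiteDimensional e
  set f : LinearMap.range (A : V →ₗ[ℝ] W) →L[ℝ] V :=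
    LinearMap.toContinuousLinearMap (e.symm : LinearMap.range (A : V →ₗ[ℝ] W) →ₗ[ℝ] V) with hf
  obtain ⟨B, hB⟩ := ContinuousLinearMap.exist_extension_of_finiteDimensional_range f
  refine ⟨B, fun v => ?_⟩
  have h1 : f (e v) = B (e v : W) := by rw [hB]; rfl
  have h2 : f (e v) = v := e.symm_apply_apply v
  exact h1.symm.trans h2

/-- A `C¹` injective immersion of a finite-dimensional space that does not shrink large distances
is a diffeomorphism onto its image. -/
theorem isC1DiffeoOntoImage_of_immersion {V W : Type*} [NormedAddCommGroup V] [NormedSpace ℝ V]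
    [FiniteDimensional ℝ V] [NormedAddCommGroup W] [NormedSpace ℝ W] {h : V → W}
    (hs : ContDiff ℝ 1 h) (hi : Function.Injective h)
    (hd : ∀ b, Function.Injective (fderiv ℝ h b)) {M : ℝ}
    (hM : ∀ b b', ‖b - b'‖ ≤ ‖h b - h b'‖ + M) : IsC1DiffeoOntoImage h := by
  refine ⟨hi, hs, fun b => ?_⟩
  have := FiniteDimensional.complete ℝ V
  have := FiniteDimensional.proper_real V
  obtain ⟨B, hB⟩ := exists_leftInverse_of_finiteDimensional _ (hd b)
  -- the inverse function theorem is applied to the composition with a left inverse of `Dh(b)`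
  have hψ : ContDiffAt ℝ 1 (fun v => B (h v)) b := (B.contDiff.comp hs).contDiffAt
  have hψ' : HasFDerivAt (fun v => B (h v)) (ContinuousLinearEquiv.refl ℝ V : V →L[ℝ] V) b := by
    have h1 := B.hasFDerivAt.comp b (hs.differentiable one_ne_zero b).hasFDerivAt
    have h2 : B.comp (fderiv ℝ h b) = (ContinuousLinearEquiv.refl ℝ V : V →L[ℝ] V) :=
      ContinuousLinearMap.ext hB
    rwa [h2] at h1
  set Φ := hψ.toOpenPartialHomeomorph _ hψ' one_ne_zero with hΦ
  have hsrc : b ∈ Φ.source := hψ.mem_toOpenPartialHomeomorph_source hψ' one_ne_zero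
  have hcd : ContDiffAt ℝ 1 Φ.symm (B (h b)) := hψ.to_localInverse hψ' one_ne_zero
  obtain ⟨S, hS, hSo, hbS⟩ := eventually_nhds_iff.1 (hcd.eventually (by simp))
  -- points far from `b`, or close to `b` but outside the source, have images away from `h b`
  have hF : IsCompact (Metric.closedBall b (1 + M) \ Φ.source) :=
    (isCompact_closedBall b (1 + M)).diff Φ.open_source
  have hFc : IsClosed (h '' (Metric.closedBall b (1 + M) \ Φ.source)) :=
    (hF.image hs.continuous).isClosed
  refine ⟨B ⁻¹' S ∩ (Metric.ball (h b) 1 ∩ (h '' (Metric.closedBall b (1 + M) \ Φ.source))ᶜ),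
    fun w => Φ.symm (B w), (hSo.preimage B.continuous).inter (Metric.isOpen_ball.inter
      hFc.isOpen_compl), ⟨hbS, Metric.mem_ball_self one_pos, ?_⟩, ?_, ?_⟩
  · rintro ⟨v, hv, hvb⟩
    exact hv.2 (hi hvb ▸ hsrc)
  · intro w hw
    exact ((hS _ hw.1).comp w B.contDiff.contDiffAt).contDiffWithinAt
  · rintro v ⟨-, hv1, hv2⟩
    have hvs : v ∈ Φ.source := by
      by_contra hvs
      refine hv2 ⟨v, ⟨?_, hvs⟩, rfl⟩
      rw [Metric.mem_closedBall, dist_eq_norm]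
      rw [Metric.mem_ball, dist_eq_norm] at hv1
      linarith [hM v b]
    exact Φ.left_inv hvs

variable {r : ℝ} {n : ℕ} {L : ℝ → C r n →L[ℝ] E n} {m μ : ℝ → ℝ}
  {K α β θ ν D Kt a ε ξ γ δ lam q : ℝ} {P : ℝ → C r n →L[ℝ] C r n} {g : ℝ → C r n → E n}

/-- Solution operators are Lipschitz continuous. -/
theorem norm_flow_sub_le (hr : 0 ≤ r) {f : ℝ → C r n → E n} {k : ℝ → ℝ} (hf : Cara f k) {s t : ℝ}
    (hst : s ≤ t) (φ ψ : C r n) :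
    ‖flow f t s φ - flow f t s ψ‖ ≤ 2 * ‖φ - ψ‖ * Real.exp (2 * Lam k s t) := by
  have hx := niceSol_sol hr hf s φ
  have hy := niceSol_sol hr hf s ψ
  set x := sol hr f s φ
  set y := sol hr f s ψ
  have hc : Continuous fun v => x v - y v := hx.cont.sub hy.cont
  rw [flow_eq_sg hr hf hst, flow_eq_sg hr hf hst, ← sg_sub hx.cont hy.cont]
  have hpast : ∀ v, v ≤ s → ‖x v - y v‖ ≤ ‖φ - ψ‖ := fun v hv => by
    rw [hx.past v hv, hy.past v hv]
    exact norm_apply_le (φ - ψ) _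
  have hl := hf.locallyIntegrable (continuous_sg hx.cont)
  have hl' := hf.locallyIntegrable (continuous_sg hy.cont)
  refine norm_sg_le hc (by positivity) fun v hv => ?_
  have hb := gronwall_sg (r := r) hf.int hf.nonneg hc (b := t) (norm_nonneg (φ - ψ))
    (fun v hv => hpast v hv.2) (fun v hv => ?_) v ⟨by linarith [hv.1], hv.2⟩
  · refine hb.trans ?_
    gcongr
    exact Lam_mono hf.int hf.nonneg s hv.2
  · rw [hx.eqn v hv.1, hy.eqn v hv.1, add_sub_add_comm,
      ← intervalIntegral.integral_sub (locInt_interval hl _ _) (locInt_interval hl' _ _)]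
    refine (norm_add_le _ _).trans (add_le_add (norm_apply_le (φ - ψ) _) ?_)
    refine intervalIntegral.norm_integral_le_of_norm_le hv.1
      (Eventually.of_forall fun u _ => ?_)
      ((locInt_interval hf.int _ _).mul_continuousOn (continuous_sg hc).norm.continuousOn)
    rw [sg_sub hx.cont hy.cont]
    exact hf.lip u _ _

/-- Vectors of `U(t)` whose orbits are bounded forwards in time vanish. -/
theorem eq_zero_of_norm_W_le (h : Adm L m) (hd : HasMuDichotomy L μ K α β θ ν P)
    (hμ : IsDiffGrowthRate μ) {t M : ℝ} {x : C r n} (hx : x ∈ U P t)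
    (hM : ∀ τ, t ≤ τ → ‖W L P τ t x‖ ≤ M) : x = 0 := by
  have hβ : 0 < β - ν := by linarith [hd.nu_lt]
  have hK := hd.one_le_K
  have hM0 : 0 ≤ M := (norm_nonneg _).trans (hM t le_rfl)
  have hb : ∀ᶠ τ in atTop, ‖x‖ ≤ K * M * Real.exp (β * ell μ t - (β - ν) * ell μ τ) := by
    filter_upwards [eventually_ge_atTop t, eventually_ge_atTop (0 : ℝ)] with τ hτ hτ0
    have h0 : 0 ≤ ell μ τ := by rw [← ell_zero hμ]; exact ell_mono hμ hτ0
    have h1 : W L P t τ (W L P τ t x) = x := by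
      rw [W_W h hd, W_self h hd, Q_of_mem_U hd hx]
    conv_lhs => rw [← h1]
    refine (norm_W_le hd hμ hτ _).trans ?_
    rw [abs_of_nonneg h0, mul_right_comm, show -β * (ell μ τ - ell μ t) + ν * ell μ τ =
      β * ell μ t - (β - ν) * ell μ τ by ring]
    have := hM τ hτ
    gcongr
  have hlim : Tendsto (fun τ => K * M * Real.exp (β * ell μ t - (β - ν) * ell μ τ)) atTop
      (𝓝 (K * M * 0)) := by
    refine Tendsto.const_mul _ (Real.tendsto_exp_atBot.comp ?_)
    exact tendsto_atBot_add_const_left _ _ (tendsto_neg_atTop_atBot.comp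
      ((tendsto_ell_atTop hμ).const_mul_atTop hβ))
  rw [mul_zero] at hlim
  exact norm_le_zero_iff.1 (ge_of_tendsto hlim hb)

variable (p : Pert L m μ K α β θ ν D P g Kt a ε ξ γ δ lam)
include p

/-- If `h^t b = h^t b'`, then the orbits of `b` and `b'` have the same image at all later times, so they
stay at bounded distance. -/
theorem Pert.hmap_injective {η : Fam P} (hη : JointContinuous η)
    (h : Fop p.ctx.adm P g η = η) (t : ℝ) : Function.Injective (hmap η t) := by
  intro b b' hbb
  obtain ⟨-, M, hM⟩ := p.memM_of_fixedPoint hη h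
  have hc := p.conjugates_of_fixedPoint hη h
  refine Subtype.ext (sub_eq_zero.1 (eq_zero_of_norm_W_le p.ctx.adm p.ctx.dich p.ctx.rate
    (sub_mem b.2 b'.2) (M := M + M) fun τ hτ => ?_))
  have h1 : hmap η τ (Tbar L P τ t b) = hmap η τ (Tbar L P τ t b') := by
    rw [hc t τ hτ, hc t τ hτ, hbb]
  rw [hmap, hmap] at h1
  have h2 : W L P τ t ((b : C r n) - b') = η τ (Tbar L P τ t b') - η τ (Tbar L P τ t b) := by
    rw [W_sub p.ctx.adm p.ctx.dich, W_coe p.ctx.dich, W_coe p.ctx.dich, sub_eq_sub_iff_add_eq_add,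
      h1, add_comm]
  rw [h2]
  exact (norm_sub_le _ _).trans (add_le_add (hM _ _) (hM _ _))

/-- The kernel of `Dh^t` is transported along the orbit, because `R(τ, t)` is Lipschitz. -/
theorem Pert.fderiv_hmap_eq_zero {η : Fam P} {N : ℝ} (hη : Reg P μ ξ ε N η)
    (h : Fop p.ctx.adm P g η = η) {t τ : ℝ} (hτ : t ≤ τ) (b x : U P t)
    (hx : (x : C r n) + fderiv ℝ (η t) b x = 0) :
    (TbarL p.ctx.adm p.ctx.dich p.ctx.rate τ t x : C r n) +
      fderiv ℝ (η τ) (Tbar L P τ t b) (TbarL p.ctx.adm p.ctx.dich p.ctx.rate τ t x) = 0 := by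
  set A := TbarL p.ctx.adm p.ctx.dich p.ctx.rate τ t with hA
  have hAb : Tbar L P τ t b = A b := (TbarL_apply p.ctx.adm p.ctx.dich p.ctx.rate τ t b).symm
  have hc := p.conjugates_of_fixedPoint hη.cont h
  have h1 := hasFDerivAt_hmap hη t b
  have h2 := (hasFDerivAt_hmap hη τ (A b)).comp b A.hasFDerivAt
  have hcst : Tendsto (fun k : ℕ => ‖((k : ℝ))‖) atTop atTop := by
    simpa using tendsto_natCast_atTop_atTop (R := ℝ)
  have l1 := (h1.lim x hcst).norm
  have l2 := (h2.lim x hcst).norm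
  have e1 : ((U P t).subtypeL + fderiv ℝ (η t) b) x = 0 := hx
  rw [e1, norm_zero] at l1
  -- difference quotients of `h^τ ∘ T(τ, t) = R(τ, t) ∘ h^t` in the direction `x`
  have l3 := l1.const_mul (2 * Real.exp (2 * Lam (fun u => m u + δ * deriv (ell μ) u) t τ))
  rw [mul_zero] at l3
  have key := le_of_tendsto_of_tendsto' l2 l3 fun k => by
    rw [norm_smul, norm_smul, mul_left_comm]
    refine mul_le_mul_of_nonneg_left ?_ (norm_nonneg _)
    have := norm_flow_sub_le p.ctx.adm.nn p.cara hτ (hmap η t (b + (k : ℝ)⁻¹ • x)) (hmap η t b)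
    rw [← R_eq_flow, ← R_eq_flow, ← hc t τ hτ, ← hc t τ hτ,
      ← TbarL_apply p.ctx.adm p.ctx.dich p.ctx.rate,
      ← TbarL_apply p.ctx.adm p.ctx.dich p.ctx.rate, mul_right_comm] at this
    exact this
  rw [hAb]
  exact norm_le_zero_iff.1 key

/-- If `Dh^t(b) x = 0`, then `T(τ,t) x = -Dη^τ T(τ,t) x` for `τ ≥ t`. The right-hand side is the Green
operator applied to a forcing term that vanishes after time `t`, hence it is bounded. -/
theorem Pert.fderiv_hmap_injective {η : Fam P} {N : ℝ} (hη : Reg P μ ξ ε N η)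
    (h : Fop p.ctx.adm P g η = η) (t : ℝ) (b : U P t) :
    Function.Injective (fderiv ℝ (hmap η t) b) := by
  rw [(hasFDerivAt_hmap hη t b).fderiv, injective_iff_map_eq_zero]
  intro x hx
  set l := fun σ => linForcing p.ctx.adm p.ctx.dich p.ctx.rate g η t b σ x with hl
  have hd : Dom μ α β (θ + ε) l := p.dom_linForcing hη t b x
  have hz := fun τ (hτ : t ≤ τ) => p.fderiv_hmap_eq_zero hη h hτ b x hx
  -- the linearized forcing term vanishes after time `t`
  have hl0 : ∀ σ, t ≤ σ → l σ = 0 := fun σ hσ => by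
    change fderiv ℝ (g σ) _ (((TbarL p.ctx.adm p.ctx.dich p.ctx.rate σ t x : U P σ) : C r n) +
      fderiv ℝ (η σ) (Tbar L P σ t b) (TbarL p.ctx.adm p.ctx.dich p.ctx.rate σ t x)) = 0
    rw [hz σ hσ, map_zero]
  refine Subtype.ext (eq_zero_of_norm_W_le p.ctx.adm p.ctx.dich p.ctx.rate x.2
    (M := D * ∫ σ, ker μ α β (θ + ε) t σ * ‖l σ‖) fun τ hτ => ?_)
  have hW : W L P τ t x = -greenC p.ctx.adm P l τ := by
    have h1 := eq_neg_of_add_eq_zero_left (hz τ hτ)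
    have h2 : fderiv ℝ (η τ) (Tbar L P τ t b) (TbarL p.ctx.adm p.ctx.dich p.ctx.rate τ t x) =
        greenC p.ctx.adm P l τ := by
      conv_lhs => rw [← h]
      rw [p.fderiv_Fop hη, p.derivFop_apply hη]
      congr 1
      funext σ
      simp only [hl, linForcing, Tbar_cocycle p.ctx.adm p.ctx.dich]
      change fderiv ℝ (g σ) _ ((TbarL p.ctx.adm p.ctx.dich p.ctx.rate σ τ
        (TbarL p.ctx.adm p.ctx.dich p.ctx.rate τ t x) : C r n) + fderiv ℝ (η σ) (Tbar L P σ t b)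
        (TbarL p.ctx.adm p.ctx.dich p.ctx.rate σ τ
          (TbarL p.ctx.adm p.ctx.dich p.ctx.rate τ t x))) =
        fderiv ℝ (g σ) _ ((TbarL p.ctx.adm p.ctx.dich p.ctx.rate σ t x : C r n) +
          fderiv ℝ (η σ) (Tbar L P σ t b) (TbarL p.ctx.adm p.ctx.dich p.ctx.rate σ t x))
      rw [TbarL_apply, TbarL_apply, TbarL_apply, Tbar_cocycle p.ctx.adm p.ctx.dich]
    rw [h2] at h1
    exact h1
  rw [hW, norm_neg]
  refine (p.ctx.norm_greenC_le hd τ).trans (mul_le_mul_of_nonneg_left ?_ p.ctx.nonneg)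
  refine integral_mono (hd.int τ) (hd.int t) fun σ => ?_
  rcases le_total t σ with hσ | hσ
  · simp only [hl0 σ hσ, norm_zero, mul_zero, le_refl]
  · refine mul_le_mul_of_nonneg_right ?_ (norm_nonneg _)
    rw [ker_of_le hσ, ker_of_le (hσ.trans hτ)]
    refine Real.exp_le_exp.2 ?_
    have := mul_le_mul_of_nonneg_left (ell_mono p.ctx.rate hτ) p.ctx.dich.alpha_pos.le
    linarith

/-- `h^t` differs from the inclusion of `U(t)` by a bounded map, so it does not shrink large distances. -/
theorem Pert.isC1DiffeoOntoImage_hmap {η : Fam P} {N : ℝ} (hη : Reg P μ ξ ε N η)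
    (h : Fop p.ctx.adm P g η = η) (t : ℝ) : IsC1DiffeoOntoImage (hmap η t) := by
  have := finiteDimensional_U p.ctx.adm p.ctx.dich p.ctx.rate t
  obtain ⟨-, M, hM⟩ := p.memM_of_fixedPoint hη.cont h
  refine isC1DiffeoOntoImage_of_immersion ((U P t).subtypeL.contDiff.add (hη.smooth t))
    (p.hmap_injective hη.cont h t) (p.fderiv_hmap_injective hη h t) (M := M + M) fun b b' => ?_
  have e : ((b - b' : U P t) : C r n) = (hmap η t b - hmap η t b') - (η t b - η t b') := by
    rw [hmap, hmap, Submodule.coe_sub]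
    abel
  change ‖((b - b' : U P t) : C r n)‖ ≤ _
  rw [e]
  exact (norm_sub_le _ _).trans (add_le_add le_rfl ((norm_sub_le _ _).trans
    (add_le_add (hM _ _) (hM _ _))))

end Diffeo

/-! ### The hypotheses in exponential form -/

section Hypotheses

variable {r : ℝ} {n : ℕ} {L : ℝ → C r n →L[ℝ] E n} {m μ : ℝ → ℝ}
  {K α β θ ν D Kt a ε ξ γ δ lam q : ℝ} {P : ℝ → C r n →L[ℝ] C r n} {g : ℝ → C r n → E n}

theorem Admissible.exists_adm (hL : Admissible L) (hr : 0 < r) : ∃ m, Adm L m := by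
  obtain ⟨h1, m, h2, h3⟩ := hL
  exact ⟨m, hr, h1, h2, h3⟩

/-- The growth bound of `T₀`, restricted to `C`. -/
theorem norm_T_le_growth (h : Adm L m) (hμ : IsDiffGrowthRate μ) (hKt : 0 ≤ Kt)
    (hg : HasBoundedGrowth L μ Kt a ε) {s t : ℝ} (hst : s ≤ t) (φ : C r n) :
    ‖T L t s φ‖ ≤ Kt * Real.exp (a * (ell μ t - ell μ s) + ε * |ell μ s|) * ‖φ‖ := by
  have hX : ∀ ω : I r, X0 (0 : E n) ω = 0 := fun ω => by unfold X0; split_ifs <;> rfl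
  have hφ : (fun ω => φ ω + X0 (0 : E n) ω) = (φ : I r → E n) := funext fun ω => by
    rw [hX, add_zero]
  refine C_norm_le (by positivity) fun ω => ?_
  have h1 := hg s t hst φ ‖φ‖ (hφ ▸ memC0_add_X0 h.pos φ 0) (fun ω => norm_apply_le φ ω) ω
  have h2 := T0_add_X0 h hst φ 0 ω
  have h3 : fund h s (0 : E n) (t + ω) = 0 := by
    simpa using fund_smul h s 0 (0 : E n) (t + ω)
  have h4 : Real.sign (t - s) * a * (ell μ t - ell μ s) = a * (ell μ t - ell μ s) := by
    rcases hst.eq_or_lt with h5 | h5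
    · simp [h5]
    · rw [Real.sign_of_pos (sub_pos.2 h5), one_mul]
  rw [hφ, h3, add_zero] at h2
  rw [h2, ratio_rpow hμ, wt_eq_exp hμ, mul_assoc Kt, ← Real.exp_add, h4] at h1
  rwa [T_eq_sg h hst, sg_apply (continuous_lsol h s φ)]

/-- Since `ν ≤ θ`, one kernel with nonuniformity exponent `θ + ε` dominates both operators. -/
theorem ctx_of_bounds (h : Adm L m) (hd : HasMuDichotomy L μ K α β θ ν P)
    (hμ : IsDiffGrowthRate μ) (hε : 0 < ε) (hθ : ε + ν ≤ θ) (hD : 0 ≤ D)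
    (hs : StableBound L P μ α θ ε D) (hu : UnstableBound L P μ β ν ε D) :
    Ctx L m μ K α β θ ν D (θ + ε) P where
  adm := h
  dich := hd
  rate := hμ
  nonneg := hD
  stab_le t τ hτ p ω := by
    rw [ker_of_le hτ]
    exact norm_stab_le h hd hs hμ hτ p ω
  unst_le t τ hτ p := by
    rw [ker_of_ge hτ]
    refine (norm_unst_le h hd hu hμ hτ p).trans ?_
    have : (ν + ε) * |ell μ τ| ≤ (θ + ε) * |ell μ τ| :=
      mul_le_mul_of_nonneg_right (by linarith) (abs_nonneg _)
    have := Real.exp_le_exp.2 (add_le_add_right this (-β * (ell μ τ - ell μ t)))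
    gcongr

theorem GBound.exp_form (hμ : IsDiffGrowthRate μ) (hg : GBound μ ξ ε γ δ g) (t : ℝ) (φ ψ : C r n) :
    ‖g t φ - g t ψ‖ ≤ δ * min 1 (‖φ - ψ‖ * Real.exp (-((ξ + ε) * |ell μ t|))) *
      (deriv (ell μ) t * Real.exp (-((γ + ε) * |ell μ t|))) := by
  have := hg t φ ψ
  rwa [normMu_eq_exp hμ, mul_assoc _ (deriv μ t),
    show -Real.sign t * (γ + ε) - 1 = Real.sign t * (-(γ + ε)) - 1 by ring, deriv_mul_rpow hμ,
    neg_mul] at this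

theorem DGBound.exp_form (hμ : IsDiffGrowthRate μ) (hg : DGBound μ ξ ε γ lam g) (t : ℝ)
    (φ ψ : C r n) : ‖fderiv ℝ (g t) φ - fderiv ℝ (g t) ψ‖ ≤
      lam * min 1 (‖φ - ψ‖ * Real.exp (-((ξ + ε) * |ell μ t|))) *
        (deriv (ell μ) t * Real.exp (-((γ + ε + 2 * ξ) * |ell μ t|))) := by
  have := hg t φ ψ
  rwa [normMu_eq_exp hμ, mul_assoc _ (deriv μ t),
    show -Real.sign t * (γ + ε) - 2 * Real.sign t * ξ - 1 =
      Real.sign t * (-(γ + ε + 2 * ξ)) - 1 by ring, deriv_mul_rpow hμ, neg_mul] at this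

/-- The hypothesis on `δ` in terms of the Lipschitz constant of `F`. -/
theorem lipConst_mul_le (hD : 0 < D) (hα : 0 < α) (hβ : 0 < β) (hq : 0 < q)
    (hδ : δ ≤ q * α * β / (D * (α + β) * (1 + q) ^ 2)) :
    D * (δ * (1 / α + 1 / β)) * (1 + q) ^ 2 ≤ q := by
  rw [le_div_iff₀ (by positivity)] at hδ
  rw [show D * (δ * (1 / α + 1 / β)) * (1 + q) ^ 2 =
    δ * (D * (α + β) * (1 + q) ^ 2) / (α * β) by field_simp; ring, div_le_iff₀ (by positivity)]
  linarith

/-- The hypothesis on `λ` implies the smallness needed for the derivative, as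
`K/(α+β) ≤ D/(α+β-2ξ)` and `K̃/(ξ-ε+β-a) ≤ 4ξK̃/((ξ-ε)²-(a-β)²)`. -/
theorem derivConst_mul_le (hKD : K ≤ D) (hD : 0 < D) (hKt : 0 ≤ Kt) (hε : 0 < ε)
    (hq : 0 < q) (hlam : 0 ≤ lam) (hξ : |a - β| + ε < ξ) (hξ' : ξ < (α + β) / 2)
    (hl : lam ≤ q ^ 2 * (α + β - 2 * ξ) * ((ξ - ε) ^ 2 - (a - β) ^ 2) /
      (D * (D * ((ξ - ε) ^ 2 - (a - β) ^ 2) + 4 * ξ * Kt * (α + β - 2 * ξ)) * (1 + q) ^ 3)) :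
    D * (lam * (K / (α + β) + Kt / (ξ - ε + β - a))) * (1 + q) ^ 3 ≤ q ^ 2 := by
  obtain ⟨h1, h2⟩ := abs_lt.1 (show |a - β| < ξ - ε by linarith)
  have hξ0 : 0 < ξ := by linarith [abs_nonneg (a - β)]
  have hw : 0 < α + β - 2 * ξ := by linarith
  have hc : 0 < ξ - ε + β - a := by linarith
  have hc' : 0 < ξ - ε - β + a := by linarith
  set w := α + β - 2 * ξ with hwd
  set S := (ξ - ε) ^ 2 - (a - β) ^ 2 with hS
  have hSe : S = (ξ - ε + β - a) * (ξ - ε - β + a) := by rw [hS]; ring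
  have hS0 : 0 < S := by rw [hSe]; positivity
  have e1 : K / (α + β) ≤ D / w := div_le_div₀ hD.le hKD hw (by linarith)
  have e2 : Kt / (ξ - ε + β - a) ≤ 4 * ξ * Kt / S := by
    rw [hSe, div_le_div_iff₀ hc (by positivity)]
    have : ξ - ε - β + a ≤ 4 * ξ := by linarith
    have := mul_le_mul_of_nonneg_left this (mul_nonneg hKt hc.le)
    linarith
  have e3 : D / w + 4 * ξ * Kt / S = (D * S + 4 * ξ * Kt * w) / (w * S) := by
    field_simp
  rw [le_div_iff₀ (by positivity)] at hl
  calc _ ≤ D * (lam * ((D * S + 4 * ξ * Kt * w) / (w * S))) * (1 + q) ^ 3 := by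
        rw [← e3]
        gcongr
    _ = lam * (D * (D * S + 4 * ξ * Kt * w) * (1 + q) ^ 3) / (w * S) := by ring
    _ ≤ _ := by
      rw [div_le_iff₀ (by positivity)]
      linarith

end Hypotheses

end DelayConj

theorem mainTheorem1 (n : ℕ) (r : ℝ) (hr : 0 < r)
    (L : ℝ → DelayConj.C r n →L[ℝ] DelayConj.E n) (hL : DelayConj.Admissible L)
    (μ : ℝ → ℝ) (hμ : DelayConj.IsDiffGrowthRate μ)
    (hH : ∃ N : ℝ, 1 < N ∧ ∀ s, μ (s + r) / μ s ≤ N)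
    (K α β θ ν : ℝ) (P : ℝ → DelayConj.C r n →L[ℝ] DelayConj.C r n)
    (hdich : DelayConj.HasMuDichotomy L μ K α β θ ν P)
    (Kt a ε : ℝ) (hKt : 1 ≤ Kt) (ha : 0 ≤ a) (hε : 0 < ε)
    (hgrowth : DelayConj.HasBoundedGrowth L μ Kt a ε)
    (hθ : ε + ν ≤ θ) (hα : θ + ε < α) (hβ : ν + ε < β) :
    (∃ D : ℝ, K ≤ D ∧ DelayConj.StableBound L P μ α θ ε D ∧
      DelayConj.UnstableBound L P μ β ν ε D) ∧
    ∀ D : ℝ, K ≤ D → DelayConj.StableBound L P μ α θ ε D →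
      DelayConj.UnstableBound L P μ β ν ε D →
    ∀ g : ℝ → DelayConj.C r n → DelayConj.E n,
      (∀ t, g t 0 = 0) →
      ContDiff ℝ 1 (fun p : ℝ × DelayConj.C r n => g p.1 p.2) →
      (∀ t, fderiv ℝ (g t) 0 = 0) →
    ∀ δ γ lam ξ q : ℝ, 0 < δ → max θ ν < γ → 0 < lam → 0 < q →
      max (ν + ε) (|a - β| + ε) < ξ → ξ < (α + β) / 2 →
      DelayConj.GBound μ ξ ε γ δ g →
      DelayConj.DGBound μ ξ ε γ lam g →
      δ ≤ q * α * β / (D * (α + β) * (1 + q) ^ 2) →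
      lam ≤ q ^ 2 * (α + β - 2 * ξ) * ((ξ - ε) ^ 2 - (a - β) ^ 2) /
        (D * (D * ((ξ - ε) ^ 2 - (a - β) ^ 2) + 4 * ξ * Kt * (α + β - 2 * ξ)) * (1 + q) ^ 3) →
    (∀ η : DelayConj.Fam P, DelayConj.MemBall μ ξ ε q η → DelayConj.FConverges L P g η) ∧
    ∃ η : DelayConj.Fam P,
      DelayConj.MemBall μ ξ ε q η ∧ DelayConj.IsFixedPoint L P g η ∧
      (∀ η' : DelayConj.Fam P, DelayConj.MemBall μ ξ ε q η' →
        DelayConj.IsFixedPoint L P g η' → η' = η) ∧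
      DelayConj.MemM η ∧ DelayConj.Conjugates L P g η ∧
      (∀ η' : DelayConj.Fam P, DelayConj.MemM η' → DelayConj.Conjugates L P g η' → η' = η) ∧
      ∀ t : ℝ, DelayConj.IsC1DiffeoOntoImage (DelayConj.hmap η t) := by
  obtain ⟨m, hA⟩ := hL.exists_adm hr
  obtain ⟨N, hN1, hN⟩ := hH
  refine ⟨DelayConj.exists_bounds hA hdich hμ hKt ha hε hN1 hN hgrowth hθ, ?_⟩
  intro D hKD hs hu g hg0 hgs hdg0 δ γ lam ξ q hδ hγ hlam hq hξ hξ' hgb hdgb hδb hlamb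
  have hK := hdich.one_le_K
  have hD : 0 < D := by linarith
  have hξa : |a - β| + ε < ξ := (le_max_right _ _).trans_lt hξ
  have p : DelayConj.Pert L m μ K α β θ ν D P g Kt a ε ξ γ δ lam :=
    { ctx := DelayConj.ctx_of_bounds hA hdich hμ hε hθ hD.le hs hu
      eps_pos := hε
      delta_nonneg := hδ.le
      lam_nonneg := hlam.le
      Kt_nonneg := by linarith
      theta_le := ((le_max_left _ _).trans_lt hγ).le
      nu_lt := (le_max_left _ _).trans_lt hξ
      abs_lt := hξa
      growth := fun s t hst φ =>
        DelayConj.norm_T_le_growth hA hμ (by linarith) hgrowth hst φ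
      g_zero := hg0
      g_smooth := hgs
      dg_zero := hdg0
      g_lip := hgb.exp_form hμ
      dg_lip := hdgb.exp_form hμ }
  have hc₀ := DelayConj.lipConst_mul_le hD hdich.alpha_pos hdich.beta_pos hq hδb
  have hc₁ := DelayConj.derivConst_mul_le hKD hD (by linarith) hε hq hlam.le hξa hξ'
    hlamb
  obtain ⟨η, hη, hfix⟩ := p.exists_fixedPoint hq hc₀ hc₁
  refine ⟨fun η' hη' => p.fConverges hη'.1, η, p.memBall_of_fixedPoint hq hc₀ hc₁ hη hfix,
    (p.isFixedPoint_iff hη.cont).2 hfix, fun η' hη' h' => ?_, p.memM_of_fixedPoint hη.cont hfix,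
    p.conjugates_of_fixedPoint hη.cont hfix, fun η' hη' h' => ?_,
    p.isC1DiffeoOntoImage_hmap hη hfix⟩
  · exact p.fixedPoint_unique hq hc₀ hη.cont hη'.1 hfix ((p.isFixedPoint_iff hη'.1).1 h')
  · exact p.fixedPoint_unique hq hc₀ hη.cont hη'.1 hfix (p.fixedPoint_of_conjugates hη' h')
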